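/- Let $p$ be an irreducible, translation-invariant transition probability on $\mathbb Z^d$ which is asymmetric, i.e. $p(x,y)\ne p(y,x)$ for some $x,y$. Let $a:\mathbb Z^d\to(0,\infty)$ satisfy $\sum_x a_x<\infty$ and, for some $M$, $\sum_y p(x,y)a_y+\sum_y a_yp(y,x)\le Ma_x$ for all $x$. Put $\mathfrak X=\{\eta\in\mathbb N^{\mathbb Z^d}:\sum_x\eta(x)a_x<\infty\}$ and $\|\eta-\zeta\|=\sum_x|\eta(x)-\zeta(x)|a_x$, and let $\mathbf L$ be the set of functions $f:\mathfrak X\to\mathbb R$ that are Lipschitz for this distance. Let $g^k_{*,\beta}\ge 0$ ($k\ge1$, $\beta\ge0$) be the rates of a mass-migration target process: $g^k_{\alpha,\beta}=\mathbf 1_{\{1\le k\le\alpha\}}\,g^k_{*,\beta}$ is such that $k$ particles jump together from a site $x$ with $\alpha$ particles to a site $y$ with $\beta$ particles at rate $p(x,y)g^k_{\alpha,\beta}$. Assume that for some $C>0$, $\sum_{k=1}^{\alpha}k\,g^k_{\alpha,\beta}\le C(\alpha+\beta)$ for all $\alpha>0$, $\beta\ge0$. The generator is $$\mathcal Lf(\eta)=\sum_{x,y}\sum_{k\ge1}p(x,y)\,g^k_{\eta(x),\eta(y)}\bigl(f(S^k_{x,y}\eta)-f(\eta)\bigr),\qquad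 f\in\mathbf L,\ \eta\in\mathfrak X,$$ where $S^k_{x,y}\eta$ is $\eta$ with $k$ particles moved from $x$ to $y$. A Markov semigroup with generator $\mathcal L$ is a family $(S(t))_{t\ge0}$ of positive linear operators $\mathbf L\to\mathbf L$ with $S(t)1=1$, $S(0)=I$, $S(s+t)=S(s)S(t)$, such that for each $f\in\mathbf L$ the Lipschitz constants of $S(t)f$ are bounded on bounded time intervals and $\frac{d}{dt}S(t)f(\eta)=\mathcal LS(t)f(\eta)$ for all $\eta\in\mathfrak X$, $t\ge0$. A probability measure $\nu$ on $\mathbb N^{\mathbb Z^d}$ is invariant for the process with semigroup $S$ if $\nu(\mathfrak X)=1$ and $\int S(t)f\,d\nu=\int f\,d\nu$ for all bounded $f\in\mathbf L$ and all $t\ge0$. Let $\mu$ be a probability measure on $\mathbb N$ with $\mu(n)>0$ for all $n$ and $\sum_n n\mu(n)<\infty$, and let $\bar\mu$ be the product measure on $\mathbb N^{\mathbb Z^d}$ with all marginals equal to $\mu$. Then for every Markov semigroup with generator $\mathcal L$, the measure $\bar\mu$ is invariant if and only if $$g^{\alpha}_{*,\beta}=g^{\alpha}_{*,0}+\frac1{\mu(\beta)}\sum_{k=1}^{\beta}H_\alpha(\beta,k)\,g^k_{*,0}\qquad\text{for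 all }\alpha\ge1,\ \beta\ge1,$$ where $H_\alpha(\beta,k)$ ($\alpha\ge1$, $1\le k\le\beta$) is determined by $$H_\alpha(\beta,\beta)=\Delta_\alpha(\beta)\mu(0),\qquad H_\alpha(\beta,k)=\Delta_\alpha(k)\mu(\beta-k)+\sum_{l=1}^{\beta-k}\Delta_\alpha(l)H_l(\beta-l,k)\quad(1\le k<\beta),$$ $$\Delta_r(s)=\frac{\mu(r+s)}{\mu(r)}-\frac{\mu(r+s-1)}{\mu(r-1)}\qquad(r\ge1,\ s\ge0).$$ Moreover, if for some $C>0$ the rates satisfy $\sum_{k=1}^{\alpha\vee\gamma}k\,|g^k_{\alpha,\beta}-g^k_{\gamma,\delta}|\le C(|\alpha-\gamma|+|\beta-\delta|)$ for all $\alpha,\beta,\gamma,\delta\ge0$, then such a semigroup exists, namely $S(t)f(\eta)=\lim_{\Lambda\uparrow\mathbb Z^d}e^{t\mathcal L_\Lambda}f(\eta)$ for $f\in\mathbf L$, $\eta\in\mathfrak X$, $t\ge 0$ (the limit along the finite sets $\Lambda\subset\mathbb Z^d$ ordered by inclusion exists), where $\mathcal L_\Lambda$ is the generator with the sum restricted to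 $x,y\in\Lambda$; so the equivalence holds for the process constructed in this way. -/

import Mathlib

open Filter Topology MeasureTheory

namespace MassMigration

section Dynamics

variable {V : Type*} [DecidableEq V]

/-- `p` is a transition probability on the set of sites `V`. -/
structure IsTransitionProbability (p : V → V → ℝ) : Prop where
  nonneg : ∀ x y, 0 ≤ p x y
  hasSum_one : ∀ x, HasSum (p x) 1

/-- Irreducibility: any site can be reached from any other through steps of positive probability. -/
def IsIrreducible (p : V → V → ℝ) : Prop :=
  ∀ x y, Relation.ReflTransGen (fun u v => 0 < p u v) x y

/-- The weights `a` used to define the norm on configurations: positive, summable and almost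
superharmonic, for `p` and for its transpose. -/
structure IsWeight (p : V → V → ℝ) (a : V → ℝ) : Prop where
  pos : ∀ x, 0 < a x
  summable : Summable a
  bound : ∃ M : ℝ, ∀ x, ∑' y, p x y * a y + ∑' y, a y * p y x ≤ M * a x

/-- The state space: configurations `η` with `∑ x, η x * a x < ∞`. -/
def stateSpace (a : V → ℝ) : Set (V → ℕ) :=
  {η | Summable fun x => (η x : ℝ) * a x}

/-- The distance `‖η - ζ‖ = ∑ x, |η x - ζ x| * a x`. -/
noncomputable def configDist (a : V → ℝ) (η ζ : V → ℕ) : ℝ :=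
  ∑' x, |(η x : ℝ) - (ζ x : ℝ)| * a x

/-- `f` is Lipschitz on the state space with constant `K`. -/
def LipschitzBound (a : V → ℝ) (K : ℝ) (f : stateSpace a → ℝ) : Prop :=
  ∀ η ζ : stateSpace a, |f η - f ζ| ≤ K * configDist a η ζ

/-- The set of Lipschitz functions on the state space. -/
def IsLip (a : V → ℝ) (f : stateSpace a → ℝ) : Prop :=
  ∃ K : ℝ, LipschitzBound a K f

/-- The configuration after `k` particles have been moved from `x` to `y` (nothing happens if there
are fewer than `k` particles at `x`, or if `x = y`). -/
def jump (x y : V) (k : ℕ) (η : V → ℕ) : V → ℕ :=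
  if k ≤ η x then
    fun z => (η z - if z = x then k else 0) + if z = y then k else 0
  else η

theorem jump_mem {a : V → ℝ} (x y : V) (k : ℕ) {η : V → ℕ} (hη : η ∈ stateSpace a) :
    jump x y k η ∈ stateSpace a := by
  unfold jump
  split_ifs with h
  · refine (summable_congr_cofinite ?_).1 hη
    rw [EventuallyEq, Filter.eventually_cofinite]
    refine (Set.toFinite ({x, y} : Set V)).subset ?_
    intro z hz
    by_contra hzn
    simp only [Set.mem_insert_iff, Set.mem_singleton_iff, not_or] at hzn
    apply hz
    simp [hzn.1, hzn.2]
  · exact hη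

/-- `jump` as a map of the state space into itself. -/
def jumpState {a : V → ℝ} (x y : V) (k : ℕ) (η : stateSpace a) : stateSpace a :=
  ⟨jump x y k η, jump_mem x y k η.2⟩

/-- `∑ k, p(x,y) g^k_{η(x),η(y)} (f(S^k_{x,y} η) - f(η))`, the contribution of the jumps from `x` to
`y` to the generator. Here and below, `g k α β` is the rate `g^k_{α,β}`, which vanishes unless
`1 ≤ k ≤ α`. -/
noncomputable def bondGenerator {a : V → ℝ} (p : V → V → ℝ) (g : ℕ → ℕ → ℕ → ℝ)
    (x y : V) (f : stateSpace a → ℝ) (η : stateSpace a) : ℝ :=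
  ∑ k ∈ Finset.Icc 1 (η.1 x), p x y * g k (η.1 x) (η.1 y) * (f (jumpState x y k η) - f η)

/-- The generator `ℒ` of the mass migration process. -/
noncomputable def generator {a : V → ℝ} (p : V → V → ℝ) (g : ℕ → ℕ → ℕ → ℝ)
    (f : stateSpace a → ℝ) (η : stateSpace a) : ℝ :=
  ∑' xy : V × V, bondGenerator p g xy.1 xy.2 f η

/-- The generator of the process restricted to the finite set of sites `Λ`: only jumps between two
sites of `Λ` are allowed. -/
noncomputable def finiteGenerator {a : V → ℝ} (p : V → V → ℝ) (g : ℕ → ℕ → ℕ → ℝ)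
    (Λ : Finset V) (f : stateSpace a → ℝ) (η : stateSpace a) : ℝ :=
  ∑ x ∈ Λ, ∑ y ∈ Λ, bondGenerator p g x y f η

/-- The semigroup `exp (t ℒ_Λ)` of the process restricted to `Λ`. From a given configuration only
finitely many others can be reached, so that this is the exponential of a finite `Q`-matrix. -/
noncomputable def finiteSemigroup {a : V → ℝ} (p : V → V → ℝ) (g : ℕ → ℕ → ℕ → ℝ)
    (Λ : Finset V) (t : ℝ) (f : stateSpace a → ℝ) (η : stateSpace a) : ℝ :=
  ∑' j : ℕ, t ^ j / (j.factorial : ℝ) * ((finiteGenerator p g Λ)^[j] f) η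

/-- The semigroup of the mass migration process constructed as the infinite-volume limit. -/
noncomputable def limitSemigroup {a : V → ℝ} (p : V → V → ℝ) (g : ℕ → ℕ → ℕ → ℝ)
    (t : ℝ) (f : stateSpace a → ℝ) (η : stateSpace a) : ℝ :=
  limUnder atTop fun Λ : Finset V => finiteSemigroup p g Λ t f η

/-- `S` is a Markov semigroup on the Lipschitz functions with generator `ℒ`: it maps Lipschitz
functions to Lipschitz functions (with constants that are locally bounded in time), it is a
semigroup of positive linear operators that preserve constants, and `d/dt S(t)f = ℒ S(t)f`
pointwise. -/
structure IsMarkovSemigroup (a : V → ℝ) (p : V → V → ℝ) (g : ℕ → ℕ → ℕ → ℝ)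
    (S : ℝ → (stateSpace a → ℝ) → stateSpace a → ℝ) : Prop where
  lip : ∀ f, IsLip a f → ∀ T : ℝ, ∃ K : ℝ, ∀ t, 0 ≤ t → t ≤ T → LipschitzBound a K (S t f)
  zero : ∀ f, IsLip a f → S 0 f = f
  add : ∀ f, IsLip a f → ∀ s t, 0 ≤ s → 0 ≤ t → S (s + t) f = S s (S t f)
  linear : ∀ f h, IsLip a f → IsLip a h → ∀ b c t : ℝ, 0 ≤ t →
    S t (fun η => b * f η + c * h η) = fun η => b * S t f η + c * S t h η
  nonneg : ∀ f, IsLip a f → (∀ η, 0 ≤ f η) → ∀ t, 0 ≤ t → ∀ η, 0 ≤ S t f η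
  one : ∀ t, 0 ≤ t → S t (fun _ => 1) = fun _ => 1
  backward : ∀ f, IsLip a f → ∀ η t, 0 ≤ t →
    HasDerivWithinAt (fun s => S s f η) (generator p g (S t f) η) (Set.Ici 0) t

/-- `ν` is invariant for the process with semigroup `S`: it is supported on the state space, and
`∫ S(t)f dν = ∫ f dν` for all bounded Lipschitz `f` and all `t ≥ 0`. -/
def IsInvariantMeasure (a : V → ℝ) (S : ℝ → (stateSpace a → ℝ) → stateSpace a → ℝ)
    (ν : Measure (V → ℕ)) : Prop :=
  (∀ᵐ η ∂ν, η ∈ stateSpace a) ∧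
  ∀ f, IsLip a f → (∃ B : ℝ, ∀ η, |f η| ≤ B) → ∀ t, 0 ≤ t →
    ∫ η, S t f η ∂(ν.comap Subtype.val) = ∫ η, f η ∂(ν.comap Subtype.val)

end Dynamics

/-- Linear growth of the rates: `∑_{k ≤ α} k g^k_{α,β} ≤ C (α + β)`. -/
def LinearGrowth (g : ℕ → ℕ → ℕ → ℝ) : Prop :=
  ∃ C : ℝ, 0 < C ∧ ∀ α β : ℕ, 0 < α →
    ∑ k ∈ Finset.Icc 1 α, (k : ℝ) * g k α β ≤ C * ((α : ℝ) + β)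

/-- Lipschitz rates: `∑_{k ≤ α ∨ γ} k |g^k_{α,β} - g^k_{γ,δ}| ≤ C (|α - γ| + |β - δ|)`. -/
def LipschitzRates (g : ℕ → ℕ → ℕ → ℝ) : Prop :=
  ∃ C : ℝ, 0 < C ∧ ∀ α β γ δ : ℕ,
    ∑ k ∈ Finset.Icc 1 (max α γ), (k : ℝ) * |g k α β - g k γ δ| ≤
      C * (|(α : ℝ) - γ| + |(β : ℝ) - δ|)

/-- The rates `g^k_{α,β} = 1_{1 ≤ k ≤ α} g^k_{*,β}` of a mass migration target process, where
`r k β` is `g^k_{*,β}`. -/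
def targetRate (r : ℕ → ℕ → ℝ) (k α β : ℕ) : ℝ :=
  if 1 ≤ k ∧ k ≤ α then r k β else 0

/-- `Δ_r(s) = m(r+s)/m(r) - m(r+s-1)/m(r-1)`, used for `r ≥ 1` only. -/
noncomputable def Delta (m : ℕ → ℝ) (r s : ℕ) : ℝ :=
  m (r + s) / m r - m (r + s - 1) / m (r - 1)

/-- The coefficients `H_α(β,k)`, used for `α ≥ 1` and `1 ≤ k ≤ β` only. The index `l` of the sum in
the recursion is shifted by one; see `H_of_lt`. -/
noncomputable def H (m : ℕ → ℝ) (α β k : ℕ) : ℝ :=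
  if k = β then Delta m α β * m 0
  else Delta m α k * m (β - k) +
    ∑ l : Fin (β - k), Delta m α (l + 1) * H m (l + 1) (β - (l + 1)) k
termination_by β
decreasing_by
  have := l.isLt
  omega

theorem H_self (m : ℕ → ℝ) (α β : ℕ) : H m α β β = Delta m α β * m 0 := by
  rw [H]; simp

theorem H_of_lt (m : ℕ → ℝ) (α β k : ℕ) (hk : k < β) :
    H m α β k = Delta m α k * m (β - k) +
      ∑ l ∈ Finset.Icc 1 (β - k), Delta m α l * H m l (β - l) k := by
  rw [H, if_neg hk.ne]
  congr 1
  rw [Fin.sum_univ_eq_sum_range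
    (fun l => Delta m α (l + 1) * H m (l + 1) (β - (l + 1)) k) (β - k)]
  rw [Finset.range_eq_Ico, Finset.sum_Ico_add'
    (fun l => Delta m α l * H m l (β - l) k) 0 (β - k) 1]
  rfl

end MassMigration

/-! Under a product measure the jumps across one bond can be moved onto the constant function: for
`x ≠ y` and bounded measurable `f`, the mean of the `x → y` part of the generator applied to `f` is
the mean of `f η * flux (η x) (η y)`, where `flux` is gain minus loss of a pair of occupation
numbers relative to its product weight (`integral_jump_sub`). Invariance amounts to mean zero of `ℒ
f` for every bounded Lipschitz `f`, because `d/dt ∫ S(t)f = ∫ ℒ S(t)f` and `S(t)f` is again bounded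
and Lipschitz (`IsMarkovSemigroup.isInvariantMeasure_iff`).

Split the flux as `φ₁(α) + φ₂(β) + Ψ(α,β)` with `φ₁`, `φ₂` centred and both marginals of `Ψ` zero.
Tested against a function of the coordinates in a finite `Λ`, every term that contains a centred
coordinate outside `Λ` integrates to zero. Translation invariance makes `p` doubly stochastic, so
what survives is `(1 - p(x,x)) (φ₁ + φ₂)(η x)` summed over `Λ`, plus `p(x,y) Ψ(η x, η y)` over the
bonds inside `Λ` (`integral_generator_cylinder`). This vanishes if `φ₁ + φ₂ = 0` and `Ψ = 0`.
Conversely, take sites with `p(u,v) ≠ p(v,u)` and test with indicators of the two values there.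
Integrating out one value gives `φ₁ + φ₂ = 0`; the remaining equation and its transpose form a
linear system of determinant `p(u,v)² - p(v,u)² ≠ 0`, so `Ψ = 0`. Invariance thus says that the flux
is a difference `φ(α) - φ(β)`.

The rest of the equivalence is algebra. Differencing the flux in `α` turns this property into a
recursion for `r α β` in terms of `r k (β - k)` (`StepCondition`); the recursion together with
conservation of particles on a bond gives the property back. Unrolling the recursion down to second
index zero produces the coefficients `H` (`stepCondition_iff`).

For existence, particle number in `Λ` is conserved, so `exp(t ℒ_Λ)` is locally a matrix exponential,
and also a Poisson average of powers of `1 + R⁻¹ ℒ_Λ`. Positivity, the Lipschitz bound (by coupling)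
and the growth of Lyapunov functions need only be checked for one such step. Two volumes are
compared by Duhamel's formula; the error is measured by a weight that tends to zero as `Λ` grows and
is still almost superharmonic, namely a resolvent of `p` applied to the flow through bonds not
contained in `Λ`. -/

open Filter Topology MeasureTheory

namespace MassMigration

/-! ### Kernel and weight estimates, and the bound on a single bond. -/

section Basics

variable {V : Type*}

/-- A doubly stochastic kernel together with an adapted weight. -/
structure AdmissibleKernel (p : V → V → ℝ) (a : V → ℝ) (M : ℝ) : Prop where
  nonneg : ∀ x y, 0 ≤ p x y
  row : ∀ x, HasSum (p x) 1
  col : ∀ y, HasSum (fun x => p x y) 1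
  pos : ∀ x, 0 < a x
  summable : Summable a
  M_pos : 0 < M
  row_weight : ∀ x, ∑' y, p x y * a y ≤ M * a x
  col_weight : ∀ x, ∑' y, a y * p y x ≤ M * a x

/-- Nonnegative jump rates supported on `k ≤ α` and of linear growth. -/
structure RateBounds (g : ℕ → ℕ → ℕ → ℝ) (C : ℝ) : Prop where
  nonneg : ∀ k α β, 0 ≤ g k α β
  supp : ∀ k α β, α < k → g k α β = 0
  pos : 0 < C
  growth : ∀ α β : ℕ, ∑ k ∈ Finset.Icc 1 α, (k : ℝ) * g k α β ≤ C * ((α : ℝ) + β)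

variable {p : V → V → ℝ} {a : V → ℝ} {M : ℝ}

theorem AdmissibleKernel.le_one (h : AdmissibleKernel p a M) (x y : V) : p x y ≤ 1 :=
  le_hasSum (h.row x) y fun z _ => h.nonneg x z

theorem summable_prod_kernel {q : V → V → ℝ} {v b : V → ℝ} (hq : ∀ x y, 0 ≤ q x y)
    (hs : ∀ x, Summable (q x)) (hb : ∀ x, ∑' y, q x y ≤ b x) (hv : ∀ x, 0 ≤ v x)
    (hvb : Summable fun x => v x * b x) :
    Summable (fun xy : V × V => v xy.1 * q xy.1 xy.2) ∧
      ∑' xy : V × V, v xy.1 * q xy.1 xy.2 ≤ ∑' x, v x * b x := by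
  have h1 : ∀ x, ∑' y, v x * q x y ≤ v x * b x := fun x => by
    rw [tsum_mul_left]; exact mul_le_mul_of_nonneg_left (hb x) (hv x)
  have h0 : ∀ x, 0 ≤ ∑' y, v x * q x y := fun x => tsum_nonneg fun y => mul_nonneg (hv x) (hq x y)
  have h2 : Summable fun x => ∑' y, v x * q x y := Summable.of_nonneg_of_le h0 h1 hvb
  have h3 : Summable (fun xy : V × V => v xy.1 * q xy.1 xy.2) := by
    have h4 : (0 : V × V → ℝ) ≤ fun xy => v xy.1 * q xy.1 xy.2 :=
      fun xy => mul_nonneg (hv xy.1) (hq xy.1 xy.2)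
    exact (summable_prod_of_nonneg h4).2 ⟨fun x => (hs x).mul_left (v x), h2⟩
  refine ⟨h3, ?_⟩
  rw [h3.tsum_prod' fun x => (hs x).mul_left (v x)]
  exact h2.tsum_le_tsum h1 hvb

namespace AdmissibleKernel

theorem summable_row_weight (h : AdmissibleKernel p a M) (x : V) :
    Summable fun y => p x y * a y :=
  Summable.of_nonneg_of_le (fun _ => mul_nonneg (h.nonneg _ _) (h.pos _).le)
    (fun y => mul_le_of_le_one_left (h.pos y).le (h.le_one x y)) h.summable

theorem summable_col_weight (h : AdmissibleKernel p a M) (x : V) :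
    Summable fun y => a y * p y x :=
  Summable.of_nonneg_of_le (fun _ => mul_nonneg (h.pos _).le (h.nonneg _ _))
    (fun y => mul_le_of_le_one_right (h.pos y).le (h.le_one y x)) h.summable

/-- Charge each unit of `u` once as source and once as target of a bond. Row sums and `p a ≤ M a`
bound the first charge by `(M + 1) a`, column sums and the transposed inequality the second. This is
the source of every domination of the generator below. -/
theorem summable_pair (h : AdmissibleKernel p a M) {u : V → ℝ} (hu : ∀ x, 0 ≤ u x)
    (hs : Summable fun x => u x * a x) :
    Summable (fun xy : V × V => p xy.1 xy.2 * (u xy.1 + u xy.2) * (a xy.1 + a xy.2)) ∧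
      ∑' xy : V × V, p xy.1 xy.2 * (u xy.1 + u xy.2) * (a xy.1 + a xy.2) ≤
        (2 * M + 2) * ∑' x, u x * a x := by
  have hr : ∀ x, ∑' y, p x y * (a x + a y) ≤ (M + 1) * a x := fun x => by
    have := h.row_weight x
    simp_rw [mul_add]
    rw [((h.row x).summable.mul_right _).tsum_add (h.summable_row_weight x), tsum_mul_right,
      (h.row x).tsum_eq]
    linarith
  have hc : ∀ x, ∑' y, p y x * (a y + a x) ≤ (M + 1) * a x := fun x => by
    have := h.col_weight x
    simp_rw [mul_add]
    rw [Summable.tsum_add (by simpa [mul_comm] using h.summable_col_weight x)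
      ((h.col x).summable.mul_right _), tsum_mul_right, (h.col x).tsum_eq]
    simp_rw [mul_comm (p _ x)]
    linarith
  have hsm : Summable fun x => u x * ((M + 1) * a x) := by
    simpa [mul_left_comm] using hs.mul_left (M + 1)
  obtain ⟨s1, t1⟩ := summable_prod_kernel (q := fun x y => p x y * (a x + a y)) (v := u)
    (fun x y => mul_nonneg (h.nonneg _ _) (add_pos (h.pos _) (h.pos _)).le)
    (fun x => by simpa [mul_add] using
      ((h.row x).summable.mul_right _).add (h.summable_row_weight x)) hr hu hsm
  obtain ⟨s2, t2⟩ := summable_prod_kernel (q := fun x y => p y x * (a y + a x)) (v := u)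
    (fun x y => mul_nonneg (h.nonneg _ _) (add_pos (h.pos _) (h.pos _)).le)
    (fun x => by
      have := (h.summable_col_weight x).add ((h.col x).summable.mul_right (a x))
      refine this.congr fun y => by ring) hc hu hsm
  have e : (fun xy : V × V => p xy.1 xy.2 * (u xy.1 + u xy.2) * (a xy.1 + a xy.2)) =
      fun xy : V × V => u xy.1 * (p xy.1 xy.2 * (a xy.1 + a xy.2)) +
        u xy.2 * (p xy.1 xy.2 * (a xy.1 + a xy.2)) := by
    funext xy; ring
  have s2' : Summable fun xy : V × V => u xy.2 * (p xy.1 xy.2 * (a xy.1 + a xy.2)) :=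
    (Equiv.prodComm V V).summable_iff.1 s2
  have t2' : ∑' xy : V × V, u xy.2 * (p xy.1 xy.2 * (a xy.1 + a xy.2)) ≤
      ∑' x, u x * ((M + 1) * a x) := by
    rw [← (Equiv.prodComm V V).tsum_eq]; exact t2
  rw [e]
  refine ⟨s1.add s2', ?_⟩
  rw [s1.tsum_add s2']
  have : ∑' x, u x * ((M + 1) * a x) = (M + 1) * ∑' x, u x * a x := by
    rw [← tsum_mul_left]; congr 1; funext x; ring
  linarith

theorem sum_pair_le (h : AdmissibleKernel p a M) {u : V → ℝ} (hu : ∀ x, 0 ≤ u x)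
    (hs : Summable fun x => u x * a x) (Λ : Finset V) :
    ∑ x ∈ Λ, ∑ y ∈ Λ, p x y * (u x + u y) * (a x + a y) ≤ (2 * M + 2) * ∑' x, u x * a x := by
  rw [← Finset.sum_product' Λ Λ fun x y => p x y * (u x + u y) * (a x + a y)]
  refine ((h.summable_pair hu hs).1.sum_le_tsum _ fun xy _ => ?_).trans (h.summable_pair hu hs).2
  exact mul_nonneg (mul_nonneg (h.nonneg _ _) (add_nonneg (hu _) (hu _)))
    (add_pos (h.pos _) (h.pos _)).le

end AdmissibleKernel

theorem summable_abs_sub (ha : ∀ x, 0 ≤ a x) (η ζ : stateSpace a) :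
    Summable fun x => |(η.1 x : ℝ) - (ζ.1 x : ℝ)| * a x := by
  refine Summable.of_nonneg_of_le (fun x => mul_nonneg (abs_nonneg _) (ha x)) (fun x => ?_)
    (Summable.add η.2 ζ.2)
  rw [← add_mul]
  refine mul_le_mul_of_nonneg_right ?_ (ha x)
  refine (abs_sub _ _).trans ?_
  simp

theorem configDist_nonneg (ha : ∀ x, 0 ≤ a x) (η ζ : V → ℕ) : 0 ≤ configDist a η ζ :=
  tsum_nonneg fun x => mul_nonneg (abs_nonneg _) (ha x)

theorem LipschitzBound.mono (ha : ∀ x, 0 ≤ a x) {K K' : ℝ} (hK : K ≤ K') {f : stateSpace a → ℝ}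
    (hf : LipschitzBound a K f) : LipschitzBound a K' f := fun η ζ =>
  (hf η ζ).trans (mul_le_mul_of_nonneg_right hK (configDist_nonneg ha _ _))

theorem IsLip.exists_nonneg (ha : ∀ x, 0 ≤ a x) {f : stateSpace a → ℝ} (hf : IsLip a f) :
    ∃ K : ℝ, 0 ≤ K ∧ LipschitzBound a K f := by
  obtain ⟨K, hK⟩ := hf
  exact ⟨|K|, abs_nonneg _, hK.mono ha (le_abs_self K)⟩

theorem summable_state_pair (h : AdmissibleKernel p a M) (η : stateSpace a) :
    Summable fun xy : V × V =>
      p xy.1 xy.2 * ((η.1 xy.1 : ℝ) + η.1 xy.2) * (a xy.1 + a xy.2) :=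
  (h.summable_pair (u := fun x => (η.1 x : ℝ)) (fun _ => Nat.cast_nonneg _) η.2).1

variable [DecidableEq V]

theorem jump_of_le {x y : V} {k : ℕ} {η : V → ℕ} (h : k ≤ η x) (z : V) :
    (jump x y k η z : ℝ) = η z - (if z = x then (k : ℝ) else 0) + if z = y then (k : ℝ) else 0 := by
  rw [jump, if_pos h]
  have : (if z = x then k else 0) ≤ η z := by
    split_ifs with hz
    · exact hz ▸ h
    · exact Nat.zero_le _
  push_cast [this]
  split_ifs <;> simp

theorem jump_self (x : V) (k : ℕ) (η : V → ℕ) : jump x x k η = η := by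
  unfold jump
  split_ifs with h
  · funext z
    split_ifs with hz
    · subst hz; omega
    · simp
  · rfl

theorem configDist_jump_jump {x y : V} {k : ℕ} {η ζ : V → ℕ} (h1 : k ≤ η x) (h2 : k ≤ ζ x) :
    configDist a (jump x y k η) (jump x y k ζ) = configDist a η ζ := by
  unfold configDist
  congr 1
  funext z
  rw [jump_of_le h1, jump_of_le h2]
  congr 2
  ring

theorem configDist_jump_le (ha : ∀ x, 0 ≤ a x) (x y : V) (k : ℕ) (η : V → ℕ) :
    configDist a (jump x y k η) η ≤ k * (a x + a y) := by
  have hk : (0 : ℝ) ≤ k := Nat.cast_nonneg k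
  by_cases h : k ≤ η x
  · unfold configDist
    have hs : ∀ w : V, HasSum (fun z => if z = w then (k : ℝ) * a w else 0) (k * a w) := fun w =>
      hasSum_ite_eq w _
    have hb : ∀ z, |(jump x y k η z : ℝ) - η z| * a z ≤
        (if z = x then (k : ℝ) * a x else 0) + if z = y then (k : ℝ) * a y else 0 := by
      intro z
      rw [jump_of_le h]
      have h3 : (η z - (if z = x then (k : ℝ) else 0) + (if z = y then (k : ℝ) else 0) - η z) =
        (if z = y then (k : ℝ) else 0) - (if z = x then (k : ℝ) else 0) := by ring
      rw [h3]
      have := mul_nonneg hk (ha z)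
      split_ifs with h4 h5 h5
      · subst h4 h5; simpa using add_nonneg this this
      · subst h4; simp
      · subst h5; simp
      · simp
    have hsum := (hs x).add (hs y)
    rw [mul_add, ← hsum.tsum_eq]
    exact (Summable.of_nonneg_of_le (fun z => mul_nonneg (abs_nonneg _) (ha z)) hb
      hsum.summable).tsum_le_tsum hb hsum.summable
  · rw [jump, if_neg h]
    simp only [configDist, sub_self, abs_zero, zero_mul, tsum_zero]
    exact mul_nonneg hk (add_nonneg (ha _) (ha _))

variable {g : ℕ → ℕ → ℕ → ℝ} {C : ℝ}

theorem LipschitzBound.jump_sub (ha : ∀ x, 0 ≤ a x) {K : ℝ} (hK : 0 ≤ K) {f : stateSpace a → ℝ}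
    (hf : LipschitzBound a K f) (x y : V) (k : ℕ) (η : stateSpace a) :
    |f (jumpState x y k η) - f η| ≤ K * (k * (a x + a y)) :=
  (hf _ _).trans (mul_le_mul_of_nonneg_left (configDist_jump_le ha x y k η.1) hK)

/-- Moving `k` particles displaces the configuration by at most `k (a x + a y)`, and the growth
condition bounds exactly the `k`-weighted sum of the rates. -/
theorem abs_bondGenerator_le (h : AdmissibleKernel p a M) (hg : RateBounds g C)
    {K : ℝ} (hK : 0 ≤ K) {f : stateSpace a → ℝ} (hf : LipschitzBound a K f) (x y : V)
    (η : stateSpace a) :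
    |bondGenerator p g x y f η| ≤ K * C * (p x y * (η.1 x + η.1 y) * (a x + a y)) := by
  unfold bondGenerator
  refine (Finset.abs_sum_le_sum_abs _ _).trans ?_
  have hb : ∀ k ∈ Finset.Icc 1 (η.1 x),
      |p x y * g k (η.1 x) (η.1 y) * (f (jumpState x y k η) - f η)| ≤
        (K * p x y * (a x + a y)) * (k * g k (η.1 x) (η.1 y)) := by
    intro k _
    rw [abs_mul, abs_of_nonneg (mul_nonneg (h.nonneg _ _) (hg.nonneg _ _ _))]
    refine (mul_le_mul_of_nonneg_left (hf.jump_sub (fun x => (h.pos x).le) hK x y k η)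
      (mul_nonneg (h.nonneg _ _) (hg.nonneg _ _ _))).trans (le_of_eq ?_)
    ring
  refine (Finset.sum_le_sum hb).trans ?_
  rw [← Finset.mul_sum]
  have h1 := hg.growth (η.1 x) (η.1 y)
  have h2 : 0 ≤ K * p x y * (a x + a y) :=
    mul_nonneg (mul_nonneg hK (h.nonneg _ _)) (add_pos (h.pos _) (h.pos _)).le
  refine (mul_le_mul_of_nonneg_left h1 h2).trans (le_of_eq ?_)
  ring

theorem summable_bondGenerator (h : AdmissibleKernel p a M) (hg : RateBounds g C)
    {f : stateSpace a → ℝ} (hf : IsLip a f) (η : stateSpace a) :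
    Summable fun xy : V × V => bondGenerator p g xy.1 xy.2 f η := by
  obtain ⟨K, hK, hf⟩ := hf.exists_nonneg fun x => (h.pos x).le
  exact Summable.of_norm_bounded ((summable_state_pair h η).mul_left (K * C))
    fun xy => abs_bondGenerator_le h hg hK hf xy.1 xy.2 η

end Basics

/-! ### Finite-volume semigroups as matrix exponentials. -/

section FiniteVolume

variable {V : Type*} [DecidableEq V] {p : V → V → ℝ} {a : V → ℝ} {M : ℝ}
  {g : ℕ → ℕ → ℕ → ℝ} {C : ℝ}

theorem bondGenerator_add (x y : V) (f h : stateSpace a → ℝ) (η : stateSpace a) :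
    bondGenerator p g x y (f + h) η = bondGenerator p g x y f η + bondGenerator p g x y h η := by
  simp only [bondGenerator, Pi.add_apply]
  rw [← Finset.sum_add_distrib]
  exact Finset.sum_congr rfl fun k _ => by ring

theorem bondGenerator_smul (x y : V) (c : ℝ) (f : stateSpace a → ℝ) (η : stateSpace a) :
    bondGenerator p g x y (c • f) η = c * bondGenerator p g x y f η := by
  simp only [bondGenerator, Pi.smul_apply, smul_eq_mul]
  rw [Finset.mul_sum]
  exact Finset.sum_congr rfl fun k _ => by ring

/-- The finite-volume generator as a linear map. -/
noncomputable def finiteGeneratorLin (p : V → V → ℝ) (g : ℕ → ℕ → ℕ → ℝ) (Λ : Finset V) :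
    (stateSpace a → ℝ) →ₗ[ℝ] (stateSpace a → ℝ) where
  toFun := finiteGenerator p g Λ
  map_add' f h := by
    funext η
    simp only [finiteGenerator, bondGenerator_add, Finset.sum_add_distrib, Pi.add_apply]
  map_smul' c f := by
    funext η
    simp only [finiteGenerator, bondGenerator_smul, Finset.mul_sum, Pi.smul_apply, smul_eq_mul,
      RingHom.id_apply]

/-- A set of configurations which is closed under the jumps inside `Λ`. -/
def JumpClosed (Λ : Finset V) (O : Set (stateSpace a)) : Prop :=
  ∀ ξ ∈ O, ∀ x ∈ Λ, ∀ y ∈ Λ, ∀ k, jumpState x y k ξ ∈ O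

theorem JumpClosed.mono {Λ Λ' : Finset V} (h : Λ ⊆ Λ') {O : Set (stateSpace a)}
    (hO : JumpClosed Λ' O) : JumpClosed Λ O :=
  fun ξ hξ x hx y hy k => hO ξ hξ x (h hx) y (h hy) k

theorem finiteGenerator_congr {Λ : Finset V} {O : Set (stateSpace a)} (hO : JumpClosed Λ O)
    {f h : stateSpace a → ℝ} (hfh : ∀ ξ ∈ O, f ξ = h ξ) {ξ : stateSpace a} (hξ : ξ ∈ O) :
    finiteGenerator p g Λ f ξ = finiteGenerator p g Λ h ξ := by
  unfold finiteGenerator bondGenerator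
  refine Finset.sum_congr rfl fun x hx => Finset.sum_congr rfl fun y hy =>
    Finset.sum_congr rfl fun k _ => ?_
  rw [hfh _ hξ, hfh _ (hO ξ hξ x hx y hy k)]

theorem sum_jump {Λ : Finset V} {x y : V} (hx : x ∈ Λ) (hy : y ∈ Λ) (k : ℕ) (η : V → ℕ) :
    ∑ z ∈ Λ, jump x y k η z = ∑ z ∈ Λ, η z := by
  by_cases h : k ≤ η x
  · have : ((∑ z ∈ Λ, jump x y k η z : ℕ) : ℝ) = (∑ z ∈ Λ, η z : ℕ) := by
      push_cast
      simp_rw [jump_of_le h]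
      rw [Finset.sum_add_distrib, Finset.sum_sub_distrib]
      simp [hx, hy]
    exact_mod_cast this
  · rw [jump, if_neg h]

theorem jump_of_ne {x y z : V} (k : ℕ) (η : V → ℕ) (hx : z ≠ x) (hy : z ≠ y) :
    jump x y k η z = η z := by
  unfold jump
  split_ifs <;> simp [hx, hy]

/-- The configurations with at most `N` particles in `Λ`. -/
def massSet (a : V → ℝ) (Λ : Finset V) (N : ℕ) : Set (stateSpace a) :=
  {ξ | ∑ x ∈ Λ, ξ.1 x ≤ N}

theorem massSet_jumpClosed (Λ : Finset V) (N : ℕ) : JumpClosed Λ (massSet a Λ N) := by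
  intro ξ hξ x hx y hy k
  change ∑ z ∈ Λ, jump x y k ξ.1 z ≤ N
  rw [sum_jump hx hy]
  exact hξ

/-- Jumps inside `Λ` freeze the configuration outside `Λ` and conserve the number of particles
inside, which leaves finitely many possibilities. -/
theorem exists_finite_jumpClosed (Λ : Finset V) (η : stateSpace a) :
    ∃ O : Finset (stateSpace a), η ∈ O ∧ JumpClosed Λ (O : Set (stateSpace a)) := by
  set O : Set (stateSpace a) :=
    {ξ | (∀ x ∉ Λ, ξ.1 x = η.1 x) ∧ ∑ x ∈ Λ, ξ.1 x = ∑ x ∈ Λ, η.1 x} with hO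
  have hfin : O.Finite := by
    refine Set.Finite.of_finite_image
      (f := fun ξ : stateSpace a => fun x : Λ => ξ.1 x) ?_ ?_
    · refine (Set.finite_Iic (fun _ : Λ => ∑ x ∈ Λ, η.1 x)).subset ?_
      rintro _ ⟨ξ, hξ, rfl⟩ x
      change ξ.1 x ≤ _
      rw [← hξ.2]
      exact Finset.single_le_sum (f := fun z => ξ.1 z) (fun _ _ => Nat.zero_le _) x.2
    · intro ξ hξ ζ hζ h
      apply Subtype.ext
      funext x
      by_cases hx : x ∈ Λ
      · exact congrFun h ⟨x, hx⟩
      · rw [hξ.1 x hx, hζ.1 x hx]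
  refine ⟨hfin.toFinset, by simp [hO], ?_⟩
  intro ξ hξ x hx y hy k
  rw [Set.Finite.coe_toFinset] at hξ ⊢
  refine ⟨fun z hz => ?_, ?_⟩
  · rw [← hξ.1 z hz]
    exact jump_of_ne k ξ.1 (fun h => hz (h ▸ hx)) (fun h => hz (h ▸ hy))
  · rw [← hξ.2]
    exact sum_jump hx hy k ξ.1

/-- Restriction of functions to a finite set of configurations. -/
noncomputable def restrictTo (O : Finset (stateSpace a)) : (stateSpace a → ℝ) →ₗ[ℝ] (O → ℝ) :=
  LinearMap.funLeft ℝ ℝ Subtype.val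

/-- The generator acting on functions on a finite set of configurations. -/
noncomputable def generatorOn (p : V → V → ℝ) (g : ℕ → ℕ → ℕ → ℝ) (Λ : Finset V)
    (O : Finset (stateSpace a)) : (O → ℝ) →L[ℝ] (O → ℝ) :=
  LinearMap.toContinuousLinearMap
    (restrictTo O ∘ₗ finiteGeneratorLin p g Λ ∘ₗ
      Function.ExtendByZero.linearMap ℝ (Subtype.val : O → stateSpace a))

/-- The extension by zero in `generatorOn` does no harm: jumps never leave `O`, so the values
outside are not seen. -/
theorem generatorOn_restrictTo {Λ : Finset V} {O : Finset (stateSpace a)}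
    (hO : JumpClosed Λ (O : Set (stateSpace a))) (f : stateSpace a → ℝ) :
    generatorOn p g Λ O (restrictTo O f) = restrictTo O (finiteGenerator p g Λ f) := by
  funext ξ
  refine finiteGenerator_congr (O := (O : Set (stateSpace a))) hO (fun ζ hζ => ?_) ξ.2
  exact Subtype.val_injective.extend_apply (restrictTo O f) 0 ⟨ζ, hζ⟩

theorem generatorOn_pow_restrictTo {Λ : Finset V} {O : Finset (stateSpace a)}
    (hO : JumpClosed Λ (O : Set (stateSpace a))) (f : stateSpace a → ℝ) (n : ℕ) :
    (generatorOn p g Λ O ^ n) (restrictTo O f) =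
      restrictTo O ((finiteGenerator p g Λ)^[n] f) := by
  induction n with
  | zero => simp
  | succ n ih =>
    rw [pow_succ', mul_apply_eq_comp, ih, generatorOn_restrictTo hO,
      Function.iterate_succ_apply']

theorem hasSum_exp_apply {E : Type*} [NormedAddCommGroup E] [NormedSpace ℝ E] [CompleteSpace E]
    (A : E →L[ℝ] E) (t : ℝ) (v : E) :
    HasSum (fun n : ℕ => (t ^ n / n.factorial) • (A ^ n) v) (NormedSpace.exp (t • A) v) := by
  have h := NormedSpace.exp_series_hasSum_exp' (𝕂 := ℝ) (t • A)
  have h2 := (ContinuousLinearMap.apply ℝ E v).hasSum h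
  convert! h2 using 2 with n
  simp [smul_pow, smul_smul, div_eq_inv_mul]

theorem exp_add_of_commute_real {E : Type*} [NormedAddCommGroup E] [NormedSpace ℝ E]
    [CompleteSpace E] {A B : E →L[ℝ] E} (h : Commute A B) :
    NormedSpace.exp (A + B) = NormedSpace.exp A * NormedSpace.exp B :=
  letI : NormedAlgebra ℚ (E →L[ℝ] E) := NormedAlgebra.restrictScalars ℚ ℝ (E →L[ℝ] E)
  NormedSpace.exp_add_of_commute h

theorem hasSum_finiteSemigroup {Λ : Finset V} {O : Finset (stateSpace a)}
    (hO : JumpClosed Λ (O : Set (stateSpace a))) (f : stateSpace a → ℝ) (t : ℝ) (ξ : O) :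
    HasSum (fun j : ℕ => t ^ j / (j.factorial : ℝ) * ((finiteGenerator p g Λ)^[j] f) ξ)
      (NormedSpace.exp (t • generatorOn p g Λ O) (restrictTo O f) ξ) := by
  have h := hasSum_exp_apply (generatorOn p g Λ O) t (restrictTo O f)
  simp_rw [generatorOn_pow_restrictTo hO] at h
  exact Pi.hasSum.1 h ξ

theorem finiteSemigroup_eq_exp {Λ : Finset V} {O : Finset (stateSpace a)}
    (hO : JumpClosed Λ (O : Set (stateSpace a))) (f : stateSpace a → ℝ) (t : ℝ) (ξ : O) :
    finiteSemigroup p g Λ t f ξ =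
      NormedSpace.exp (t • generatorOn p g Λ O) (restrictTo O f) ξ :=
  (hasSum_finiteSemigroup hO f t ξ).tsum_eq

theorem restrictTo_finiteSemigroup {Λ : Finset V} {O : Finset (stateSpace a)}
    (hO : JumpClosed Λ (O : Set (stateSpace a))) (f : stateSpace a → ℝ) (t : ℝ) :
    restrictTo O (finiteSemigroup p g Λ t f) =
      NormedSpace.exp (t • generatorOn p g Λ O) (restrictTo O f) :=
  funext fun ξ => finiteSemigroup_eq_exp hO f t ξ

/-- One step of the Euler scheme with step `1 / R`. -/
noncomputable def eulerStep (p : V → V → ℝ) (g : ℕ → ℕ → ℕ → ℝ) (Λ : Finset V) (R : ℝ)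
    (f : stateSpace a → ℝ) (η : stateSpace a) : ℝ :=
  f η + R⁻¹ * finiteGenerator p g Λ f η

/-- Uniformization: the semigroup is the average of the powers of `1 + R⁻¹ ℒ_Λ` at a Poisson number
of steps of parameter `t R`. For `R` above the total jump rate each step is a Markov operator, so
properties stable under one step pass to the semigroup. -/
theorem hasSum_euler (Λ : Finset V) {R : ℝ} (hR : 0 < R)
    (f : stateSpace a → ℝ) (t : ℝ) (η : stateSpace a) :
    HasSum (fun n : ℕ => Real.exp (-(t * R)) * ((t * R) ^ n / (n.factorial : ℝ)) *
      ((eulerStep p g Λ R)^[n] f) η) (finiteSemigroup p g Λ t f η) := by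
  obtain ⟨O, hη, hO⟩ := exists_finite_jumpClosed Λ η
  set A := generatorOn p g Λ O
  set P : (O → ℝ) →L[ℝ] (O → ℝ) := 1 + R⁻¹ • A with hP
  have h1 : ∀ f, P (restrictTo O f) = restrictTo O (eulerStep p g Λ R f) := by
    intro f
    rw [hP, add_apply, smul_apply,
      generatorOn_restrictTo hO]
    rfl
  have h2 : ∀ n, (P ^ n) (restrictTo O f) = restrictTo O ((eulerStep p g Λ R)^[n] f) := by
    intro n
    induction n with
    | zero => simp
    | succ n ih =>
      rw [pow_succ', mul_apply_eq_comp, ih, h1, Function.iterate_succ_apply']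
  -- Write `t A = -t R + t R P`; the scalar part commutes with `P` and factors out.
  have h3 : NormedSpace.exp (t • A) =
      Real.exp (-(t * R)) • NormedSpace.exp ((t * R) • P) := by
    have e1 : t • A = (-(t * R)) • (1 : (O → ℝ) →L[ℝ] (O → ℝ)) + (t * R) • P := by
      rw [hP, smul_add, smul_smul, mul_assoc, mul_inv_cancel₀ hR.ne', mul_one, ← add_assoc,
        ← add_smul, neg_add_cancel, zero_smul, zero_add]
    have hcomm : Commute ((-(t * R)) • (1 : (O → ℝ) →L[ℝ] (O → ℝ))) ((t * R) • P) :=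
      (Commute.one_left _).smul_left _
    rw [e1, exp_add_of_commute_real hcomm, ← Algebra.algebraMap_eq_smul_one,
      ← NormedSpace.algebraMap_exp_comm, Algebra.algebraMap_eq_smul_one, smul_mul_assoc, one_mul,
      Real.exp_eq_exp_ℝ]
  have h4 := hasSum_exp_apply P (t * R) (restrictTo O f)
  simp_rw [h2] at h4
  have h5 := (Pi.hasSum.1 h4 ⟨η, hη⟩).mul_left (Real.exp (-(t * R)))
  have h6 := finiteSemigroup_eq_exp (p := p) (g := g) hO f t ⟨η, hη⟩
  rw [h3] at h6
  rw [show finiteSemigroup p g Λ t f η = _ from h6]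
  convert! h5 using 2
  rw [mul_assoc]
  rfl

theorem finiteSemigroup_add_apply (Λ : Finset V) (f h : stateSpace a → ℝ) (t : ℝ) :
    finiteSemigroup p g Λ t (f + h) = finiteSemigroup p g Λ t f + finiteSemigroup p g Λ t h := by
  funext η
  obtain ⟨O, hη, hO⟩ := exists_finite_jumpClosed Λ η
  have := fun f => finiteSemigroup_eq_exp (p := p) (g := g) hO f t ⟨η, hη⟩
  simp only [Pi.add_apply]
  rw [this, this, this, map_add, map_add]
  rfl

theorem finiteSemigroup_smul (Λ : Finset V) (c : ℝ) (f : stateSpace a → ℝ) (t : ℝ) :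
    finiteSemigroup p g Λ t (c • f) = c • finiteSemigroup p g Λ t f := by
  funext η
  obtain ⟨O, hη, hO⟩ := exists_finite_jumpClosed Λ η
  have := fun f => finiteSemigroup_eq_exp (p := p) (g := g) hO f t ⟨η, hη⟩
  simp only [Pi.smul_apply]
  rw [this, this, map_smul, map_smul]
  rfl

theorem finiteSemigroup_zero (Λ : Finset V) (f : stateSpace a → ℝ) :
    finiteSemigroup p g Λ 0 f = f := by
  funext η
  obtain ⟨O, hη, hO⟩ := exists_finite_jumpClosed Λ η
  rw [finiteSemigroup_eq_exp hO f 0 ⟨η, hη⟩, zero_smul, NormedSpace.exp_zero]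
  rfl

theorem finiteSemigroup_semigroup (Λ : Finset V) (f : stateSpace a → ℝ) (s t : ℝ) :
    finiteSemigroup p g Λ (s + t) f = finiteSemigroup p g Λ s (finiteSemigroup p g Λ t f) := by
  funext η
  obtain ⟨O, hη, hO⟩ := exists_finite_jumpClosed Λ η
  rw [finiteSemigroup_eq_exp hO f _ ⟨η, hη⟩, finiteSemigroup_eq_exp hO _ s ⟨η, hη⟩,
    restrictTo_finiteSemigroup hO, add_smul, exp_add_of_commute_real]
  · rfl
  · exact ((Commute.refl _).smul_left _).smul_right _

theorem hasDerivAt_finiteSemigroup (Λ : Finset V) (f : stateSpace a → ℝ) (η : stateSpace a)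
    (t : ℝ) :
    HasDerivAt (fun s => finiteSemigroup p g Λ s f η)
      (finiteGenerator p g Λ (finiteSemigroup p g Λ t f) η) t := by
  obtain ⟨O, hη, hO⟩ := exists_finite_jumpClosed Λ η
  have h := hasDerivAt_exp_smul_const' (𝕂 := ℝ) (generatorOn p g Λ O) t
  have h2 := h.clm_apply (hasDerivAt_const t (restrictTo O f))
  have h3 := hasDerivAt_pi.1 h2 ⟨η, hη⟩
  have e : (fun s => finiteSemigroup p g Λ s f η) = fun s =>
      NormedSpace.exp (s • generatorOn p g Λ O) (restrictTo O f) ⟨η, hη⟩ :=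
    funext fun s => finiteSemigroup_eq_exp hO f s ⟨η, hη⟩
  rw [e]
  convert! h3 using 1
  simp only [map_zero, add_zero, mul_apply_eq_comp]
  rw [← restrictTo_finiteSemigroup hO, generatorOn_restrictTo hO]
  rfl

/-- Derivative of the interpolation between two finite-volume semigroups. -/
theorem hasDerivAt_interpolation {Λ Λ' : Finset V} (hΛ : Λ ⊆ Λ') (f : stateSpace a → ℝ)
    (η : stateSpace a) (t s : ℝ) :
    HasDerivAt (fun s => finiteSemigroup p g Λ (t - s) (finiteSemigroup p g Λ' s f) η)
      (finiteSemigroup p g Λ (t - s) (finiteGenerator p g Λ' (finiteSemigroup p g Λ' s f) -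
        finiteGenerator p g Λ (finiteSemigroup p g Λ' s f)) η) s := by
  -- A finite set closed for the larger volume is closed for the smaller one, so both generators
  -- become matrices on the same space.
  obtain ⟨O, hη, hO'⟩ := exists_finite_jumpClosed Λ' η
  have hO := hO'.mono hΛ
  set A := generatorOn p g Λ O
  set A' := generatorOn p g Λ' O
  have h1 : HasDerivAt (fun s => NormedSpace.exp ((t - s) • A))
      (-(NormedSpace.exp ((t - s) • A) * A)) s := by
    have h := (hasDerivAt_exp_smul_const (𝕂 := ℝ) A (t - s)).scomp s
      ((hasDerivAt_id s).const_sub t)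
    simpa [Function.comp_def] using h
  have h2 := (hasDerivAt_exp_smul_const' (𝕂 := ℝ) A' s).clm_apply
    (hasDerivAt_const s (restrictTo O f))
  have h3 := hasDerivAt_pi.1 (h1.clm_apply h2) ⟨η, hη⟩
  have e : (fun s => finiteSemigroup p g Λ (t - s) (finiteSemigroup p g Λ' s f) η) = fun s =>
      NormedSpace.exp ((t - s) • A) (NormedSpace.exp (s • A') (restrictTo O f)) ⟨η, hη⟩ := by
    funext s
    rw [finiteSemigroup_eq_exp hO _ _ ⟨η, hη⟩, restrictTo_finiteSemigroup hO']
  rw [e]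
  convert! h3 using 1
  rw [finiteSemigroup_eq_exp hO _ _ ⟨η, hη⟩]
  simp only [map_zero, add_zero, mul_apply_eq_comp]
  rw [← restrictTo_finiteSemigroup hO', map_sub, generatorOn_restrictTo hO', map_sub,
    neg_apply, mul_apply_eq_comp, generatorOn_restrictTo hO]
  simp only [Pi.sub_apply, Pi.add_apply, Pi.neg_apply]
  ring

end FiniteVolume

/-! ### Positivity, Lipschitz bounds and comparison of volumes by uniformization. -/

section Estimates

variable {V : Type*} {p : V → V → ℝ} {a : V → ℝ} {M : ℝ}
  {g : ℕ → ℕ → ℕ → ℝ} {C : ℝ}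

theorem configDist_comm (η ζ : V → ℕ) : configDist a η ζ = configDist a ζ η := by
  unfold configDist
  simp_rw [abs_sub_comm]

/-- The total jump rate inside `Λ`. -/
noncomputable def totalRate (p : V → V → ℝ) (g : ℕ → ℕ → ℕ → ℝ) (Λ : Finset V) (ξ : V → ℕ) : ℝ :=
  ∑ x ∈ Λ, ∑ y ∈ Λ, ∑ k ∈ Finset.Icc 1 (ξ x), p x y * g k (ξ x) (ξ y)

/-- The rates are unbounded on the whole state space, but they involve only occupation numbers in
`Λ`, which the conserved mass `N` bounds. One step size then serves the whole trajectory. -/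
theorem exists_totalRate_le (h : AdmissibleKernel p a M) (hg : RateBounds g C) (Λ : Finset V)
    (N : ℕ) : ∃ R : ℝ, 0 < R ∧ ∀ ξ ∈ massSet a Λ N, totalRate p g Λ ξ.1 ≤ R := by
  -- The added `1` keeps `R` positive when the sum is zero.
  refine ⟨∑ x ∈ Λ, ∑ y ∈ Λ, C * (N + N) + 1, ?_, fun ξ hξ => ?_⟩
  · have := hg.pos
    positivity
  · have hN : ∀ x ∈ Λ, (ξ.1 x : ℝ) ≤ N := fun x hx => by
      exact_mod_cast (Finset.single_le_sum (f := fun z => ξ.1 z)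
        (fun _ _ => Nat.zero_le _) hx).trans hξ
    refine le_add_of_le_of_nonneg (Finset.sum_le_sum fun x hx => Finset.sum_le_sum fun y hy => ?_)
      zero_le_one
    have h1 : ∀ k ∈ Finset.Icc 1 (ξ.1 x), p x y * g k (ξ.1 x) (ξ.1 y) ≤
        k * g k (ξ.1 x) (ξ.1 y) := by
      intro k hk
      refine mul_le_mul_of_nonneg_right ((h.le_one x y).trans ?_) (hg.nonneg _ _ _)
      exact_mod_cast (Finset.mem_Icc.1 hk).1
    refine (Finset.sum_le_sum h1).trans ((hg.growth _ _).trans ?_)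
    exact mul_le_mul_of_nonneg_left (add_le_add (hN x hx) (hN y hy)) hg.pos.le

theorem mem_massSet (Λ : Finset V) (η : stateSpace a) : η ∈ massSet a Λ (∑ x ∈ Λ, η.1 x) :=
  le_refl (∑ x ∈ Λ, η.1 x)

variable [DecidableEq V]

/-- Exhibits the step as a convex combination of values of `f` once `R` dominates the total rate. -/
theorem eulerStep_eq {Λ : Finset V} {R : ℝ} (f : stateSpace a → ℝ) (ξ : stateSpace a) :
    eulerStep p g Λ R f ξ = (1 - R⁻¹ * totalRate p g Λ ξ.1) * f ξ +
      R⁻¹ * ∑ x ∈ Λ, ∑ y ∈ Λ, ∑ k ∈ Finset.Icc 1 (ξ.1 x),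
        p x y * g k (ξ.1 x) (ξ.1 y) * f (jumpState x y k ξ) := by
  simp only [eulerStep, finiteGenerator, bondGenerator, totalRate, mul_sub,
    Finset.sum_sub_distrib, ← Finset.sum_mul]
  ring

theorem eulerStep_nonneg (h : AdmissibleKernel p a M) (hg : RateBounds g C) {Λ : Finset V}
    {F : Set (stateSpace a)} (hF : JumpClosed Λ F) {R : ℝ} (hR : 0 < R)
    (hRF : ∀ ξ ∈ F, totalRate p g Λ ξ.1 ≤ R) {f : stateSpace a → ℝ} (hf : ∀ ξ ∈ F, 0 ≤ f ξ) :
    ∀ ξ ∈ F, 0 ≤ eulerStep p g Λ R f ξ := by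
  intro ξ hξ
  rw [eulerStep_eq]
  refine add_nonneg (mul_nonneg ?_ (hf ξ hξ)) (mul_nonneg (inv_pos.2 hR).le ?_)
  · rw [sub_nonneg, inv_mul_le_iff₀ hR, mul_one]
    exact hRF ξ hξ
  · exact Finset.sum_nonneg fun x hx => Finset.sum_nonneg fun y hy => Finset.sum_nonneg fun k _ =>
      mul_nonneg (mul_nonneg (h.nonneg _ _) (hg.nonneg _ _ _)) (hf _ (hF ξ hξ x hx y hy k))

theorem eulerStep_sub {Λ : Finset V} {R : ℝ} (f w : stateSpace a → ℝ) :
    eulerStep p g Λ R (f - w) = eulerStep p g Λ R f - eulerStep p g Λ R w := by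
  funext ξ
  have : finiteGenerator p g Λ (f - w) = finiteGenerator p g Λ f - finiteGenerator p g Λ w :=
    map_sub (finiteGeneratorLin p g Λ) f w
  simp only [eulerStep, this, Pi.sub_apply]
  ring

theorem finiteGenerator_smul {Λ : Finset V} (c : ℝ) (f : stateSpace a → ℝ) :
    finiteGenerator p g Λ (c • f) = c • finiteGenerator p g Λ f :=
  map_smul (finiteGeneratorLin p g Λ) c f

theorem finiteSemigroup_nonneg (h : AdmissibleKernel p a M) (hg : RateBounds g C) (Λ : Finset V)
    {f : stateSpace a → ℝ} (hf : ∀ ξ, 0 ≤ f ξ) {t : ℝ} (ht : 0 ≤ t) (η : stateSpace a) :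
    0 ≤ finiteSemigroup p g Λ t f η := by
  obtain ⟨R, hR, hRF⟩ := exists_totalRate_le h hg Λ (∑ x ∈ Λ, η.1 x)
  have hn : ∀ n, ∀ ξ ∈ massSet a Λ (∑ x ∈ Λ, η.1 x), 0 ≤ ((eulerStep p g Λ R)^[n] f) ξ := by
    intro n
    induction n with
    | zero => exact fun ξ _ => hf ξ
    | succ n ih =>
      rw [Function.iterate_succ_apply']
      exact eulerStep_nonneg h hg (massSet_jumpClosed Λ _) hR hRF ih
  refine (hasSum_euler Λ hR f t η).nonneg fun n => mul_nonneg ?_ (hn n η (mem_massSet Λ η))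
  have : 0 ≤ t * R := mul_nonneg ht hR.le
  positivity

theorem finiteSemigroup_sub (Λ : Finset V) (f w : stateSpace a → ℝ) (t : ℝ) :
    finiteSemigroup p g Λ t (f - w) = finiteSemigroup p g Λ t f - finiteSemigroup p g Λ t w := by
  have h1 := finiteSemigroup_add_apply (p := p) (g := g) Λ (f - w) w t
  rw [sub_add_cancel] at h1
  rw [h1, add_sub_cancel_right]

theorem finiteSemigroup_mono (h : AdmissibleKernel p a M) (hg : RateBounds g C) (Λ : Finset V)
    {f w : stateSpace a → ℝ} (hf : ∀ ξ, f ξ ≤ w ξ) {t : ℝ} (ht : 0 ≤ t) (η : stateSpace a) :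
    finiteSemigroup p g Λ t f η ≤ finiteSemigroup p g Λ t w η := by
  have := finiteSemigroup_nonneg (f := w - f) h hg Λ (fun ξ => sub_nonneg.2 (hf ξ)) ht η
  rw [finiteSemigroup_sub] at this
  exact sub_nonneg.1 this

theorem abs_finiteSemigroup_le (h : AdmissibleKernel p a M) (hg : RateBounds g C) (Λ : Finset V)
    {f w : stateSpace a → ℝ} (hf : ∀ ξ, |f ξ| ≤ w ξ) {t : ℝ} (ht : 0 ≤ t) (η : stateSpace a) :
    |finiteSemigroup p g Λ t f η| ≤ finiteSemigroup p g Λ t w η := by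
  refine abs_le'.2 ⟨finiteSemigroup_mono h hg Λ (fun ξ => (abs_le'.1 (hf ξ)).1) ht η, ?_⟩
  have h1 := finiteSemigroup_mono (f := (-1 : ℝ) • f) h hg Λ
    (fun ξ => by simpa using (abs_le'.1 (hf ξ)).2) ht η
  rw [finiteSemigroup_smul] at h1
  simpa using h1

theorem finiteSemigroup_const (Λ : Finset V) (c : ℝ) (t : ℝ) :
    finiteSemigroup p g Λ t (fun _ : stateSpace a => c) = fun _ => c := by
  have h0 : finiteGenerator p g Λ (fun _ : stateSpace a => c) = 0 := by
    funext ξ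
    simp [finiteGenerator, bondGenerator]
  have h1 : ∀ n, (finiteGenerator p g Λ)^[n + 1] (fun _ : stateSpace a => c) = 0 := by
    intro n
    induction n with
    | zero => exact h0
    | succ n ih =>
      rw [Function.iterate_succ_apply', ih]
      exact map_zero (finiteGeneratorLin p g Λ)
  funext η
  unfold finiteSemigroup
  rw [tsum_eq_single 0]
  · simp
  · intro n hn
    obtain ⟨m, rfl⟩ := Nat.exists_eq_succ_of_ne_zero hn
    rw [h1]
    simp

theorem hasSum_poisson {R : ℝ} (hR : 0 < R) (c t w : ℝ) :
    HasSum (fun n : ℕ => Real.exp (-(t * R)) * ((t * R) ^ n / (n.factorial : ℝ)) *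
      ((1 + R⁻¹ * c) ^ n * w)) (Real.exp (c * t) * w) := by
  have h1 := NormedSpace.expSeries_div_hasSum_exp (𝔸 := ℝ) (t * R * (1 + R⁻¹ * c))
  rw [← Real.exp_eq_exp_ℝ] at h1
  have h2 := (h1.mul_left (Real.exp (-(t * R)))).mul_right w
  convert! h2 using 1
  · funext n
    rw [mul_pow (t * R)]
    simp only [div_eq_mul_inv, mul_assoc, mul_left_comm]
  · rw [← Real.exp_add]
    congr 2
    field_simp
    ring

/-- A Lyapunov bound. One positive step multiplies `W` by at most `1 + c / R`, so `n` steps by at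
most the `n`-th power, and the Poisson average of these powers is `exp (c t)`. -/
theorem finiteSemigroup_weight_le (h : AdmissibleKernel p a M) (hg : RateBounds g C)
    (Λ : Finset V) {W : stateSpace a → ℝ} {c : ℝ} (hc : 0 ≤ c)
    (hLW : ∀ ξ, finiteGenerator p g Λ W ξ ≤ c * W ξ) {t : ℝ} (ht : 0 ≤ t) (η : stateSpace a) :
    finiteSemigroup p g Λ t W η ≤ Real.exp (c * t) * W η := by
  obtain ⟨R, hR, hRF⟩ := exists_totalRate_le h hg Λ (∑ x ∈ Λ, η.1 x)
  have hn : ∀ n, ∀ ξ ∈ massSet a Λ (∑ x ∈ Λ, η.1 x),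
      ((eulerStep p g Λ R)^[n] W) ξ ≤ (1 + R⁻¹ * c) ^ n * W ξ := by
    intro n
    induction n with
    | zero => exact fun ξ _ => by simp
    | succ n ih =>
      intro ξ hξ
      rw [Function.iterate_succ_apply']
      have h1 := eulerStep_nonneg (f := ((1 + R⁻¹ * c) ^ n • W) - (eulerStep p g Λ R)^[n] W)
        h hg (massSet_jumpClosed Λ _) hR hRF (fun ζ hζ => sub_nonneg.2 (ih ζ hζ)) ξ hξ
      rw [eulerStep_sub] at h1
      refine (sub_nonneg.1 h1).trans ?_
      simp only [eulerStep, finiteGenerator_smul, Pi.smul_apply, smul_eq_mul]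
      have h2 := mul_le_mul_of_nonneg_left (hLW ξ) (inv_pos.2 hR).le
      have h3 : 0 ≤ (1 + R⁻¹ * c) ^ n := by positivity
      have h4 := mul_le_mul_of_nonneg_left h2 h3
      rw [pow_succ]
      linarith
  refine hasSum_le (fun n => ?_) (hasSum_euler Λ hR W t η) (hasSum_poisson hR c t (W η))
  refine mul_le_mul_of_nonneg_left (hn n η (mem_massSet Λ η)) ?_
  have : 0 ≤ t * R := mul_nonneg ht hR.le
  positivity

theorem bondGenerator_eq_extended (hg : RateBounds g C) (x y : V) (f : stateSpace a → ℝ)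
    (η : stateSpace a) {n : ℕ} (hn : η.1 x ≤ n) :
    bondGenerator p g x y f η = ∑ k ∈ Finset.Icc 1 n,
      p x y * g k (η.1 x) (η.1 y) * (f (jumpState x y k η) - f η) := by
  refine Finset.sum_subset (Finset.Icc_subset_Icc_right hn) fun k hk hk' => ?_
  rw [hg.supp k _ _ (by rw [Finset.mem_Icc] at hk hk'; omega)]
  simp

/-- Basic coupling. At the minimum of the two rates both configurations jump together, which
preserves their distance; at the excess rate only one jumps, which costs `k (a x + a y)`. If one
configuration has fewer than `k` particles at `x`, its rate is zero and there is no common jump. -/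
theorem coupling_term_le (hg : RateBounds g C) (ha : ∀ x, 0 ≤ a x) {x y : V} {f : stateSpace a → ℝ}
    {K : ℝ} (hK : 0 ≤ K) {F : Set (stateSpace a)}
    (hf : ∀ η ∈ F, ∀ ζ ∈ F, f η - f ζ ≤ K * configDist a η.1 ζ.1) (k : ℕ)
    {η ζ : stateSpace a} (hη : η ∈ F) (hζ : ζ ∈ F) (hη' : jumpState x y k η ∈ F)
    (hζ' : jumpState x y k ζ ∈ F) :
    g k (η.1 x) (η.1 y) * (f (jumpState x y k η) - f η) -
      g k (ζ.1 x) (ζ.1 y) * (f (jumpState x y k ζ) - f ζ) ≤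
    min (g k (η.1 x) (η.1 y)) (g k (ζ.1 x) (ζ.1 y)) * (K * configDist a η.1 ζ.1 - (f η - f ζ)) +
      |g k (η.1 x) (η.1 y) - g k (ζ.1 x) (ζ.1 y)| * (K * (k * (a x + a y))) := by
  have h1 : f (jumpState x y k η) - f η ≤ K * (k * (a x + a y)) :=
    (hf _ hη' _ hη).trans (mul_le_mul_of_nonneg_left (configDist_jump_le ha x y k η.1) hK)
  have h2 : f ζ - f (jumpState x y k ζ) ≤ K * (k * (a x + a y)) := by
    refine (hf _ hζ _ hζ').trans (mul_le_mul_of_nonneg_left ?_ hK)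
    rw [configDist_comm]
    exact configDist_jump_le ha x y k ζ.1
  have h3 : min (g k (η.1 x) (η.1 y)) (g k (ζ.1 x) (ζ.1 y)) *
      (f (jumpState x y k η) - f (jumpState x y k ζ)) ≤
      min (g k (η.1 x) (η.1 y)) (g k (ζ.1 x) (ζ.1 y)) * (K * configDist a η.1 ζ.1) := by
    by_cases hk : k ≤ η.1 x ∧ k ≤ ζ.1 x
    · refine mul_le_mul_of_nonneg_left ?_ (le_min (hg.nonneg _ _ _) (hg.nonneg _ _ _))
      have := hf _ hη' _ hζ'
      rwa [show (jumpState x y k η).1 = jump x y k η.1 from rfl,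
        show (jumpState x y k ζ).1 = jump x y k ζ.1 from rfl,
        configDist_jump_jump hk.1 hk.2] at this
    · have : min (g k (η.1 x) (η.1 y)) (g k (ζ.1 x) (ζ.1 y)) = 0 := by
        rw [not_and_or, not_le, not_le] at hk
        rcases hk with hk | hk
        · rw [hg.supp k _ _ hk]
          exact min_eq_left (hg.nonneg _ _ _)
        · rw [hg.supp k (ζ.1 x) _ hk]
          exact min_eq_right (hg.nonneg _ _ _)
      simp [this]
  rcases le_total (g k (η.1 x) (η.1 y)) (g k (ζ.1 x) (ζ.1 y)) with hle | hle
  · rw [min_eq_left hle] at h3 ⊢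
    rw [abs_of_nonpos (sub_nonpos.2 hle)]
    have := mul_le_mul_of_nonneg_left h2 (sub_nonneg.2 hle)
    linarith
  · rw [min_eq_right hle] at h3 ⊢
    rw [abs_of_nonneg (sub_nonneg.2 hle)]
    have := mul_le_mul_of_nonneg_left h1 (sub_nonneg.2 hle)
    linarith

/-- With `T` the total rate of common jumps, the step difference is at most `(1 - T / R)(f η - f ζ)
+ (T / R) K d` plus the cost of the excess jumps. The first two terms give at most `K d`; the
Lipschitz condition on the rates and `sum_pair_le`, applied to `|η - ζ|`, bound the cost by `R⁻¹ K D
(2 M + 2) d`. -/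
theorem eulerStep_lipschitz (h : AdmissibleKernel p a M) (hg : RateBounds g C) {D : ℝ}
    (hL : ∀ α β γ δ : ℕ, ∑ k ∈ Finset.Icc 1 (max α γ), (k : ℝ) * |g k α β - g k γ δ| ≤
      D * (|(α : ℝ) - γ| + |(β : ℝ) - δ|)) (hD : 0 ≤ D) {Λ : Finset V}
    {F : Set (stateSpace a)} (hF : JumpClosed Λ F) {R : ℝ} (hR : 0 < R)
    (hRF : ∀ ξ ∈ F, totalRate p g Λ ξ.1 ≤ R) {f : stateSpace a → ℝ} {K : ℝ} (hK : 0 ≤ K)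
    (hf : ∀ η ∈ F, ∀ ζ ∈ F, f η - f ζ ≤ K * configDist a η.1 ζ.1) :
    ∀ η ∈ F, ∀ ζ ∈ F, eulerStep p g Λ R f η - eulerStep p g Λ R f ζ ≤
      K * (1 + R⁻¹ * (D * (2 * M + 2))) * configDist a η.1 ζ.1 := by
  intro η hη ζ hζ
  set d := configDist a η.1 ζ.1 with hd
  have ha := fun x => (h.pos x).le
  set m : V → V → ℕ → ℝ := fun x y k => min (g k (η.1 x) (η.1 y)) (g k (ζ.1 x) (ζ.1 y)) with hm
  set T : ℝ := ∑ x ∈ Λ, ∑ y ∈ Λ, ∑ k ∈ Finset.Icc 1 (max (η.1 x) (ζ.1 x)), p x y * m x y k with hT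
  -- The common rate is at most the rate of `η` alone, so `1 - T / R` is a legitimate weight.
  have hTR : T ≤ R := by
    refine le_trans ?_ (hRF η hη)
    refine Finset.sum_le_sum fun x _ => Finset.sum_le_sum fun y _ => ?_
    rw [show ∑ k ∈ Finset.Icc 1 (η.1 x), p x y * g k (η.1 x) (η.1 y) =
      ∑ k ∈ Finset.Icc 1 (max (η.1 x) (ζ.1 x)), p x y * g k (η.1 x) (η.1 y) from
      Finset.sum_subset (Finset.Icc_subset_Icc_right (le_max_left _ _)) fun k hk hk' => by
        rw [hg.supp k _ _ (by rw [Finset.mem_Icc] at hk hk'; omega), mul_zero]]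
    exact Finset.sum_le_sum fun k _ => mul_le_mul_of_nonneg_left (min_le_left _ _) (h.nonneg _ _)
  have hbond : ∀ x ∈ Λ, ∀ y ∈ Λ, bondGenerator p g x y f η - bondGenerator p g x y f ζ ≤
      (∑ k ∈ Finset.Icc 1 (max (η.1 x) (ζ.1 x)), p x y * m x y k) * (K * d - (f η - f ζ)) +
      K * D * (p x y * (|(η.1 x : ℝ) - ζ.1 x| + |(η.1 y : ℝ) - ζ.1 y|) * (a x + a y)) := by
    intro x hx y hy
    rw [bondGenerator_eq_extended hg x y f η (le_max_left _ (ζ.1 x)),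
      bondGenerator_eq_extended hg x y f ζ (le_max_right (η.1 x) _), ← Finset.sum_sub_distrib]
    have h1 : ∀ k ∈ Finset.Icc 1 (max (η.1 x) (ζ.1 x)),
        p x y * g k (η.1 x) (η.1 y) * (f (jumpState x y k η) - f η) -
        p x y * g k (ζ.1 x) (ζ.1 y) * (f (jumpState x y k ζ) - f ζ) ≤
        p x y * m x y k * (K * d - (f η - f ζ)) +
          p x y * K * (a x + a y) * (k * |g k (η.1 x) (η.1 y) - g k (ζ.1 x) (ζ.1 y)|) := by
      intro k _
      have := mul_le_mul_of_nonneg_left (coupling_term_le hg ha hK hf k hη hζ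
        (hF η hη x hx y hy k) (hF ζ hζ x hx y hy k)) (h.nonneg x y)
      rw [mul_sub, mul_add] at this
      simp only [hm, hd]
      linarith
    refine (Finset.sum_le_sum h1).trans ?_
    rw [Finset.sum_add_distrib, ← Finset.sum_mul,
      ← Finset.mul_sum _ (fun k : ℕ => (k : ℝ) * |g k (η.1 x) (η.1 y) - g k (ζ.1 x) (ζ.1 y)|)]
    have h2 : 0 ≤ p x y * K * (a x + a y) :=
      mul_nonneg (mul_nonneg (h.nonneg _ _) hK) (add_nonneg (ha _) (ha _))
    have h3 := mul_le_mul_of_nonneg_left (hL (η.1 x) (η.1 y) (ζ.1 x) (ζ.1 y)) h2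
    linarith
  have hgen : finiteGenerator p g Λ f η - finiteGenerator p g Λ f ζ ≤
      T * (K * d - (f η - f ζ)) + K * D * ((2 * M + 2) * d) := by
    unfold finiteGenerator
    simp_rw [← Finset.sum_sub_distrib]
    refine (Finset.sum_le_sum fun x hx => Finset.sum_le_sum fun y hy => hbond x hx y hy).trans ?_
    simp only [Finset.sum_add_distrib, ← Finset.sum_mul]
    refine add_le_add le_rfl ?_
    simp only [← Finset.mul_sum _ _ (K * D)]
    refine mul_le_mul_of_nonneg_left ?_ (mul_nonneg hK hD)
    exact h.sum_pair_le (u := fun x => |(η.1 x : ℝ) - ζ.1 x|) (fun _ => abs_nonneg _)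
      (summable_abs_sub ha η ζ) Λ
  have h4 := mul_le_mul_of_nonneg_left hgen (inv_pos.2 hR).le
  have h5 : 0 ≤ 1 - R⁻¹ * T := by
    rw [sub_nonneg, inv_mul_le_iff₀ hR, mul_one]
    exact hTR
  have h6 := mul_le_mul_of_nonneg_left (hf η hη ζ hζ) h5
  unfold eulerStep
  linarith

theorem finiteSemigroup_lipschitz (h : AdmissibleKernel p a M) (hg : RateBounds g C) {D : ℝ}
    (hL : ∀ α β γ δ : ℕ, ∑ k ∈ Finset.Icc 1 (max α γ), (k : ℝ) * |g k α β - g k γ δ| ≤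
      D * (|(α : ℝ) - γ| + |(β : ℝ) - δ|)) (hD : 0 ≤ D) (Λ : Finset V)
    {f : stateSpace a → ℝ} {K : ℝ} (hK : 0 ≤ K) (hf : LipschitzBound a K f)
    {t : ℝ} (ht : 0 ≤ t) :
    LipschitzBound a (K * Real.exp (D * (2 * M + 2) * t)) (finiteSemigroup p g Λ t f) := by
  set c := D * (2 * M + 2) with hc
  have hc0 : 0 ≤ c := mul_nonneg hD (by linarith [h.M_pos])
  have key : ∀ η ζ : stateSpace a, finiteSemigroup p g Λ t f η - finiteSemigroup p g Λ t f ζ ≤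
      K * Real.exp (c * t) * configDist a η.1 ζ.1 := by
    intro η ζ
    -- The sum of the two masses puts both configurations into one mass set, hence under one `R`.
    set N := ∑ x ∈ Λ, η.1 x + ∑ x ∈ Λ, ζ.1 x
    have hη : η ∈ massSet a Λ N := Nat.le_add_right _ _
    have hζ : ζ ∈ massSet a Λ N := Nat.le_add_left _ _
    obtain ⟨R, hR, hRF⟩ := exists_totalRate_le h hg Λ N
    have hn : ∀ n, ∀ η ∈ massSet a Λ N, ∀ ζ ∈ massSet a Λ N,
        ((eulerStep p g Λ R)^[n] f) η - ((eulerStep p g Λ R)^[n] f) ζ ≤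
          K * (1 + R⁻¹ * c) ^ n * configDist a η.1 ζ.1 := by
      intro n
      induction n with
      | zero => exact fun η _ ζ _ => by simpa using (le_abs_self _).trans (hf η ζ)
      | succ n ih =>
        intro η hη ζ hζ
        rw [Function.iterate_succ_apply', pow_succ, ← mul_assoc]
        exact eulerStep_lipschitz h hg hL hD (massSet_jumpClosed Λ N) hR hRF
          (by positivity) ih η hη ζ hζ
    have h1 := (hasSum_euler (p := p) (g := g) Λ hR f t η).sub
      (hasSum_euler (p := p) (g := g) Λ hR f t ζ)
    have h2 := hasSum_poisson hR c t (K * configDist a η.1 ζ.1)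
    rw [show K * Real.exp (c * t) * configDist a η.1 ζ.1 =
      Real.exp (c * t) * (K * configDist a η.1 ζ.1) by ring]
    refine hasSum_le (fun n => ?_) h1 h2
    rw [← mul_sub]
    refine mul_le_mul_of_nonneg_left ((hn n η hη ζ hζ).trans (le_of_eq (by ring))) ?_
    have : 0 ≤ t * R := mul_nonneg ht hR.le
    positivity
  intro η ζ
  refine abs_sub_le_iff.2 ⟨key η ζ, ?_⟩
  rw [configDist_comm]
  exact key ζ η

/-- Duhamel: interpolate by `S_Λ(t - s) S_Λ'(s) f`. Its derivative is `S_Λ(t - s)` applied to the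
difference of the generators at `S_Λ'(s) f`, a function that stays Lipschitz; the difference is at
most a multiple of `W`, and `S_Λ` inflates `W` only exponentially. -/
theorem abs_finiteSemigroup_sub_le (h : AdmissibleKernel p a M) (hg : RateBounds g C) {D : ℝ}
    (hL : ∀ α β γ δ : ℕ, ∑ k ∈ Finset.Icc 1 (max α γ), (k : ℝ) * |g k α β - g k γ δ| ≤
      D * (|(α : ℝ) - γ| + |(β : ℝ) - δ|)) (hD : 0 ≤ D) {Λ Λ' : Finset V} (hΛ : Λ ⊆ Λ')
    {f : stateSpace a → ℝ} {K : ℝ} (hK : 0 ≤ K) (hf : LipschitzBound a K f)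
    {W : stateSpace a → ℝ} {c : ℝ} (hc : D * (2 * M + 2) ≤ c)
    (hW : ∀ ξ, 0 ≤ W ξ)
    (hLW : ∀ ξ, finiteGenerator p g Λ W ξ ≤ c * W ξ)
    (hdiff : ∀ (w : stateSpace a → ℝ) (K : ℝ), 0 ≤ K → LipschitzBound a K w → ∀ ξ,
      |finiteGenerator p g Λ' w ξ - finiteGenerator p g Λ w ξ| ≤ K * W ξ)
    {t : ℝ} (ht : 0 ≤ t) (η : stateSpace a) :
    |finiteSemigroup p g Λ' t f η - finiteSemigroup p g Λ t f η| ≤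
      K * Real.exp (c * t) * W η * t := by
  have hc0 : 0 ≤ c := le_trans (mul_nonneg hD (by linarith [h.M_pos])) hc
  have hderiv : ∀ s ∈ Set.Icc 0 t, HasDerivWithinAt
      (fun s => finiteSemigroup p g Λ (t - s) (finiteSemigroup p g Λ' s f) η)
      (finiteSemigroup p g Λ (t - s) (finiteGenerator p g Λ' (finiteSemigroup p g Λ' s f) -
        finiteGenerator p g Λ (finiteSemigroup p g Λ' s f)) η) (Set.Icc 0 t) s :=
    fun s _ => (hasDerivAt_interpolation hΛ f η t s).hasDerivWithinAt
  have hbound : ∀ s ∈ Set.Ico 0 t,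
      ‖finiteSemigroup p g Λ (t - s) (finiteGenerator p g Λ' (finiteSemigroup p g Λ' s f) -
        finiteGenerator p g Λ (finiteSemigroup p g Λ' s f)) η‖ ≤
        K * Real.exp (c * t) * W η := by
    intro s hs
    have hts : 0 ≤ t - s := sub_nonneg.2 hs.2.le
    set K' := K * Real.exp (D * (2 * M + 2) * s)
    have hK' : 0 ≤ K' := mul_nonneg hK (Real.exp_pos _).le
    have h1 := finiteSemigroup_lipschitz h hg hL hD Λ' hK hf hs.1
    have h2 := abs_finiteSemigroup_le (w := K' • W) h hg Λ (fun ξ => hdiff _ K' hK' h1 ξ) hts η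
    refine h2.trans ?_
    rw [finiteSemigroup_smul]
    simp only [Pi.smul_apply, smul_eq_mul]
    have h3 := finiteSemigroup_weight_le h hg Λ hc0 hLW hts η
    have h4 : K' ≤ K * Real.exp (c * s) := mul_le_mul_of_nonneg_left
      (Real.exp_le_exp.2 (mul_le_mul_of_nonneg_right hc hs.1)) hK
    calc K' * finiteSemigroup p g Λ (t - s) W η
        ≤ K' * (Real.exp (c * (t - s)) * W η) := mul_le_mul_of_nonneg_left h3 hK'
      _ ≤ K * Real.exp (c * s) * (Real.exp (c * (t - s)) * W η) :=
        mul_le_mul_of_nonneg_right h4 (mul_nonneg (Real.exp_pos _).le (hW η))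
      _ = K * Real.exp (c * t) * W η := by
        have : Real.exp (c * t) = Real.exp (c * s) * Real.exp (c * (t - s)) := by
          rw [← Real.exp_add]; congr 1; ring
        rw [this]; ring
  have := norm_image_sub_le_of_norm_deriv_le_segment' hderiv hbound t ⟨ht, le_rfl⟩
  simpa [finiteSemigroup_zero] using this

end Estimates

/-! ### The flow through bonds not contained in a finite volume. -/

section Weights

variable {V : Type*} {p : V → V → ℝ} {a : V → ℝ} {M : ℝ}

theorem AdmissibleKernel.boundary_summand (h : AdmissibleKernel p a M) (x : V) :
    Summable (fun y => (p x y + p y x) * (a x + a y)) ∧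
      ∑' y, (p x y + p y x) * (a x + a y) ≤ (2 * M + 2) * a x := by
  have s1 := (h.row x).summable.mul_right (a x)
  have s2 := h.summable_row_weight x
  have s3 := (h.col x).summable.mul_right (a x)
  have s4 := h.summable_col_weight x
  have e : (fun y => (p x y + p y x) * (a x + a y)) =
      fun y => (p x y * a x + p x y * a y) + (p y x * a x + a y * p y x) := by
    funext y; ring
  rw [e]
  refine ⟨(s1.add s2).add (s3.add s4), ?_⟩
  rw [(s1.add s2).tsum_add (s3.add s4), s1.tsum_add s2, s3.tsum_add s4, tsum_mul_right,
    tsum_mul_right, (h.row x).tsum_eq, (h.col x).tsum_eq]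
  linarith [h.row_weight x, h.col_weight x]

theorem AdmissibleKernel.flow_nonneg (h : AdmissibleKernel p a M) (x y : V) :
    0 ≤ (p x y + p y x) * (a x + a y) :=
  mul_nonneg (add_nonneg (h.nonneg _ _) (h.nonneg _ _)) (add_pos (h.pos _) (h.pos _)).le

/-- The linear functional `ξ ↦ ∑ x, ξ x * w x`. -/
noncomputable def linearWeight (w : V → ℝ) (ξ : stateSpace a) : ℝ :=
  ∑' x, (ξ.1 x : ℝ) * w x

theorem summable_state_mul {w : V → ℝ} {κ : ℝ} (hw0 : ∀ x, 0 ≤ w x) (hw : ∀ x, w x ≤ κ * a x)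
    (ξ : stateSpace a) : Summable fun x => (ξ.1 x : ℝ) * w x := by
  refine Summable.of_nonneg_of_le (fun x => mul_nonneg (Nat.cast_nonneg _) (hw0 x)) (fun x => ?_)
    (Summable.mul_left κ ξ.2)
  rw [mul_left_comm]
  exact mul_le_mul_of_nonneg_left (hw x) (Nat.cast_nonneg _)

variable [DecidableEq V]

/-- The part of the flow through `x` along bonds that are not contained in `Λ`. -/
noncomputable def boundaryFlow (p : V → V → ℝ) (a : V → ℝ) (Λ : Finset V) (x : V) : ℝ :=
  ∑' y, if x ∈ Λ ∧ y ∈ Λ then 0 else (p x y + p y x) * (a x + a y)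

theorem AdmissibleKernel.summable_boundaryFlow (h : AdmissibleKernel p a M) (Λ : Finset V)
    (x : V) :
    Summable fun y => if x ∈ Λ ∧ y ∈ Λ then 0 else (p x y + p y x) * (a x + a y) := by
  refine Summable.of_nonneg_of_le (fun y => ?_) (fun y => ?_) (h.boundary_summand x).1
  · split_ifs
    exacts [le_rfl, h.flow_nonneg x y]
  · split_ifs
    exacts [h.flow_nonneg x y, le_rfl]

theorem AdmissibleKernel.boundaryFlow_le (h : AdmissibleKernel p a M) (Λ : Finset V) (x : V) :
    boundaryFlow p a Λ x ≤ (2 * M + 2) * a x := by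
  refine ((h.summable_boundaryFlow Λ x).tsum_le_tsum (fun y => ?_)
    (h.boundary_summand x).1).trans (h.boundary_summand x).2
  split_ifs
  exacts [h.flow_nonneg x y, le_rfl]

theorem AdmissibleKernel.tendsto_boundaryFlow (h : AdmissibleKernel p a M) (x : V) :
    Tendsto (fun Λ => boundaryFlow p a Λ x) atTop (𝓝 0) := by
  have := tendsto_tsum_of_dominated_convergence (𝓕 := atTop)
    (f := fun (Λ : Finset V) y => if x ∈ Λ ∧ y ∈ Λ then 0 else (p x y + p y x) * (a x + a y))
    (g := fun _ => 0) (h.boundary_summand x).1 (fun y => ?_) (Eventually.of_forall fun Λ y => ?_)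
  · rw [tsum_zero] at this
    exact this
  · refine tendsto_const_nhds.congr' ?_
    filter_upwards [eventually_ge_atTop {x, y}] with Λ hΛ
    rw [if_pos ⟨hΛ (by simp), hΛ (by simp)⟩]
  · rw [Real.norm_eq_abs]
    split_ifs
    · simpa using h.flow_nonneg x y
    · exact (abs_of_nonneg (h.flow_nonneg x y)).le

/-! ### An almost superharmonic majorant of the boundary flow that vanishes in the limit. -/

/-- Powers of the kernel `p`. -/
noncomputable def kernelPow (p : V → V → ℝ) : ℕ → V → V → ENNReal
  | 0, x, z => if x = z then 1 else 0
  | n + 1, x, z => ∑' y, ENNReal.ofReal (p x y) * kernelPow p n y z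

/-- The resolvent `∑ θ ^ n p ^ n`. -/
noncomputable def resolventKernel (p : V → V → ℝ) (θ : ENNReal) (x z : V) : ENNReal :=
  ∑' n, θ ^ n * kernelPow p n x z

/-- Iteration of `p a ≤ M a`, in `ENNReal` so that sums may be exchanged freely. -/
theorem AdmissibleKernel.tsum_kernelPow_le (h : AdmissibleKernel p a M) (n : ℕ) (x : V) :
    ∑' z, kernelPow p n x z * ENNReal.ofReal (a z) ≤
      ENNReal.ofReal M ^ n * ENNReal.ofReal (a x) := by
  induction n generalizing x with
  | zero => simp [kernelPow, ite_mul]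
  | succ n ih =>
    calc ∑' z, kernelPow p (n + 1) x z * ENNReal.ofReal (a z)
        = ∑' y, ENNReal.ofReal (p x y) * ∑' z, kernelPow p n y z * ENNReal.ofReal (a z) := by
          simp_rw [kernelPow, ← ENNReal.tsum_mul_right, ← ENNReal.tsum_mul_left]
          rw [ENNReal.tsum_comm]
          simp_rw [mul_assoc]
      _ ≤ ∑' y, ENNReal.ofReal (p x y) * (ENNReal.ofReal M ^ n * ENNReal.ofReal (a y)) :=
          ENNReal.tsum_le_tsum fun y => mul_le_mul_right (ih y) _
      _ = ENNReal.ofReal M ^ n * ENNReal.ofReal (∑' y, p x y * a y) := by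
          rw [ENNReal.ofReal_tsum_of_nonneg (fun y => mul_nonneg (h.nonneg _ _) (h.pos _).le)
            (h.summable_row_weight x), ← ENNReal.tsum_mul_left]
          refine tsum_congr fun y => ?_
          rw [ENNReal.ofReal_mul (h.nonneg _ _)]
          ring
      _ ≤ ENNReal.ofReal M ^ n * ENNReal.ofReal (M * a x) :=
          mul_le_mul_right (ENNReal.ofReal_le_ofReal (h.row_weight x)) _
      _ = ENNReal.ofReal M ^ (n + 1) * ENNReal.ofReal (a x) := by
          rw [ENNReal.ofReal_mul h.M_pos.le, pow_succ, mul_assoc]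

/-- The parameter `(2 M)⁻¹` turns the bounds `M ^ n` into a geometric series of ratio `1/2`, whence
the factor `2`. -/
theorem AdmissibleKernel.tsum_resolventKernel_le (h : AdmissibleKernel p a M) (x : V) :
    ∑' z, resolventKernel p (ENNReal.ofReal (2 * M)⁻¹) x z * ENNReal.ofReal (a z) ≤
      2 * ENNReal.ofReal (a x) := by
  have hM := h.M_pos
  calc ∑' z, resolventKernel p (ENNReal.ofReal (2 * M)⁻¹) x z * ENNReal.ofReal (a z)
      = ∑' n, ENNReal.ofReal (2 * M)⁻¹ ^ n *
          ∑' z, kernelPow p n x z * ENNReal.ofReal (a z) := by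
        simp_rw [resolventKernel, ← ENNReal.tsum_mul_right, ← ENNReal.tsum_mul_left]
        rw [ENNReal.tsum_comm]
        simp_rw [mul_assoc]
    _ ≤ ∑' n, (2⁻¹ : ENNReal) ^ n * ENNReal.ofReal (a x) := by
        refine ENNReal.tsum_le_tsum fun n => ?_
        refine (mul_le_mul_right (h.tsum_kernelPow_le n x) _).trans (le_of_eq ?_)
        rw [← mul_assoc, ← mul_pow, ← ENNReal.ofReal_mul (by positivity)]
        congr 2
        rw [show (2 * M)⁻¹ * M = 2⁻¹ by field_simp, ENNReal.ofReal_inv_of_pos two_pos]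
        simp
    _ = 2 * ENNReal.ofReal (a x) := by
        rw [ENNReal.tsum_mul_right, ENNReal.tsum_geometric, ENNReal.one_sub_inv_two, inv_inv]

theorem one_le_resolventKernel (θ : ENNReal) (x : V) : 1 ≤ resolventKernel p θ x x :=
  le_trans (by simp [kernelPow]) (ENNReal.le_tsum (f := fun n => θ ^ n * kernelPow p n x x) 0)

/-- Applying `θ p` shifts the series by one, that is, drops its zeroth term. -/
theorem mul_tsum_resolventKernel_le (θ : ENNReal) (x z : V) :
    θ * ∑' y, ENNReal.ofReal (p x y) * resolventKernel p θ y z ≤ resolventKernel p θ x z := by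
  calc θ * ∑' y, ENNReal.ofReal (p x y) * resolventKernel p θ y z
      = ∑' n, θ ^ (n + 1) * kernelPow p (n + 1) x z := by
        simp_rw [resolventKernel, ← ENNReal.tsum_mul_left]
        rw [ENNReal.tsum_comm]
        refine tsum_congr fun n => ?_
        rw [kernelPow, ← ENNReal.tsum_mul_left]
        refine tsum_congr fun y => ?_
        ring
    _ ≤ resolventKernel p θ x z :=
        ENNReal.tsum_comp_le_tsum_of_injective Nat.succ_injective
          (fun n => θ ^ n * kernelPow p n x z)

/-- The extended nonnegative version of `boundaryWeight`. -/
noncomputable def boundaryWeightENN (p : V → V → ℝ) (a : V → ℝ) (M : ℝ) (Λ : Finset V) (x : V) :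
    ENNReal :=
  ∑' z, resolventKernel p (ENNReal.ofReal (2 * M)⁻¹) x z * ENNReal.ofReal (boundaryFlow p a Λ z)

/-- An almost superharmonic weight that dominates `boundaryFlow`. -/
noncomputable def boundaryWeight (p : V → V → ℝ) (a : V → ℝ) (M : ℝ) (Λ : Finset V) (x : V) : ℝ :=
  (boundaryWeightENN p a M Λ x).toReal

namespace AdmissibleKernel

theorem resolvent_flow_le (h : AdmissibleKernel p a M) (Λ : Finset V) (x z : V) :
    resolventKernel p (ENNReal.ofReal (2 * M)⁻¹) x z * ENNReal.ofReal (boundaryFlow p a Λ z) ≤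
      ENNReal.ofReal (2 * M + 2) *
        (resolventKernel p (ENNReal.ofReal (2 * M)⁻¹) x z * ENNReal.ofReal (a z)) := by
  rw [mul_left_comm, ← ENNReal.ofReal_mul (by linarith [h.M_pos])]
  exact mul_le_mul_right (ENNReal.ofReal_le_ofReal (h.boundaryFlow_le Λ z)) _

theorem tsum_dominating_le (h : AdmissibleKernel p a M) (x : V) :
    ∑' z, ENNReal.ofReal (2 * M + 2) *
        (resolventKernel p (ENNReal.ofReal (2 * M)⁻¹) x z * ENNReal.ofReal (a z)) ≤
      ENNReal.ofReal ((4 * M + 4) * a x) := by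
  have hM := h.M_pos
  rw [ENNReal.tsum_mul_left]
  refine (mul_le_mul_right (h.tsum_resolventKernel_le x) _).trans (le_of_eq ?_)
  rw [show (2 : ENNReal) = ENNReal.ofReal 2 by simp, ← ENNReal.ofReal_mul (by positivity),
    ← ENNReal.ofReal_mul (by positivity)]
  congr 1
  ring

theorem boundaryWeightENN_le (h : AdmissibleKernel p a M) (Λ : Finset V) (x : V) :
    boundaryWeightENN p a M Λ x ≤ ENNReal.ofReal ((4 * M + 4) * a x) :=
  (ENNReal.tsum_le_tsum fun z => h.resolvent_flow_le Λ x z).trans (h.tsum_dominating_le x)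

theorem boundaryWeightENN_ne_top (h : AdmissibleKernel p a M) (Λ : Finset V) (x : V) :
    boundaryWeightENN p a M Λ x ≠ ⊤ :=
  ((h.boundaryWeightENN_le Λ x).trans_lt ENNReal.ofReal_lt_top).ne

theorem boundaryWeight_le (h : AdmissibleKernel p a M) (Λ : Finset V) (x : V) :
    boundaryWeight p a M Λ x ≤ (4 * M + 4) * a x :=
  ENNReal.toReal_le_of_le_ofReal
    (mul_nonneg (by linarith [h.M_pos]) (h.pos x).le) (h.boundaryWeightENN_le Λ x)

theorem boundaryFlow_le_weight (h : AdmissibleKernel p a M) (Λ : Finset V) (x : V) :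
    boundaryFlow p a Λ x ≤ boundaryWeight p a M Λ x := by
  refine (ENNReal.ofReal_le_iff_le_toReal (h.boundaryWeightENN_ne_top Λ x)).1 ?_
  refine le_trans ?_ (ENNReal.le_tsum x)
  exact le_mul_of_one_le_left zero_le (one_le_resolventKernel _ x)

/-- This is why the resolvent is taken: `boundaryFlow` tends to zero but need not be almost
superharmonic, while `a` is almost superharmonic but independent of `Λ`. The weight has both
virtues. -/
theorem tsum_mul_boundaryWeight_le (h : AdmissibleKernel p a M) (Λ : Finset V) (x : V) :
    ∑' y, p x y * boundaryWeight p a M Λ y ≤ 2 * M * boundaryWeight p a M Λ x := by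
  have hM := h.M_pos
  have hθ : ENNReal.ofReal (2 * M) * ENNReal.ofReal (2 * M)⁻¹ = 1 := by
    rw [← ENNReal.ofReal_mul (by positivity), mul_inv_cancel₀ (by positivity), ENNReal.ofReal_one]
  have h1 : ∑' y, ENNReal.ofReal (p x y) * boundaryWeightENN p a M Λ y ≤
      ENNReal.ofReal (2 * M) * boundaryWeightENN p a M Λ x := by
    simp_rw [boundaryWeightENN, ← ENNReal.tsum_mul_left]
    rw [ENNReal.tsum_comm]
    refine ENNReal.tsum_le_tsum fun z => ?_
    simp_rw [← mul_assoc]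
    rw [ENNReal.tsum_mul_right]
    refine mul_le_mul_left ?_ _
    refine le_trans (le_of_eq ?_) (mul_le_mul_right
      (mul_tsum_resolventKernel_le (p := p) (ENNReal.ofReal (2 * M)⁻¹) x z) _)
    rw [← mul_assoc, hθ, one_mul]
  have h2 : ∀ y, p x y * boundaryWeight p a M Λ y =
      (ENNReal.ofReal (p x y) * boundaryWeightENN p a M Λ y).toReal := fun y => by
    rw [ENNReal.toReal_mul, ENNReal.toReal_ofReal (h.nonneg x y)]
    rfl
  simp_rw [h2]
  rw [← ENNReal.tsum_toReal_eq fun y =>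
    ENNReal.mul_ne_top ENNReal.ofReal_ne_top (h.boundaryWeightENN_ne_top Λ y)]
  refine (ENNReal.toReal_mono (ENNReal.mul_ne_top ENNReal.ofReal_ne_top
    (h.boundaryWeightENN_ne_top Λ x)) h1).trans (le_of_eq ?_)
  rw [ENNReal.toReal_mul, ENNReal.toReal_ofReal (by positivity)]
  rfl

/-- Dominated convergence for the counting measure: each flow tends to zero and is at most `(2 M +
2) a`, against which the resolvent kernel is summable. -/
theorem tendsto_boundaryWeight [Countable V] (h : AdmissibleKernel p a M) (x : V) :
    Tendsto (fun Λ => boundaryWeight p a M Λ x) atTop (𝓝 0) := by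
  have h1 : Tendsto (fun Λ => boundaryWeightENN p a M Λ x) atTop (𝓝 0) := by
    let _ : MeasurableSpace V := ⊤
    have := tendsto_lintegral_filter_of_dominated_convergence (μ := Measure.count) (l := atTop)
      (F := fun (Λ : Finset V) z => resolventKernel p (ENNReal.ofReal (2 * M)⁻¹) x z *
        ENNReal.ofReal (boundaryFlow p a Λ z)) (f := fun _ => 0)
      (fun z => ENNReal.ofReal (2 * M + 2) *
        (resolventKernel p (ENNReal.ofReal (2 * M)⁻¹) x z * ENNReal.ofReal (a z)))
      (Eventually.of_forall fun Λ => measurable_from_top)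
      (Eventually.of_forall fun Λ => Eventually.of_forall fun z => h.resolvent_flow_le Λ x z)
      (by
        rw [lintegral_count]
        exact ((h.tsum_dominating_le x).trans_lt ENNReal.ofReal_lt_top).ne)
      (Eventually.of_forall fun z => by
        have h2 : resolventKernel p (ENNReal.ofReal (2 * M)⁻¹) x z ≠ ⊤ := by
          intro htop
          have h3 := (ENNReal.le_tsum z).trans (h.tsum_resolventKernel_le x)
          rw [htop, ENNReal.top_mul (ENNReal.ofReal_pos.2 (h.pos z)).ne'] at h3
          exact absurd (top_le_iff.1 h3)
            (ENNReal.mul_ne_top ENNReal.ofNat_ne_top ENNReal.ofReal_ne_top)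
        have h4 := ENNReal.tendsto_ofReal (h.tendsto_boundaryFlow z)
        have h5 := ENNReal.Tendsto.const_mul (a := resolventKernel p (ENNReal.ofReal (2 * M)⁻¹) x z)
          h4 (Or.inr h2)
        simpa using h5)
    simp_rw [lintegral_count] at this
    rw [tsum_zero] at this
    exact this
  exact (ENNReal.tendsto_toReal ENNReal.zero_ne_top).comp h1

theorem boundaryWeight_nonneg (Λ : Finset V) (x : V) : 0 ≤ boundaryWeight p a M Λ x :=
  ENNReal.toReal_nonneg

end AdmissibleKernel

theorem AdmissibleKernel.tendsto_linearWeight [Countable V] (h : AdmissibleKernel p a M)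
    (ξ : stateSpace a) :
    Tendsto (fun Λ => linearWeight (boundaryWeight p a M Λ) ξ) atTop (𝓝 0) := by
  have := tendsto_tsum_of_dominated_convergence (𝓕 := atTop)
    (f := fun (Λ : Finset V) x => (ξ.1 x : ℝ) * boundaryWeight p a M Λ x)
    (g := fun _ => 0) (bound := fun x => (4 * M + 4) * (ξ.1 x * a x))
    (Summable.mul_left _ ξ.2) (fun y => ?_) (Eventually.of_forall fun Λ x => ?_)
  · rw [tsum_zero] at this
    exact this
  · simpa using (h.tendsto_boundaryWeight y).const_mul (ξ.1 y : ℝ)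
  · rw [Real.norm_eq_abs, abs_of_nonneg
      (mul_nonneg (Nat.cast_nonneg _) (AdmissibleKernel.boundaryWeight_nonneg Λ x)), mul_left_comm]
    exact mul_le_mul_of_nonneg_left (h.boundaryWeight_le Λ x) (Nat.cast_nonneg _)

end Weights

/-! ### The infinite-volume limit and its semigroup properties. -/

section InfiniteVolume

variable {V : Type*} {p : V → V → ℝ} {a : V → ℝ} {M : ℝ}
  {g : ℕ → ℕ → ℕ → ℝ} {C : ℝ}

/-- An exponential rate which controls the finite-volume semigroups. -/
noncomputable def growthRate (M C D : ℝ) : ℝ := max (D * (2 * M + 2)) (C * (1 + 2 * M))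

theorem growthRate_nonneg {D : ℝ} (h : AdmissibleKernel p a M) (hg : RateBounds g C) :
    0 ≤ growthRate M C D :=
  le_max_of_le_right (mul_nonneg hg.pos.le (by linarith [h.M_pos]))

/-- The dominating summand of the generator. -/
noncomputable def bondBound (p : V → V → ℝ) (a : V → ℝ) (η : stateSpace a) (xy : V × V) : ℝ :=
  p xy.1 xy.2 * ((η.1 xy.1 : ℝ) + η.1 xy.2) * (a xy.1 + a xy.2)

theorem bondBound_nonneg (h : AdmissibleKernel p a M) (η : stateSpace a) (xy : V × V) :
    0 ≤ bondBound p a η xy :=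
  mul_nonneg (mul_nonneg (h.nonneg _ _) (by positivity)) (add_pos (h.pos _) (h.pos _)).le

variable [DecidableEq V]

/-- The departure from `x` can only lower the functional, so the arrival at `y` alone is counted. -/
theorem linearWeight_jump_le {w : V → ℝ} {κ : ℝ} (hw0 : ∀ x, 0 ≤ w x) (hw : ∀ x, w x ≤ κ * a x)
    (x y : V) (k : ℕ) (ξ : stateSpace a) :
    linearWeight w (jumpState x y k ξ) ≤ linearWeight w ξ + k * w y := by
  have h1 : HasSum (fun z => if z = y then (k : ℝ) * w y else 0) (k * w y) := hasSum_ite_eq y _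
  unfold linearWeight
  rw [← h1.tsum_eq, ← (summable_state_mul hw0 hw ξ).tsum_add h1.summable]
  refine (summable_state_mul hw0 hw _).tsum_le_tsum (fun z => ?_)
    ((summable_state_mul hw0 hw ξ).add h1.summable)
  have h2 : ((jumpState x y k ξ).1 z : ℝ) ≤ ξ.1 z + if z = y then (k : ℝ) else 0 := by
    change (jump x y k ξ.1 z : ℝ) ≤ _
    have : jump x y k ξ.1 z ≤ ξ.1 z + if z = y then k else 0 := by
      by_cases hk : k ≤ ξ.1 x
      · rw [jump, if_pos hk]
        exact Nat.add_le_add_right (Nat.sub_le _ _) _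
      · rw [jump, if_neg hk]
        exact Nat.le_add_right _ _
    exact_mod_cast this
  refine (mul_le_mul_of_nonneg_right h2 (hw0 z)).trans (le_of_eq ?_)
  split_ifs with hz
  · subst hz; ring
  · ring

/-- Linear growth splits the gain at `y` into a part proportional to `ξ x`, bounded through `p w ≤ m
w`, and a part proportional to `ξ y`, bounded through the column sums. -/
theorem finiteGenerator_linearWeight_le (h : AdmissibleKernel p a M) (hg : RateBounds g C)
    {w : V → ℝ} {κ m : ℝ} (hw0 : ∀ x, 0 ≤ w x) (hw : ∀ x, w x ≤ κ * a x)
    (hpw : ∀ x, ∑' y, p x y * w y ≤ m * w x) (hm : 0 ≤ m) (Λ : Finset V) (ξ : stateSpace a) :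
    finiteGenerator p g Λ (linearWeight w) ξ ≤ C * (1 + m) * linearWeight w ξ := by
  have hbond : ∀ x y, bondGenerator p g x y (linearWeight w) ξ ≤
      C * (ξ.1 x * (p x y * w y)) + C * (p x y * (ξ.1 y * w y)) := by
    intro x y
    have h1 : ∀ k ∈ Finset.Icc 1 (ξ.1 x), p x y * g k (ξ.1 x) (ξ.1 y) *
        (linearWeight w (jumpState x y k ξ) - linearWeight w ξ) ≤
        p x y * w y * (k * g k (ξ.1 x) (ξ.1 y)) := by
      intro k _
      have h2 : linearWeight w (jumpState x y k ξ) - linearWeight w ξ ≤ k * w y := by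
        linarith [linearWeight_jump_le hw0 hw x y k ξ]
      have := mul_le_mul_of_nonneg_left h2
        (mul_nonneg (h.nonneg x y) (hg.nonneg k (ξ.1 x) (ξ.1 y)))
      linarith
    refine (Finset.sum_le_sum h1).trans ?_
    rw [← Finset.mul_sum]
    have := mul_le_mul_of_nonneg_left (hg.growth (ξ.1 x) (ξ.1 y))
      (mul_nonneg (h.nonneg x y) (hw0 y))
    linarith
  have hsw : ∀ x, Summable fun y => p x y * w y := fun x =>
    Summable.of_nonneg_of_le (fun y => mul_nonneg (h.nonneg _ _) (hw0 y))
      (fun y => mul_le_mul_of_nonneg_left (hw y) (h.nonneg _ _))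
      (by simpa [mul_left_comm] using (h.summable_row_weight x).mul_left κ)
  have hlin : ∑ x ∈ Λ, (ξ.1 x : ℝ) * w x ≤ linearWeight w ξ :=
    (summable_state_mul hw0 hw ξ).sum_le_tsum _ fun x _ => mul_nonneg (Nat.cast_nonneg _) (hw0 x)
  have hrow : ∑ x ∈ Λ, ∑ y ∈ Λ, C * (ξ.1 x * (p x y * w y)) ≤ C * (m * linearWeight w ξ) := by
    simp_rw [← Finset.mul_sum]
    refine mul_le_mul_of_nonneg_left ?_ hg.pos.le
    refine le_trans ?_ (mul_le_mul_of_nonneg_left hlin hm)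
    rw [Finset.mul_sum]
    refine Finset.sum_le_sum fun x _ => ?_
    rw [mul_left_comm]
    refine mul_le_mul_of_nonneg_left (le_trans ?_ (hpw x)) (Nat.cast_nonneg _)
    exact (hsw x).sum_le_tsum _ fun y _ => mul_nonneg (h.nonneg _ _) (hw0 y)
  have hcol : ∑ x ∈ Λ, ∑ y ∈ Λ, C * (p x y * (ξ.1 y * w y)) ≤ C * linearWeight w ξ := by
    rw [Finset.sum_comm]
    simp_rw [← Finset.mul_sum]
    refine mul_le_mul_of_nonneg_left (le_trans (Finset.sum_le_sum fun y _ => ?_) hlin) hg.pos.le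
    rw [← Finset.sum_mul]
    refine mul_le_of_le_one_left (mul_nonneg (Nat.cast_nonneg _) (hw0 y)) ?_
    exact sum_le_hasSum _ (fun x _ => h.nonneg x y) (h.col y)
  have := Finset.sum_le_sum fun x (_ : x ∈ Λ) => Finset.sum_le_sum fun y (_ : y ∈ Λ) => hbond x y
  simp_rw [Finset.sum_add_distrib] at this
  unfold finiteGenerator
  linarith

/-- Only bonds not contained in `Λ` remain, and the particles at `x` contribute at most `ξ x` times
the boundary flow through `x`. -/
theorem abs_finiteGenerator_sub_le (h : AdmissibleKernel p a M) (hg : RateBounds g C)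
    {Λ Λ' : Finset V} (hΛ : Λ ⊆ Λ') {f : stateSpace a → ℝ} {K : ℝ} (hK : 0 ≤ K)
    (hf : LipschitzBound a K f) (ξ : stateSpace a) :
    |finiteGenerator p g Λ' f ξ - finiteGenerator p g Λ f ξ| ≤
      K * (C * linearWeight (boundaryWeight p a M Λ) ξ) := by
  set q : V → V → ℝ := fun x y => if x ∈ Λ ∧ y ∈ Λ then 0 else p x y * (a x + a y) with hq
  have hdiff : finiteGenerator p g Λ' f ξ - finiteGenerator p g Λ f ξ =
      ∑ x ∈ Λ', ∑ y ∈ Λ', if x ∈ Λ ∧ y ∈ Λ then 0 else bondGenerator p g x y f ξ := by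
    have h1 : finiteGenerator p g Λ f ξ =
        ∑ x ∈ Λ', ∑ y ∈ Λ', if x ∈ Λ ∧ y ∈ Λ then bondGenerator p g x y f ξ else 0 := by
      unfold finiteGenerator
      refine Finset.sum_subset_zero_on_sdiff hΛ (fun x hx => ?_) (fun x hx => ?_)
      · rw [Finset.mem_sdiff] at hx
        simp [hx.2]
      · refine Finset.sum_subset_zero_on_sdiff hΛ (fun y hy => ?_) (fun y hy => ?_)
        · rw [Finset.mem_sdiff] at hy
          simp [hy.2]
        · simp [hx, hy]
    rw [h1]
    unfold finiteGenerator
    simp_rw [← Finset.sum_sub_distrib]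
    refine Finset.sum_congr rfl fun x _ => Finset.sum_congr rfl fun y _ => ?_
    split_ifs <;> simp
  have hterm : ∀ x y, |if x ∈ Λ ∧ y ∈ Λ then 0 else bondGenerator p g x y f ξ| ≤
      K * C * (ξ.1 x * q x y) + K * C * (ξ.1 y * q x y) := by
    intro x y
    simp only [hq]
    split_ifs
    · simp
    · exact (abs_bondGenerator_le h hg hK hf x y ξ).trans (le_of_eq (by ring))
  rw [hdiff]
  refine (Finset.abs_sum_le_sum_abs _ _).trans ((Finset.sum_le_sum fun x _ =>
    (Finset.abs_sum_le_sum_abs _ _).trans (Finset.sum_le_sum fun y _ => hterm x y)).trans ?_)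
  simp_rw [Finset.sum_add_distrib]
  -- Relabelling the target as `x` collects both roles of a site; hence the symmetrized `p x y + p y
  -- x` in `boundaryFlow`.
  rw [Finset.sum_comm (f := fun x y => K * C * (ξ.1 y * q x y)), ← Finset.sum_add_distrib]
  simp_rw [← Finset.mul_sum, ← mul_add, ← Finset.sum_add_distrib]
  rw [← Finset.mul_sum, mul_assoc]
  refine mul_le_mul_of_nonneg_left (mul_le_mul_of_nonneg_left ?_ hg.pos.le) hK
  refine le_trans (Finset.sum_le_sum fun x _ => ?_)
    ((summable_state_mul (fun x => AdmissibleKernel.boundaryWeight_nonneg Λ x)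
      (h.boundaryWeight_le Λ) ξ).sum_le_tsum Λ'
      fun x _ => mul_nonneg (Nat.cast_nonneg _) (AdmissibleKernel.boundaryWeight_nonneg Λ x))
  refine mul_le_mul_of_nonneg_left (le_trans ?_ (h.boundaryFlow_le_weight Λ x)) (Nat.cast_nonneg _)
  refine le_trans (le_of_eq (Finset.sum_congr rfl fun y _ => ?_))
    ((h.summable_boundaryFlow Λ x).sum_le_tsum Λ' fun y _ => ?_)
  · simp only [hq, and_comm (a := y ∈ Λ)]
    split_ifs <;> ring
  · split_ifs
    exacts [le_rfl, h.flow_nonneg x y]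

section Lipschitz

variable {D : ℝ} (h : AdmissibleKernel p a M) (hg : RateBounds g C)
  (hL : ∀ α β γ δ : ℕ, ∑ k ∈ Finset.Icc 1 (max α γ), (k : ℝ) * |g k α β - g k γ δ| ≤
      D * (|(α : ℝ) - γ| + |(β : ℝ) - δ|)) (hD : 0 ≤ D)

/-- The error bound for the finite-volume approximation. -/
noncomputable def volumeError (p : V → V → ℝ) (a : V → ℝ) (M C : ℝ) (Λ : Finset V)
    (ξ : stateSpace a) : ℝ :=
  C * linearWeight (boundaryWeight p a M Λ) ξ

include hg in
theorem volumeError_nonneg (Λ : Finset V) (ξ : stateSpace a) : 0 ≤ volumeError p a M C Λ ξ :=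
  mul_nonneg hg.pos.le (tsum_nonneg fun x => mul_nonneg (Nat.cast_nonneg _)
    (AdmissibleKernel.boundaryWeight_nonneg Λ x))

include h in
theorem tendsto_volumeError [Countable V] (ξ : stateSpace a) :
    Tendsto (fun Λ => volumeError p a M C Λ ξ) atTop (𝓝 0) := by
  simpa [volumeError] using (h.tendsto_linearWeight ξ).const_mul C

include h hg in
theorem finiteGenerator_volumeError_le (Λ Λ' : Finset V) (ξ : stateSpace a) :
    finiteGenerator p g Λ' (volumeError p a M C Λ) ξ ≤
      growthRate M C D * volumeError p a M C Λ ξ := by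
  have h1 := finiteGenerator_linearWeight_le h hg
    (fun x => AdmissibleKernel.boundaryWeight_nonneg (p := p) (a := a) (M := M) Λ x)
    (h.boundaryWeight_le Λ) (h.tsum_mul_boundaryWeight_le Λ) (by linarith [h.M_pos]) Λ' ξ
  have h2 : volumeError p a M C Λ = C • linearWeight (boundaryWeight p a M Λ) := rfl
  rw [h2, finiteGenerator_smul, ← h2, Pi.smul_apply, smul_eq_mul]
  refine (mul_le_mul_of_nonneg_left h1 hg.pos.le).trans ?_
  have h3 := mul_le_mul_of_nonneg_right (le_max_right (D * (2 * M + 2)) (C * (1 + 2 * M)))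
    (volumeError_nonneg (p := p) (a := a) (M := M) hg Λ ξ)
  refine le_trans (le_of_eq ?_) h3
  rw [h2, Pi.smul_apply, smul_eq_mul]
  ring

include h hg hL hD in
theorem abs_finiteSemigroup_sub_le_volumeError {Λ Λ' : Finset V} (hΛ : Λ ⊆ Λ')
    {f : stateSpace a → ℝ} {K : ℝ} (hK : 0 ≤ K) (hf : LipschitzBound a K f)
    {t : ℝ} (ht : 0 ≤ t) (η : stateSpace a) :
    |finiteSemigroup p g Λ' t f η - finiteSemigroup p g Λ t f η| ≤
      K * Real.exp (growthRate M C D * t) * volumeError p a M C Λ η * t :=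
  abs_finiteSemigroup_sub_le h hg hL hD hΛ hK hf (le_max_left _ _) (volumeError_nonneg hg Λ)
    (finiteGenerator_volumeError_le h hg Λ Λ)
    (fun _ _ hK hw ξ => abs_finiteGenerator_sub_le h hg hΛ hK hw ξ) ht η

include h hg hL hD in
theorem tendsto_limitSemigroup [Countable V] {f : stateSpace a → ℝ} (hf : IsLip a f) {t : ℝ}
    (ht : 0 ≤ t) (η : stateSpace a) :
    Tendsto (fun Λ => finiteSemigroup p g Λ t f η) atTop (𝓝 (limitSemigroup p g t f η)) := by
  obtain ⟨K, hK, hf⟩ := hf.exists_nonneg fun x => (h.pos x).le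
  have hc : CauchySeq fun Λ : Finset V => finiteSemigroup p g Λ t f η := by
    refine cauchySeq_of_le_tendsto_0'
      (fun Λ => K * Real.exp (growthRate M C D * t) * volumeError p a M C Λ η * t)
      (fun Λ Λ' hΛ => ?_) ?_
    · rw [dist_comm, Real.dist_eq]
      exact abs_finiteSemigroup_sub_le_volumeError h hg hL hD hΛ hK hf ht η
    · simpa using ((tendsto_volumeError (C := C) h η).const_mul
        (K * Real.exp (growthRate M C D * t))).mul_const t
  exact tendsto_nhds_limUnder (cauchySeq_tendsto_of_complete hc)

include h hg hL hD in
theorem abs_limitSemigroup_sub_le [Countable V] (Λ : Finset V)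
    {f : stateSpace a → ℝ} {K : ℝ} (hK : 0 ≤ K) (hf : LipschitzBound a K f)
    {t : ℝ} (ht : 0 ≤ t) (η : stateSpace a) :
    |limitSemigroup p g t f η - finiteSemigroup p g Λ t f η| ≤
      K * Real.exp (growthRate M C D * t) * t * volumeError p a M C Λ η := by
  refine le_of_tendsto (((tendsto_limitSemigroup h hg hL hD ⟨K, hf⟩ ht η).sub_const _).abs) ?_
  filter_upwards [eventually_ge_atTop Λ] with Λ' hΛ
  exact (abs_finiteSemigroup_sub_le_volumeError h hg hL hD hΛ hK hf ht η).trans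
    (le_of_eq (by ring))

include h hg hL hD in
theorem limitSemigroup_lipschitz [Countable V] {f : stateSpace a → ℝ} {K : ℝ} (hK : 0 ≤ K)
    (hf : LipschitzBound a K f) {t : ℝ} (ht : 0 ≤ t) :
    LipschitzBound a (K * Real.exp (D * (2 * M + 2) * t)) (limitSemigroup p g t f) := by
  intro η ζ
  exact le_of_tendsto (((tendsto_limitSemigroup h hg hL hD ⟨K, hf⟩ ht η).sub
    (tendsto_limitSemigroup h hg hL hD ⟨K, hf⟩ ht ζ)).abs)
    (Eventually.of_forall fun Λ => finiteSemigroup_lipschitz h hg hL hD Λ hK hf ht η ζ)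

include h hg hL hD in
theorem limitSemigroup_lipschitz_uniform [Countable V] {f : stateSpace a → ℝ} {K : ℝ} (hK : 0 ≤ K)
    (hf : LipschitzBound a K f) {t T : ℝ} (ht : 0 ≤ t) (hT : t ≤ T) :
    LipschitzBound a (K * Real.exp (D * (2 * M + 2) * T)) (limitSemigroup p g t f) := by
  refine (limitSemigroup_lipschitz h hg hL hD hK hf ht).mono (fun x => (h.pos x).le) ?_
  refine mul_le_mul_of_nonneg_left (Real.exp_le_exp.2 (mul_le_mul_of_nonneg_left hT ?_)) hK
  exact mul_nonneg hD (by linarith [h.M_pos])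

include h hg hL hD in
theorem finiteSemigroup_lipschitz_uniform (Λ : Finset V) {f : stateSpace a → ℝ} {K : ℝ}
    (hK : 0 ≤ K) (hf : LipschitzBound a K f) {t T : ℝ} (ht : 0 ≤ t) (hT : t ≤ T) :
    LipschitzBound a (K * Real.exp (D * (2 * M + 2) * T)) (finiteSemigroup p g Λ t f) := by
  refine (finiteSemigroup_lipschitz h hg hL hD Λ hK hf ht).mono (fun x => (h.pos x).le) ?_
  refine mul_le_mul_of_nonneg_left (Real.exp_le_exp.2 (mul_le_mul_of_nonneg_left hT ?_)) hK
  exact mul_nonneg hD (by linarith [h.M_pos])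

include h hg hL hD in
-- In finite volume the identity is exact. Replacing the inner `S_Λ(t) f` by its limit costs a
-- multiple of `volumeError`, and the outer `S_Λ(s)` multiplies this error by at most an
-- exponential, so it still vanishes.
theorem limitSemigroup_add [Countable V] {f : stateSpace a → ℝ} (hf : IsLip a f) {s t : ℝ}
    (hs : 0 ≤ s) (ht : 0 ≤ t) :
    limitSemigroup p g (s + t) f = limitSemigroup p g s (limitSemigroup p g t f) := by
  funext η
  obtain ⟨K, hK, hKf⟩ := hf.exists_nonneg fun x => (h.pos x).le
  have h1 := tendsto_limitSemigroup h hg hL hD hf (add_nonneg hs ht) η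
  have h2 := tendsto_limitSemigroup h hg hL hD
    ⟨_, limitSemigroup_lipschitz h hg hL hD hK hKf ht⟩ hs η
  set κ := K * Real.exp (growthRate M C D * t) * t with hκ
  have hκ0 : 0 ≤ κ := by positivity
  refine tendsto_nhds_unique h1 ?_
  have h3 : Tendsto (fun Λ => finiteSemigroup p g Λ (s + t) f η -
      finiteSemigroup p g Λ s (limitSemigroup p g t f) η) atTop (𝓝 0) := by
    refine squeeze_zero_norm (a := fun Λ => κ * (Real.exp (growthRate M C D * s) *
      volumeError p a M C Λ η)) (fun Λ => ?_) ?_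
    · have h4 := abs_finiteSemigroup_le (p := p) (g := g) (t := s)
        (f := finiteSemigroup p g Λ t f - limitSemigroup p g t f)
        (w := κ • volumeError p a M C Λ) h hg Λ (fun ξ => by
          rw [Pi.sub_apply, abs_sub_comm]
          exact abs_limitSemigroup_sub_le h hg hL hD Λ hK hKf ht ξ) hs η
      rw [finiteSemigroup_sub, finiteSemigroup_smul] at h4
      rw [finiteSemigroup_semigroup, Real.norm_eq_abs]
      refine h4.trans (mul_le_mul_of_nonneg_left ?_ hκ0)
      exact finiteSemigroup_weight_le h hg Λ (growthRate_nonneg h hg)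
        (finiteGenerator_volumeError_le h hg Λ Λ) hs η
    · simpa using ((tendsto_volumeError (C := C) h η).const_mul
        (Real.exp (growthRate M C D * s))).const_mul κ
  simpa using h3.add h2

include h hg hL hD in
theorem tendsto_finiteGenerator [Countable V] {f : stateSpace a → ℝ} (hf : IsLip a f) {t : ℝ}
    (ht : 0 ≤ t) (η : stateSpace a) :
    Tendsto (fun Λ => finiteGenerator p g Λ (finiteSemigroup p g Λ t f) η) atTop
      (𝓝 (generator p g (limitSemigroup p g t f) η)) := by
  obtain ⟨K, hK, hKf⟩ := hf.exists_nonneg fun x => (h.pos x).le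
  set K' := K * Real.exp (D * (2 * M + 2) * t)
  have hK' : 0 ≤ K' := mul_nonneg hK (Real.exp_pos _).le
  have h1 : ∀ Λ : Finset V, finiteGenerator p g Λ (finiteSemigroup p g Λ t f) η =
      ∑' xy : V × V, if xy ∈ Λ ×ˢ Λ then
        bondGenerator p g xy.1 xy.2 (finiteSemigroup p g Λ t f) η else 0 := by
    intro Λ
    rw [tsum_eq_sum (s := Λ ×ˢ Λ) fun xy hxy => if_neg hxy, finiteGenerator,
      ← Finset.sum_product' Λ Λ fun x y => bondGenerator p g x y (finiteSemigroup p g Λ t f) η]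
    exact Finset.sum_congr rfl fun xy hxy => (if_pos hxy).symm
  simp_rw [h1]
  refine tendsto_tsum_of_dominated_convergence (bound := fun xy => K' * C * bondBound p a η xy)
    ((summable_state_pair h η).mul_left (K' * C)) (fun xy => ?_)
    (Eventually.of_forall fun Λ xy => ?_)
  · have h2 : Tendsto (fun Λ => bondGenerator p g xy.1 xy.2 (finiteSemigroup p g Λ t f) η) atTop
        (𝓝 (bondGenerator p g xy.1 xy.2 (limitSemigroup p g t f) η)) :=
      tendsto_finsetSum _ fun k _ => ((tendsto_limitSemigroup h hg hL hD hf ht _).sub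
        (tendsto_limitSemigroup h hg hL hD hf ht η)).const_mul _
    refine h2.congr' ?_
    filter_upwards [eventually_ge_atTop {xy.1, xy.2}] with Λ hΛ
    rw [if_pos (Finset.mem_product.2 ⟨hΛ (by simp), hΛ (by simp)⟩)]
  · split_ifs
    · exact abs_bondGenerator_le h hg hK' (finiteSemigroup_lipschitz h hg hL hD Λ hK hKf ht) _ _ η
    · simpa using mul_nonneg (mul_nonneg hK' hg.pos.le) (bondBound_nonneg h η xy)

include h hg in
theorem abs_finiteGenerator_le {f : stateSpace a → ℝ} {K : ℝ} (hK : 0 ≤ K)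
    (hf : LipschitzBound a K f) (Λ : Finset V) (η : stateSpace a) :
    |finiteGenerator p g Λ f η| ≤ K * C * ∑' xy, bondBound p a η xy := by
  unfold finiteGenerator
  rw [← Finset.sum_product' Λ Λ fun x y => bondGenerator p g x y f η, ← tsum_mul_left]
  refine (Finset.abs_sum_le_sum_abs _ _).trans ((Finset.sum_le_sum fun xy _ =>
    abs_bondGenerator_le h hg hK hf xy.1 xy.2 η).trans ?_)
  exact ((summable_state_pair h η).mul_left (K * C)).sum_le_tsum _ fun xy _ =>
    mul_nonneg (mul_nonneg hK hg.pos.le) (bondBound_nonneg h η xy)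

include h hg hL hD in
-- The finite-volume time derivatives are bounded uniformly in `Λ`, so the limit is Lipschitz in
-- time.
theorem continuousOn_limitSemigroup [Countable V] {f : stateSpace a → ℝ} (hf : IsLip a f)
    (η : stateSpace a) (T : ℝ) :
    ContinuousOn (fun s => limitSemigroup p g s f η) (Set.Icc 0 T) := by
  obtain ⟨K, hK, hKf⟩ := hf.exists_nonneg fun x => (h.pos x).le
  set K' := K * Real.exp (D * (2 * M + 2) * T)
  have hK' : 0 ≤ K' := mul_nonneg hK (Real.exp_pos _).le
  set B := K' * C * ∑' xy, bondBound p a η xy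
  have hB : 0 ≤ B := mul_nonneg (mul_nonneg hK' hg.pos.le) (tsum_nonneg (bondBound_nonneg h η))
  have h1 : ∀ s ∈ Set.Icc 0 T, ∀ t ∈ Set.Icc 0 T,
      ‖limitSemigroup p g t f η - limitSemigroup p g s f η‖ ≤ B * ‖t - s‖ := by
    intro s hs t ht
    refine le_of_tendsto ((tendsto_limitSemigroup h hg hL hD hf ht.1 η).sub
      (tendsto_limitSemigroup h hg hL hD hf hs.1 η)).norm (Eventually.of_forall fun Λ => ?_)
    refine (convex_Icc (0 : ℝ) T).norm_image_sub_le_of_norm_hasDerivWithin_le (𝕜 := ℝ)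
      (f := fun s => finiteSemigroup p g Λ s f η) (C := B)
      (fun u _ => (hasDerivAt_finiteSemigroup Λ f η u).hasDerivWithinAt) (fun u hu => ?_) hs ht
    exact abs_finiteGenerator_le h hg hK'
      (finiteSemigroup_lipschitz_uniform h hg hL hD Λ hK hKf hu.1 hu.2) Λ η
  have h2 : LipschitzOnWith B.toNNReal (fun s => limitSemigroup p g s f η) (Set.Icc 0 T) := by
    refine LipschitzOnWith.of_dist_le_mul fun s hs t ht => ?_
    rw [Real.coe_toNNReal _ hB, dist_eq_norm, dist_eq_norm]
    exact h1 t ht s hs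
  exact h2.continuousOn

include h hg hL hD in
theorem continuousOn_generator_limitSemigroup [Countable V] {f : stateSpace a → ℝ}
    (hf : IsLip a f) (η : stateSpace a) (T : ℝ) :
    ContinuousOn (fun s => generator p g (limitSemigroup p g s f) η) (Set.Icc 0 T) := by
  obtain ⟨K, hK, hKf⟩ := hf.exists_nonneg fun x => (h.pos x).le
  set K' := K * Real.exp (D * (2 * M + 2) * T)
  have hK' : 0 ≤ K' := mul_nonneg hK (Real.exp_pos _).le
  refine continuousOn_tsum (u := fun xy => K' * C * bondBound p a η xy) (fun xy => ?_)
    ((summable_state_pair h η).mul_left (K' * C)) (fun xy s hs => ?_)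
  · exact continuousOn_finsetSum _ fun k _ => continuousOn_const.mul
      ((continuousOn_limitSemigroup h hg hL hD hf _ T).sub
        (continuousOn_limitSemigroup h hg hL hD hf η T))
  · exact abs_bondGenerator_le h hg hK'
      (limitSemigroup_lipschitz_uniform h hg hL hD hK hKf hs.1 hs.2) _ _ η

theorem limitSemigroup_zero {f : stateSpace a → ℝ} : limitSemigroup p g 0 f = f := by
  funext η
  simp only [limitSemigroup, finiteSemigroup_zero]
  exact tendsto_const_nhds.limUnder_eq

include h hg hL hD in
-- Derivatives do not pass to a pointwise limit; the integrated equation does, by dominated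
-- convergence.
theorem limitSemigroup_eq_integral [Countable V] {f : stateSpace a → ℝ} (hf : IsLip a f)
    (η : stateSpace a) {t : ℝ} (ht : 0 ≤ t) :
    limitSemigroup p g t f η =
      f η + ∫ s in (0 : ℝ)..t, generator p g (limitSemigroup p g s f) η := by
  obtain ⟨K, hK, hKf⟩ := hf.exists_nonneg fun x => (h.pos x).le
  set K' := K * Real.exp (D * (2 * M + 2) * t)
  have hK' : 0 ≤ K' := mul_nonneg hK (Real.exp_pos _).le
  have hcont : ∀ Λ : Finset V,
      Continuous fun s => finiteGenerator p g Λ (finiteSemigroup p g Λ s f) η := by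
    intro Λ
    have h1 : ∀ ξ, Continuous fun s => finiteSemigroup p g Λ s f ξ := fun ξ =>
      continuous_iff_continuousAt.2 fun s => (hasDerivAt_finiteSemigroup Λ f ξ s).continuousAt
    exact continuous_finsetSum _ fun x _ => continuous_finsetSum _ fun y _ =>
      continuous_finsetSum _ fun k _ => continuous_const.mul ((h1 _).sub (h1 η))
  have hint : ∀ Λ : Finset V, finiteSemigroup p g Λ t f η =
      f η + ∫ s in (0 : ℝ)..t, finiteGenerator p g Λ (finiteSemigroup p g Λ s f) η := by
    intro Λ
    rw [intervalIntegral.integral_eq_sub_of_hasDerivAt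
      (fun s _ => hasDerivAt_finiteSemigroup Λ f η s) ((hcont Λ).intervalIntegrable 0 t),
      finiteSemigroup_zero]
    ring
  refine tendsto_nhds_unique (tendsto_limitSemigroup h hg hL hD hf ht η) ?_
  simp_rw [hint]
  refine Tendsto.const_add _ ?_
  refine intervalIntegral.tendsto_integral_filter_of_dominated_convergence
    (fun _ => K' * C * ∑' xy, bondBound p a η xy)
    (Eventually.of_forall fun Λ => (hcont Λ).aestronglyMeasurable)
    (Eventually.of_forall fun Λ => Eventually.of_forall fun s hs => ?_)
    intervalIntegrable_const (Eventually.of_forall fun s hs => ?_)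
  · rw [Set.uIoc_of_le ht] at hs
    exact abs_finiteGenerator_le h hg hK'
      (finiteSemigroup_lipschitz_uniform h hg hL hD Λ hK hKf hs.1.le hs.2) Λ η
  · rw [Set.uIoc_of_le ht] at hs
    exact tendsto_finiteGenerator h hg hL hD hf hs.1.le η

include h hg hL hD in
theorem hasDerivWithinAt_limitSemigroup [Countable V] {f : stateSpace a → ℝ} (hf : IsLip a f)
    (η : stateSpace a) {t : ℝ} (ht : 0 ≤ t) :
    HasDerivWithinAt (fun s => limitSemigroup p g s f η)
      (generator p g (limitSemigroup p g t f) η) (Set.Ici 0) t := by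
  set φ : ℝ → ℝ := fun s => generator p g (limitSemigroup p g s f) η with hφ
  have hφc : ContinuousOn φ (Set.Ici 0) := by
    intro s hs
    refine ((continuousOn_generator_limitSemigroup h hg hL hD hf η (s + 1)) s
      ⟨hs, by linarith⟩).mono_of_mem_nhdsWithin ?_
    rw [mem_nhdsWithin]
    exact ⟨Set.Iio (s + 1), isOpen_Iio, by simp, fun u hu => ⟨hu.2, le_of_lt hu.1⟩⟩
  -- Freezing the integrand at negative times makes it continuous on the whole line, so the
  -- two-sided fundamental theorem applies and is then restricted.
  have hψ : Continuous fun s : ℝ => φ (max 0 s) :=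
    hφc.comp_continuous (continuous_const.max continuous_id) fun s => Set.mem_Ici.2 (le_max_left 0 s)
  have h1 : HasDerivAt (fun u => f η + ∫ s in (0 : ℝ)..u, φ (max 0 s)) (φ (max 0 t)) t :=
    (intervalIntegral.integral_hasDerivAt_right (hψ.intervalIntegrable 0 t)
      (hψ.stronglyMeasurableAtFilter _ _) hψ.continuousAt).const_add (f η)
  rw [max_eq_right ht] at h1
  refine h1.hasDerivWithinAt.congr (fun u hu => ?_) ?_
  all_goals
    rw [limitSemigroup_eq_integral h hg hL hD hf η (by assumption)]
    congr 1
    refine intervalIntegral.integral_congr fun s hs => ?_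
    rw [Set.uIcc_of_le (by assumption)] at hs
    simp only [hφ, max_eq_right hs.1]

include h hg hL hD in
/-- The infinite-volume limit is a Markov semigroup with generator `ℒ`. -/
theorem isMarkovSemigroup_limitSemigroup [Countable V] :
    IsMarkovSemigroup a p g (limitSemigroup p g) where
  lip f hf T := by
    obtain ⟨K, hK, hKf⟩ := hf.exists_nonneg fun x => (h.pos x).le
    exact ⟨_, fun t ht hT => limitSemigroup_lipschitz_uniform h hg hL hD hK hKf ht hT⟩
  zero f _ := limitSemigroup_zero
  add f hf s t hs ht := limitSemigroup_add h hg hL hD hf hs ht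
  linear f w hf hw b c t ht := by
    funext η
    have hfw : IsLip a fun η => b * f η + c * w η := by
      obtain ⟨K, hK⟩ := hf
      obtain ⟨K', hK'⟩ := hw
      refine ⟨|b| * K + |c| * K', fun η ζ => ?_⟩
      have h1 := mul_le_mul_of_nonneg_left (hK η ζ) (abs_nonneg b)
      have h2 := mul_le_mul_of_nonneg_left (hK' η ζ) (abs_nonneg c)
      rw [← abs_mul] at h1 h2
      have h3 := abs_add_le (b * (f η - f ζ)) (c * (w η - w ζ))
      rw [show b * f η + c * w η - (b * f ζ + c * w ζ) =
        b * (f η - f ζ) + c * (w η - w ζ) by ring]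
      linarith
    refine tendsto_nhds_unique (tendsto_limitSemigroup h hg hL hD hfw ht η) ?_
    have h1 : ∀ Λ : Finset V, finiteSemigroup p g Λ t (fun η => b * f η + c * w η) η =
        b * finiteSemigroup p g Λ t f η + c * finiteSemigroup p g Λ t w η := fun Λ => by
      have := congrFun (finiteSemigroup_add_apply (p := p) (g := g) Λ (b • f) (c • w) t) η
      rw [finiteSemigroup_smul, finiteSemigroup_smul] at this
      exact this
    simp_rw [h1]
    exact ((tendsto_limitSemigroup h hg hL hD hf ht η).const_mul b).add
      ((tendsto_limitSemigroup h hg hL hD hw ht η).const_mul c)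
  nonneg f hf hf0 t ht η := ge_of_tendsto (tendsto_limitSemigroup h hg hL hD hf ht η)
    (Eventually.of_forall fun Λ => finiteSemigroup_nonneg h hg Λ hf0 ht η)
  one t _ := by
    funext η
    simp only [limitSemigroup, finiteSemigroup_const]
    exact tendsto_const_nhds.limUnder_eq
  backward f hf η t ht := hasDerivWithinAt_limitSemigroup h hg hL hD hf η ht

end Lipschitz

end InfiniteVolume

/-! ### Algebra of the rates: flux, one-step recursion and the coefficients `H`. -/

section Rates

variable {m : ℕ → ℝ} {r : ℕ → ℕ → ℝ}

/-- The net rate at which the pair of occupation numbers `(α, β)` of a bond `(x, y)` gains mass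
relative to the product weight `m α * m β`. -/
noncomputable def flux (m : ℕ → ℝ) (r : ℕ → ℕ → ℝ) (α β : ℕ) : ℝ :=
  (∑ k ∈ Finset.Icc 1 β, r k (β - k) * (m (α + k) * m (β - k))) / (m α * m β) -
    ∑ k ∈ Finset.Icc 1 α, r k β

/-- A jump of size `k` is a bijection between configurations `(i + k, j)` and `(i, j + k)` of a bond
with `n` particles. -/
theorem sum_antidiagonal_shift {E : Type*} [AddCommMonoid E] (φ : ℕ → ℕ → ℕ → E) (n : ℕ) :
    ∑ q ∈ Finset.HasAntidiagonal.antidiagonal n, ∑ k ∈ Finset.Icc 1 q.1, φ (q.1 - k) q.2 k =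
      ∑ q ∈ Finset.HasAntidiagonal.antidiagonal n, ∑ k ∈ Finset.Icc 1 q.2, φ q.1 (q.2 - k) k := by
  rw [Finset.sum_sigma', Finset.sum_sigma']
  refine Finset.sum_bij' (fun s _ => ⟨(s.1.1 - s.2, s.1.2 + s.2), s.2⟩)
    (fun s _ => ⟨(s.1.1 + s.2, s.1.2 - s.2), s.2⟩) ?_ ?_ ?_ ?_ ?_
  · rintro ⟨⟨i, j⟩, k⟩ hs
    simp only [Finset.mem_sigma, Finset.HasAntidiagonal.mem_antidiagonal, Finset.mem_Icc] at hs ⊢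
    omega
  · rintro ⟨⟨i, j⟩, k⟩ hs
    simp only [Finset.mem_sigma, Finset.HasAntidiagonal.mem_antidiagonal, Finset.mem_Icc] at hs ⊢
    omega
  · rintro ⟨⟨i, j⟩, k⟩ hs
    simp only [Finset.mem_sigma, Finset.HasAntidiagonal.mem_antidiagonal, Finset.mem_Icc] at hs
    simp only [Sigma.mk.injEq, Prod.mk.injEq, heq_eq_eq, and_true]
    omega
  · rintro ⟨⟨i, j⟩, k⟩ hs
    simp only [Finset.mem_sigma, Finset.HasAntidiagonal.mem_antidiagonal, Finset.mem_Icc] at hs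
    simp only [Sigma.mk.injEq, Prod.mk.injEq, heq_eq_eq, and_true]
    omega
  · rintro ⟨⟨i, j⟩, k⟩ hs
    simp

/-- Jumps preserve the total of the pair, so gain and loss cancel within each total. -/
theorem sum_antidiagonal_flux (hm : ∀ n, 0 < m n) (n : ℕ) :
    ∑ q ∈ Finset.HasAntidiagonal.antidiagonal n, m q.1 * m q.2 * flux m r q.1 q.2 = 0 := by
  have h1 := sum_antidiagonal_shift (fun i j k => r k j * (m (i + k) * m j)) n
  have h2 : ∀ q : ℕ × ℕ, m q.1 * m q.2 * flux m r q.1 q.2 =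
      (∑ k ∈ Finset.Icc 1 q.2, r k (q.2 - k) * (m (q.1 + k) * m (q.2 - k))) -
        ∑ k ∈ Finset.Icc 1 q.1, r k q.2 * (m (q.1 - k + k) * m q.2) := by
    intro q
    have h3 := (mul_pos (hm q.1) (hm q.2)).ne'
    rw [flux, mul_sub, mul_div_cancel₀ _ h3, Finset.mul_sum]
    congr 1
    refine Finset.sum_congr rfl fun k hk => ?_
    rw [Nat.sub_add_cancel (Finset.mem_Icc.1 hk).2]
    ring
  simp_rw [h2]
  rw [Finset.sum_sub_distrib, ← h1, sub_self]

/-- In the gain only the ratio `m (α + k) / m α` depends on `α`, and its increment is `Delta`; the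
loss gains one term. -/
theorem flux_succ_sub (hm : ∀ n, 0 < m n) (α β : ℕ) :
    flux m r (α + 1) β - flux m r α β =
      1 / m β * ∑ k ∈ Finset.Icc 1 β, Delta m (α + 1) k * m (β - k) * r k (β - k) -
        r (α + 1) β := by
  have h1 := (hm α).ne'
  have h2 := (hm (α + 1)).ne'
  have h3 := (hm β).ne'
  have h4 : ∑ k ∈ Finset.Icc 1 β, Delta m (α + 1) k * m (β - k) * r k (β - k) =
      (∑ k ∈ Finset.Icc 1 β, r k (β - k) * (m (α + 1 + k) * m (β - k))) / m (α + 1) -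
      (∑ k ∈ Finset.Icc 1 β, r k (β - k) * (m (α + k) * m (β - k))) / m α := by
    rw [Finset.sum_div, Finset.sum_div, ← Finset.sum_sub_distrib]
    refine Finset.sum_congr rfl fun k _ => ?_
    rw [Delta, show α + 1 + k - 1 = α + k by omega, Nat.add_sub_cancel]
    ring
  rw [h4, flux, flux, Finset.sum_Icc_succ_top (by omega)]
  field_simp
  ring

/-- The one-step form of the invariance condition. -/
def StepCondition (m : ℕ → ℝ) (r : ℕ → ℕ → ℝ) : Prop :=
  ∀ α β : ℕ, 1 ≤ α → 1 ≤ β → r α β = r α 0 +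
    1 / m β * ∑ k ∈ Finset.Icc 1 β, Delta m α k * m (β - k) * r k (β - k)

/-- The increment in `α` equals `φ (α + 1) - φ α` for every `β`. At `β = 0` the gain sum is empty
and this is `-r (α + 1) 0`; equating the two cases is the recursion. -/
theorem stepCondition_of_flux (hm : ∀ n, 0 < m n) {φ : ℕ → ℝ}
    (hφ : ∀ α β, flux m r α β = φ α - φ β) : StepCondition m r := by
  intro α β hα _
  obtain ⟨α, rfl⟩ := Nat.exists_eq_add_of_le' hα
  have h1 := flux_succ_sub (r := r) hm α β
  have h2 := flux_succ_sub (r := r) hm α 0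
  rw [hφ, hφ] at h1 h2
  simp only [zero_lt_one, Finset.Icc_eq_empty_of_lt, Finset.sum_empty] at h2
  linarith

/-- The recursion fixes the dependence on `α`, leaving `flux m r 0 β` unknown; conservation of
particles determines it. -/
theorem flux_of_stepCondition (hm : ∀ n, 0 < m n) (h : StepCondition m r) (α β : ℕ) :
    flux m r α β = ∑ k ∈ Finset.Icc 1 β, r k 0 - ∑ k ∈ Finset.Icc 1 α, r k 0 := by
  have h1 : ∀ α β, flux m r α β = flux m r 0 β - ∑ k ∈ Finset.Icc 1 α, r k 0 := by
    intro α β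
    induction α with
    | zero => simp
    | succ α ih =>
      have h2 := flux_succ_sub (r := r) hm α β
      rw [Finset.sum_Icc_succ_top (by omega)]
      rcases Nat.eq_zero_or_pos β with rfl | hβ
      · simp only [zero_lt_one, Finset.Icc_eq_empty_of_lt, Finset.sum_empty] at h2
        linarith
      · have := h (α + 1) β (by omega) hβ
        linarith
  -- On the antidiagonal of `β`, the loss sums cancel after swapping coordinates; by induction the
  -- only term left is the one at `(0, β)`.
  have h3 : ∀ β, flux m r 0 β = ∑ k ∈ Finset.Icc 1 β, r k 0 := by
    intro β
    induction β using Nat.strong_induction_on with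
    | _ β ih =>
      have h4 := sum_antidiagonal_flux (r := r) hm β
      have h5 : ∑ q ∈ Finset.HasAntidiagonal.antidiagonal β, m q.1 * m q.2 *
          (flux m r 0 q.2 - ∑ k ∈ Finset.Icc 1 q.2, r k 0) = 0 := by
        have h6 : ∀ q : ℕ × ℕ, m q.1 * m q.2 * flux m r q.1 q.2 = m q.1 * m q.2 * flux m r 0 q.2 -
            m q.1 * m q.2 * ∑ k ∈ Finset.Icc 1 q.1, r k 0 := fun q => by rw [h1, mul_sub]
        rw [← h4, Finset.sum_congr rfl fun q _ => h6 q]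
        simp_rw [mul_sub, Finset.sum_sub_distrib]
        congr 1
        rw [← Finset.Nat.sum_antidiagonal_swap]
        exact Finset.sum_congr rfl fun q _ => by simp [mul_comm]
      rw [Finset.sum_eq_single (0, β)] at h5
      · have := (mul_pos (hm 0) (hm β)).ne'
        exact sub_eq_zero.1 ((mul_eq_zero.1 h5).resolve_left this)
      · rintro ⟨i, j⟩ hq hne
        rw [Finset.HasAntidiagonal.mem_antidiagonal] at hq
        have : j < β := by
          rcases Nat.lt_or_ge j β with hlt | hge
          · exact hlt
          · exact absurd (by rw [Prod.mk.injEq]; omega) hne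
        rw [ih j this, sub_self, mul_zero]
      · intro hn
        simp at hn
  rw [h1, h3]

theorem H_eq (m : ℕ → ℝ) (α : ℕ) {β k : ℕ} (hk : k ≤ β) :
    H m α β k = Delta m α k * m (β - k) +
      ∑ l ∈ Finset.Icc 1 (β - k), Delta m α l * H m l (β - l) k := by
  rcases hk.lt_or_eq with hk | rfl
  · exact H_of_lt m α β k hk
  · rw [H_self]
    simp

/-- Summing the recursion for `H` by its first step `l` leaves a problem of size `β - l`: this is
the substitution of the formula for `r l (β - l)` into the one-step recursion. -/
theorem sum_H_mul (m : ℕ → ℝ) (α β : ℕ) (ρ : ℕ → ℝ) :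
    ∑ k ∈ Finset.Icc 1 β, H m α β k * ρ k =
      ∑ l ∈ Finset.Icc 1 β, Delta m α l *
        (m (β - l) * ρ l + ∑ k ∈ Finset.Icc 1 (β - l), H m l (β - l) k * ρ k) := by
  have h1 : ∀ k ∈ Finset.Icc 1 β, H m α β k * ρ k = Delta m α k * (m (β - k) * ρ k) +
      ∑ l ∈ Finset.Icc 1 (β - k), Delta m α l * (H m l (β - l) k * ρ k) := by
    intro k hk
    rw [H_eq m α (Finset.mem_Icc.1 hk).2, add_mul, Finset.sum_mul]
    simp_rw [mul_assoc]
  rw [Finset.sum_congr rfl h1]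
  simp_rw [mul_add, Finset.sum_add_distrib, Finset.mul_sum]
  congr 1
  refine Finset.sum_comm' fun k l => ?_
  simp only [Finset.mem_Icc]
  omega

theorem stepCondition_iff (hm : ∀ n, 0 < m n) :
    StepCondition m r ↔ ∀ α β : ℕ, 1 ≤ α → 1 ≤ β →
      r α β = r α 0 + 1 / m β * ∑ k ∈ Finset.Icc 1 β, H m α β k * r k 0 := by
  -- Only the formula at smaller second index is used, so the same identity serves the induction and
  -- the converse.
  have key : ∀ α β : ℕ, (∀ β' < β, ∀ l, 1 ≤ l → 1 ≤ β' →
      r l β' = r l 0 + 1 / m β' * ∑ k ∈ Finset.Icc 1 β', H m l β' k * r k 0) →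
      ∑ k ∈ Finset.Icc 1 β, H m α β k * r k 0 =
        ∑ k ∈ Finset.Icc 1 β, Delta m α k * m (β - k) * r k (β - k) := by
    intro α β h
    rw [sum_H_mul]
    refine Finset.sum_congr rfl fun l hl => ?_
    rw [Finset.mem_Icc] at hl
    rw [mul_assoc]
    congr 1
    rcases Nat.eq_zero_or_pos (β - l) with h0 | hpos
    · simp [h0]
    · rw [h (β - l) (by omega) l hl.1 hpos]
      have := (hm (β - l)).ne'
      field_simp
  constructor
  · intro h α β hα hβ
    induction β using Nat.strong_induction_on generalizing α with
    | _ β ih =>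
      rw [key α β fun β' hβ' l hl hβ1 => ih β' hβ' l hl hβ1]
      exact h α β hα hβ
  · intro h α β hα hβ
    rw [← key α β fun β' _ l hl hβ1 => h l β' hl hβ1]
    exact h α β hα hβ

end Rates

/-! ### Change of variables for jumps under the product measure. -/

section ProductMeasure

theorem integrable_iff_summable_real {X E : Type*} [Countable X] [MeasurableSpace X]
    [MeasurableSingletonClass X] [NormedAddCommGroup E] (μ : Measure X) [IsFiniteMeasure μ]
    {f : X → E} : Integrable f μ ↔ Summable fun x => μ.real {x} * ‖f x‖ := by
  have := integrable_sum_dirac_iff (f := f) (x := fun x : X => x) (c := fun x => μ {x})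
    fun x => measure_ne_top μ {x}
  rwa [Measure.sum_smul_dirac] at this

theorem summable_antidiagonal_iff {f : ℕ × ℕ → ℝ} (hf : ∀ q, 0 ≤ f q) :
    Summable f ↔ Summable fun n => ∑ q ∈ Finset.HasAntidiagonal.antidiagonal n, f q := by
  rw [← Finset.HasAntidiagonal.sigmaAntidiagonalEquivProd.summable_iff]
  refine (summable_sigma_of_nonneg
    (f := f ∘ Finset.HasAntidiagonal.sigmaAntidiagonalEquivProd) fun q => hf _).trans ?_
  constructor
  · intro h
    refine h.2.congr fun n => ?_
    rw [tsum_fintype]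
    exact Finset.sum_coe_sort (Finset.HasAntidiagonal.antidiagonal n) f
  · intro h
    refine ⟨fun n => Summable.of_finite, ?_⟩
    refine h.congr fun n => ?_
    rw [tsum_fintype]
    exact (Finset.sum_coe_sort (Finset.HasAntidiagonal.antidiagonal n) f).symm

theorem tsum_antidiagonal {f : ℕ × ℕ → ℝ} (hf : Summable f) :
    ∑' q, f q = ∑' n, ∑ q ∈ Finset.HasAntidiagonal.antidiagonal n, f q := by
  rw [← Finset.HasAntidiagonal.sigmaAntidiagonalEquivProd.tsum_eq]
  have h1 := Finset.HasAntidiagonal.sigmaAntidiagonalEquivProd.summable_iff.2 hf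
  refine h1.tsum_sigma.trans (tsum_congr fun n => ?_)
  rw [tsum_fintype]
  exact Finset.sum_coe_sort (Finset.HasAntidiagonal.antidiagonal n) f

theorem prod_real_singleton {μ : Measure ℕ} [SFinite μ] (q : ℕ × ℕ) :
    (μ.prod μ).real {q} = μ.real {q.1} * μ.real {q.2} := by
  rw [show ({q} : Set (ℕ × ℕ)) = {q.1} ×ˢ {q.2} from (Set.singleton_prod_singleton).symm,
    measureReal_prod_prod]

/-- The total rate at which mass leaves a site with `q.1` particles for one with `q.2`. -/
noncomputable def lossRate (r : ℕ → ℕ → ℝ) (q : ℕ × ℕ) : ℝ := ∑ k ∈ Finset.Icc 1 q.1, r k q.2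

/-- The rate, relative to the product weight `m`, at which the pair `q` is created by a jump. -/
noncomputable def gainRate (m : ℕ → ℝ) (r : ℕ → ℕ → ℝ) (q : ℕ × ℕ) : ℝ :=
  (∑ k ∈ Finset.Icc 1 q.2, r k (q.2 - k) * (m (q.1 + k) * m (q.2 - k))) / (m q.1 * m q.2)

/-- Transposition of the jump operator on a bond; the sums over a fixed total are finite, so no
convergence is involved. -/
theorem sum_antidiagonal_gain {μ : Measure ℕ} [SFinite μ] {r : ℕ → ℕ → ℝ}
    (hpos : ∀ n, 0 < μ.real {n}) (f : ℕ × ℕ → ℝ) (n : ℕ) :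
    ∑ q ∈ Finset.HasAntidiagonal.antidiagonal n, (μ.prod μ).real {q} *
        (f q * gainRate (fun n => μ.real {n}) r q) =
      ∑ q ∈ Finset.HasAntidiagonal.antidiagonal n, (μ.prod μ).real {q} *
        ∑ k ∈ Finset.Icc 1 q.1, r k q.2 * f (q.1 - k, q.2 + k) := by
  have h1 := sum_antidiagonal_shift
    (fun i j k => r k j * (μ.real {i + k} * μ.real {j}) * f (i, j + k)) n
  refine Eq.trans (Finset.sum_congr rfl fun q _ => ?_) (h1.symm.trans
    (Finset.sum_congr rfl fun q _ => ?_))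
  · have h2 := (mul_pos (hpos q.1) (hpos q.2)).ne'
    rw [prod_real_singleton, gainRate, mul_left_comm, mul_div_cancel₀ _ h2, Finset.mul_sum]
    refine Finset.sum_congr rfl fun k hk => ?_
    rw [Nat.sub_add_cancel (Finset.mem_Icc.1 hk).2]
    exact mul_comm _ _
  · rw [prod_real_singleton, Finset.mul_sum]
    refine Finset.sum_congr rfl fun k hk => ?_
    rw [Nat.sub_add_cancel (Finset.mem_Icc.1 hk).2]
    ring

variable {μ : Measure ℕ} [IsProbabilityMeasure μ] {r : ℕ → ℕ → ℝ} {C : ℝ}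

theorem lossRate_nonneg (hr : ∀ k β, 1 ≤ k → 0 ≤ r k β) (q : ℕ × ℕ) : 0 ≤ lossRate r q :=
  Finset.sum_nonneg fun k hk => hr k _ (Finset.mem_Icc.1 hk).1

theorem gainRate_nonneg {m : ℕ → ℝ} (hm : ∀ n, 0 < m n) (hr : ∀ k β, 1 ≤ k → 0 ≤ r k β)
    (q : ℕ × ℕ) : 0 ≤ gainRate m r q :=
  div_nonneg (Finset.sum_nonneg fun k hk => mul_nonneg (hr k _ (Finset.mem_Icc.1 hk).1)
    (mul_pos (hm _) (hm _)).le) (mul_pos (hm _) (hm _)).le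

variable (hpos : ∀ n, 0 < μ.real {n}) (hmoment : Summable fun n : ℕ => (n : ℝ) * μ.real {n})
  (hr : ∀ k β, 1 ≤ k → 0 ≤ r k β)
  (hgrowth : ∀ α β : ℕ, ∑ k ∈ Finset.Icc 1 α, (k : ℝ) * r k β ≤ C * ((α : ℝ) + β))

include hr hgrowth in
theorem lossRate_le (q : ℕ × ℕ) : lossRate r q ≤ C * ((q.1 : ℝ) + q.2) := by
  refine (Finset.sum_le_sum fun k hk => ?_).trans (hgrowth q.1 q.2)
  have hk := (Finset.mem_Icc.1 hk).1
  exact le_mul_of_one_le_left (hr k _ hk) (by exact_mod_cast hk)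

include hmoment in
theorem integrable_cast : Integrable (fun n : ℕ => (n : ℝ)) μ := by
  rw [integrable_iff_summable_real]
  exact hmoment.congr fun n => by simp [mul_comm]

include hmoment hr hgrowth in
theorem integrable_lossRate : Integrable (lossRate r) (μ.prod μ) := by
  have h1 : Integrable (fun q : ℕ × ℕ => C * ((q.1 : ℝ) + q.2)) (μ.prod μ) :=
    (((integrable_cast hmoment).comp_fst μ).add ((integrable_cast hmoment).comp_snd μ)).const_mul C
  refine h1.mono' (Measurable.of_discrete).aestronglyMeasurable (ae_of_all _ fun q => ?_)
  rw [Real.norm_eq_abs, abs_of_nonneg (lossRate_nonneg hr q)]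
  exact lossRate_le hr hgrowth q

include hpos hmoment hr hgrowth in
-- A direct growth bound is not available. Gain and loss are nonnegative with equal weighted sums on
-- each antidiagonal, so integrability transfers from the loss.
theorem integrable_gainRate : Integrable (gainRate (fun n => μ.real {n}) r) (μ.prod μ) := by
  have h1 := (integrable_iff_summable_real (μ.prod μ)).1
    (integrable_lossRate hmoment hr hgrowth)
  rw [summable_antidiagonal_iff fun q => mul_nonneg measureReal_nonneg (norm_nonneg _)] at h1
  rw [integrable_iff_summable_real,
    summable_antidiagonal_iff fun q => mul_nonneg measureReal_nonneg (norm_nonneg _)]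
  refine h1.congr fun n => ?_
  have h2 := sum_antidiagonal_gain (r := r) hpos (fun _ => 1) n
  simp only [one_mul, mul_one] at h2
  simp_rw [Real.norm_eq_abs, abs_of_nonneg (gainRate_nonneg hpos hr _),
    abs_of_nonneg (lossRate_nonneg hr _)]
  exact h2.symm

include hpos hmoment hr hgrowth in
theorem integrable_flux :
    Integrable (fun q : ℕ × ℕ => flux (fun n => μ.real {n}) r q.1 q.2) (μ.prod μ) :=
  (integrable_gainRate hpos hmoment hr hgrowth).sub (integrable_lossRate hmoment hr hgrowth)

include hr in
theorem abs_sum_rate_mul_le {f : ℕ → ℝ} {B : ℝ} (hf : ∀ k, |f k| ≤ B) (q : ℕ × ℕ) :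
    |∑ k ∈ Finset.Icc 1 q.1, r k q.2 * f k| ≤ B * lossRate r q := by
  rw [lossRate, Finset.mul_sum]
  refine (Finset.abs_sum_le_sum_abs _ _).trans (Finset.sum_le_sum fun k hk => ?_)
  have := hr k q.2 (Finset.mem_Icc.1 hk).1
  rw [abs_mul, abs_of_nonneg this, mul_comm]
  exact mul_le_mul_of_nonneg_right (hf k) this

include hpos hmoment hr hgrowth in
theorem integral_pair_shift {f : ℕ × ℕ → ℝ} {B : ℝ} (hf : ∀ q, |f q| ≤ B) :
    ∫ q, ∑ k ∈ Finset.Icc 1 q.1, r k q.2 * f (q.1 - k, q.2 + k) ∂(μ.prod μ) =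
      ∫ q, f q * gainRate (fun n => μ.real {n}) r q ∂(μ.prod μ) := by
  have i1 : Integrable (fun q : ℕ × ℕ => ∑ k ∈ Finset.Icc 1 q.1, r k q.2 * f (q.1 - k, q.2 + k))
      (μ.prod μ) :=
    ((integrable_lossRate hmoment hr hgrowth).const_mul B).mono'
      (Measurable.of_discrete).aestronglyMeasurable
      (ae_of_all _ fun q => abs_sum_rate_mul_le hr (fun k => hf _) q)
  have i2 : Integrable (fun q => f q * gainRate (fun n => μ.real {n}) r q) (μ.prod μ) := by
    refine (integrable_gainRate hpos hmoment hr hgrowth).bdd_mul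
      (c := B) (Measurable.of_discrete).aestronglyMeasurable (ae_of_all _ hf)
  have s : ∀ {F : ℕ × ℕ → ℝ}, Integrable F (μ.prod μ) →
      Summable fun q => (μ.prod μ).real {q} • F q := fun hF => by
    have := (integrable_iff_summable_real _).1 hF
    exact Summable.of_norm (this.congr fun q => by
      rw [norm_smul, Real.norm_of_nonneg measureReal_nonneg])
  rw [integral_countable i1, integral_countable i2, tsum_antidiagonal (s i1),
    tsum_antidiagonal (s i2)]
  exact tsum_congr fun n => (sum_antidiagonal_gain hpos f n).symm

variable {V : Type*} [DecidableEq V]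

variable (μ) in
/-- Resampling one coordinate preserves the product measure. -/
theorem measurePreserving_update (x : V) :
    MeasurePreserving (fun q : (V → ℕ) × ℕ => Function.update q.1 x q.2)
      ((Measure.infinitePi fun _ : V => μ).prod μ) (Measure.infinitePi fun _ : V => μ) := by
  have hmeas : Measurable fun q : (V → ℕ) × ℕ => Function.update q.1 x q.2 := by
    refine measurable_pi_lambda _ fun z => ?_
    by_cases hz : z = x
    · subst hz
      simpa using measurable_snd
    · simp only [Function.update_of_ne hz]
      exact (measurable_pi_apply z).comp measurable_fst
  refine ⟨hmeas, ?_⟩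
  refine Measure.eq_infinitePi _ fun s t ht => ?_
  rw [Measure.map_apply hmeas (MeasurableSet.pi s.countable_toSet fun i _ => ht i)]
  have h1 : (fun q : (V → ℕ) × ℕ => Function.update q.1 x q.2) ⁻¹' Set.pi s t =
      Set.pi (s.erase x : Finset V) t ×ˢ (if x ∈ s then t x else Set.univ) := by
    ext ⟨η, α⟩
    simp only [Set.mem_preimage, Set.mem_pi, Set.mem_prod, Finset.mem_coe, Finset.mem_erase]
    constructor
    · intro h
      refine ⟨fun z hz => by simpa [Function.update_of_ne hz.1] using h z hz.2, ?_⟩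
      split_ifs with hx
      · simpa using h x hx
      · trivial
    · rintro ⟨h, hx⟩ z hz
      by_cases hzx : z = x
      · subst hzx
        simpa [hz] using hx
      · simpa [Function.update_of_ne hzx] using h z ⟨hzx, hz⟩
  rw [h1, Measure.prod_prod, Measure.infinitePi_pi _ fun i _ => ht i]
  split_ifs with hx
  · rw [mul_comm, Finset.mul_prod_erase s (fun i => μ (t i)) hx]
  · rw [measure_univ, mul_one, Finset.erase_eq_of_notMem hx]

variable (μ) in
/-- Resampling two coordinates preserves the product measure. -/
theorem measurePreserving_update_update (x y : V) :
    MeasurePreserving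
      (fun q : (V → ℕ) × ℕ × ℕ => Function.update (Function.update q.1 x q.2.1) y q.2.2)
      ((Measure.infinitePi fun _ : V => μ).prod (μ.prod μ))
      (Measure.infinitePi fun _ : V => μ) :=
  ((measurePreserving_update μ y).comp
    ((measurePreserving_update μ x).prod (MeasurePreserving.id μ))).comp
      (measurePreserving_prodAssoc _ μ μ).symm

variable (μ) in
theorem measurePreserving_pair {x y : V} (hxy : x ≠ y) :
    MeasurePreserving (fun η : V → ℕ => (η x, η y)) (Measure.infinitePi fun _ : V => μ)
      (μ.prod μ) := by
  have hmeas : Measurable fun η : V → ℕ => (η x, η y) :=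
    (measurable_pi_apply x).prodMk (measurable_pi_apply y)
  refine ⟨hmeas, ?_⟩
  have h1 := measurePreserving_update_update μ x y
  rw [← h1.map_eq, Measure.map_map hmeas h1.measurable]
  have h2 : ((fun η : V → ℕ => (η x, η y)) ∘ fun q : (V → ℕ) × ℕ × ℕ =>
      Function.update (Function.update q.1 x q.2.1) y q.2.2) = Prod.snd := by
    funext q
    simp [Function.update_of_ne hxy]
  rw [h2, Measure.map_snd_prod, measure_univ, one_smul]

theorem measurable_jump (x y : V) (k : ℕ) : Measurable (jump x y k) := by
  refine measurable_pi_lambda _ fun z => ?_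
  have h1 : (fun η : V → ℕ => jump x y k η z) = (fun q : ℕ × ℕ =>
      if k ≤ q.1 then (q.2 - if z = x then k else 0) + (if z = y then k else 0) else q.2) ∘
        fun η : V → ℕ => (η x, η z) := by
    funext η
    by_cases hk : k ≤ η x <;> simp [jump, hk]
  rw [h1]
  exact Measurable.of_discrete.comp ((measurable_pi_apply x).prodMk (measurable_pi_apply z))

theorem measurable_sum_Icc {Ω : Type*} [MeasurableSpace Ω] {F : ℕ → Ω → ℝ} {N : Ω → ℕ}
    (hF : ∀ k, Measurable (F k)) (hN : Measurable N) :
    Measurable fun ω => ∑ k ∈ Finset.Icc 1 (N ω), F k ω := by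
  have h1 : Measurable fun q : ℕ × Ω => ∑ k ∈ Finset.Icc 1 q.1, F k q.2 :=
    measurable_from_prod_countable_right fun n =>
      Finset.measurable_sum (Finset.Icc 1 n) fun k _ => hF k
  exact h1.comp (hN.prodMk measurable_id)

theorem jump_update_update {x y : V} (hxy : x ≠ y) (η : V → ℕ) {α β k : ℕ} (hk : k ≤ α) :
    jump x y k (Function.update (Function.update η x α) y β) =
      Function.update (Function.update η x (α - k)) y (β + k) := by
  have h1 : Function.update (Function.update η x α) y β x = α := by
    rw [Function.update_of_ne hxy, Function.update_self]
  rw [jump, if_pos (by rwa [h1])]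
  funext z
  by_cases hzy : z = y
  · subst hzy
    simp [hxy.symm]
  · by_cases hzx : z = x
    · subst hzx
      simp [hzy]
    · simp [hzy, hzx]

theorem integral_update_update {F : (V → ℕ) → ℝ}
    (hF : Integrable F (Measure.infinitePi fun _ : V => μ)) (x y : V) :
    ∫ η, F η ∂(Measure.infinitePi fun _ : V => μ) =
      ∫ η, ∫ q : ℕ × ℕ, F (Function.update (Function.update η x q.1) y q.2) ∂(μ.prod μ)
        ∂(Measure.infinitePi fun _ : V => μ) := by
  have h1 := measurePreserving_update_update μ x y
  have h2 := (h1.integrable_comp hF.aestronglyMeasurable).2 hF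
  refine Eq.trans ?_ (integral_prod _ h2)
  conv_lhs => rw [← h1.map_eq]
  rw [integral_map h1.measurable.aemeasurable (by rw [h1.map_eq]; exact hF.aestronglyMeasurable)]
  rfl

theorem integral_update {F : (V → ℕ) → ℝ}
    (hF : Integrable F (Measure.infinitePi fun _ : V => μ)) (x : V) :
    ∫ η, F η ∂(Measure.infinitePi fun _ : V => μ) =
      ∫ η, ∫ α, F (Function.update η x α) ∂μ ∂(Measure.infinitePi fun _ : V => μ) := by
  have h1 := measurePreserving_update μ x
  have h2 := (h1.integrable_comp hF.aestronglyMeasurable).2 hF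
  refine Eq.trans ?_ (integral_prod _ h2)
  conv_lhs => rw [← h1.map_eq]
  rw [integral_map h1.measurable.aemeasurable (by rw [h1.map_eq]; exact hF.aestronglyMeasurable)]
  rfl

include hpos hmoment hr hgrowth in
/-- Change of variables for the jumps from `x` to `y`. -/
theorem integral_jump_sub {x y : V} (hxy : x ≠ y) {f : (V → ℕ) → ℝ} (hfm : Measurable f)
    {B : ℝ} (hf : ∀ η, |f η| ≤ B) :
    ∫ η, ∑ k ∈ Finset.Icc 1 (η x), r k (η y) * (f (jump x y k η) - f η)
        ∂(Measure.infinitePi fun _ : V => μ) =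
      ∫ η, f η * flux (fun n => μ.real {n}) r (η x) (η y)
        ∂(Measure.infinitePi fun _ : V => μ) := by
  set ν := Measure.infinitePi fun _ : V => μ
  have hp := measurePreserving_pair μ hxy
  have il : Integrable (fun η : V → ℕ => lossRate r (η x, η y)) ν :=
    hp.integrable_comp_of_integrable (integrable_lossRate hmoment hr hgrowth)
  have ig : Integrable (fun η : V → ℕ => gainRate (fun n => μ.real {n}) r (η x, η y)) ν :=
    hp.integrable_comp_of_integrable (integrable_gainRate hpos hmoment hr hgrowth)
  have i1 : Integrable (fun η => ∑ k ∈ Finset.Icc 1 (η x), r k (η y) * f (jump x y k η)) ν := by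
    refine (il.const_mul B).mono' (measurable_sum_Icc (fun k => ?_)
      (measurable_pi_apply x)).aestronglyMeasurable
      (ae_of_all _ fun η => abs_sum_rate_mul_le hr (fun k => hf _) (η x, η y))
    exact (Measurable.of_discrete.comp (measurable_pi_apply y)).mul
      (hfm.comp (measurable_jump x y k))
  have i2 : Integrable (fun η => f η * lossRate r (η x, η y)) ν :=
    il.bdd_mul (c := B) hfm.aestronglyMeasurable (ae_of_all _ hf)
  have i3 : Integrable (fun η => f η * gainRate (fun n => μ.real {n}) r (η x, η y)) ν :=
    ig.bdd_mul (c := B) hfm.aestronglyMeasurable (ae_of_all _ hf)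
  have e1 : ∀ η : V → ℕ, ∑ k ∈ Finset.Icc 1 (η x), r k (η y) * (f (jump x y k η) - f η) =
      (∑ k ∈ Finset.Icc 1 (η x), r k (η y) * f (jump x y k η)) - f η * lossRate r (η x, η y) := by
    intro η
    simp_rw [mul_sub, Finset.sum_sub_distrib, lossRate, Finset.mul_sum, mul_comm (f η)]
  have e2 : ∀ η : V → ℕ, f η * flux (fun n => μ.real {n}) r (η x) (η y) =
      f η * gainRate (fun n => μ.real {n}) r (η x, η y) - f η * lossRate r (η x, η y) := by
    intro η
    rw [← mul_sub]
    rfl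
  simp_rw [e1, e2]
  -- Resample the two coordinates of the bond; with the others fixed, the claim is
  -- `integral_pair_shift`.
  rw [integral_sub i1 i2, integral_sub i3 i2, integral_update_update i1 x y,
    integral_update_update i3 x y]
  congr 2
  funext η
  have := integral_pair_shift (r := r) hpos hmoment hr hgrowth
    (f := fun q => f (Function.update (Function.update η x q.1) y q.2)) (fun q => hf _)
  have h1 : ∀ q : ℕ × ℕ, Function.update (Function.update η x q.1) y q.2 x = q.1 := fun q => by
    rw [Function.update_of_ne hxy, Function.update_self]
  simp_rw [h1, Function.update_self]
  rw [← this]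
  refine integral_congr_ae (ae_of_all _ fun q => Finset.sum_congr rfl fun k hk => ?_)
  simp only
  rw [jump_update_update hxy η (Finset.mem_Icc.1 hk).2]

end ProductMeasure

/-! ### The state space under the product measure and means of the generator. -/

section StateSpaceMeasure

theorem measurable_tsum_of_summable {Ω ι : Type*} [MeasurableSpace Ω] [Countable ι]
    {F : ι → Ω → ℝ} (hF : ∀ i, Measurable (F i)) (hs : ∀ ω, Summable fun i => F i ω) :
    Measurable fun ω => ∑' i, F i ω := by
  refine measurable_of_tendsto_metrizable' (atTop : Filter (Finset ι))
    (fun s => Finset.measurable_sum s fun i _ => hF i) ?_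
  rw [tendsto_pi_nhds]
  exact fun ω => (hs ω).hasSum

variable {V : Type*} {p : V → V → ℝ} {a : V → ℝ} {M : ℝ}
  {g : ℕ → ℕ → ℕ → ℝ} {C : ℝ} {μ : Measure ℕ} [IsProbabilityMeasure μ]

theorem mem_stateSpace_iff (ha : ∀ x, 0 ≤ a x) (η : V → ℕ) :
    η ∈ stateSpace a ↔ ∑' x, ENNReal.ofReal ((η x : ℝ) * a x) ≠ ⊤ := by
  have h0 : ∀ x, 0 ≤ (η x : ℝ) * a x := fun x => mul_nonneg (Nat.cast_nonneg _) (ha x)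
  refine ⟨fun h => Summable.tsum_ofReal_ne_top h, fun h => ?_⟩
  exact (ENNReal.summable_toReal h).congr fun x => ENNReal.toReal_ofReal (h0 x)

theorem measurable_occupation (x : V) (c : ℝ) :
    Measurable fun η : V → ℕ => ENNReal.ofReal ((η x : ℝ) * c) :=
  Measurable.of_discrete.comp (measurable_pi_apply x)
    (g := fun n : ℕ => ENNReal.ofReal ((n : ℝ) * c))

theorem measurableSet_stateSpace [Countable V] (ha : ∀ x, 0 ≤ a x) :
    MeasurableSet (stateSpace a) := by
  have h1 : stateSpace a = {η | ∑' x, ENNReal.ofReal ((η x : ℝ) * a x) ≠ ⊤} :=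
    Set.ext fun η => mem_stateSpace_iff ha η
  rw [h1]
  exact (Measurable.tsum fun x => measurable_occupation x (a x))
    (measurableSet_singleton ⊤).compl

theorem integrable_occupation (hmoment : Summable fun n : ℕ => (n : ℝ) * μ.real {n}) (x : V) :
    Integrable (fun η : V → ℕ => (η x : ℝ)) (Measure.infinitePi fun _ : V => μ) :=
  (measurePreserving_eval_infinitePi (fun _ : V => μ) x).integrable_comp_of_integrable
    (integrable_cast hmoment)

theorem integral_occupation (x : V) :
    ∫ η, (η x : ℝ) ∂(Measure.infinitePi fun _ : V => μ) = ∫ n : ℕ, (n : ℝ) ∂μ := by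
  have h1 := measurePreserving_eval_infinitePi (fun _ : V => μ) x
  conv_rhs => rw [← h1.map_eq]
  rw [integral_map h1.measurable.aemeasurable
    (Measurable.of_discrete : Measurable fun n : ℕ => (n : ℝ)).aestronglyMeasurable]

theorem lintegral_occupation_ne_top [Countable V] (h : AdmissibleKernel p a M)
    (hmoment : Summable fun n : ℕ => (n : ℝ) * μ.real {n}) :
    ∫⁻ η, ∑' x, ENNReal.ofReal ((η x : ℝ) * a x) ∂(Measure.infinitePi fun _ : V => μ) ≠ ⊤ := by
  rw [lintegral_tsum fun x => (measurable_occupation x (a x)).aemeasurable]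
  have h1 : ∀ x, ∫⁻ η, ENNReal.ofReal ((η x : ℝ) * a x) ∂(Measure.infinitePi fun _ : V => μ) =
      ENNReal.ofReal ((∫ n : ℕ, (n : ℝ) ∂μ) * a x) := by
    intro x
    rw [← ofReal_integral_eq_lintegral_ofReal ((integrable_occupation hmoment x).mul_const _)
      (ae_of_all _ fun η => mul_nonneg (Nat.cast_nonneg _) (h.pos x).le), integral_mul_const,
      integral_occupation]
  simp_rw [h1]
  exact (h.summable.mul_left _).tsum_ofReal_ne_top

theorem ae_mem_stateSpace [Countable V] (h : AdmissibleKernel p a M)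
    (hmoment : Summable fun n : ℕ => (n : ℝ) * μ.real {n}) :
    ∀ᵐ η ∂(Measure.infinitePi fun _ : V => μ), η ∈ stateSpace a := by
  have h1 := ae_lt_top (Measurable.tsum fun x => measurable_occupation x (a x))
    (lintegral_occupation_ne_top h hmoment)
  filter_upwards [h1] with η hη
  exact (mem_stateSpace_iff (fun x => (h.pos x).le) η).2 hη.ne

variable (μ a) in
/-- The product measure restricted to the state space. -/
noncomputable def stateMeasure : Measure (stateSpace a) :=
  (Measure.infinitePi fun _ : V => μ).comap Subtype.val

theorem measurePreserving_val [Countable V] (h : AdmissibleKernel p a M)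
    (hmoment : Summable fun n : ℕ => (n : ℝ) * μ.real {n}) :
    MeasurePreserving (Subtype.val : stateSpace a → V → ℕ) (stateMeasure a μ)
      (Measure.infinitePi fun _ : V => μ) := by
  refine ⟨measurable_subtype_coe, ?_⟩
  rw [stateMeasure, map_comap_subtype_coe (measurableSet_stateSpace fun x => (h.pos x).le)]
  exact Measure.restrict_eq_self_of_ae_mem (ae_mem_stateSpace h hmoment)

theorem isProbabilityMeasure_stateMeasure [Countable V] (h : AdmissibleKernel p a M)
    (hmoment : Summable fun n : ℕ => (n : ℝ) * μ.real {n}) :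
    IsProbabilityMeasure (stateMeasure a μ) := by
  have := measurePreserving_val h hmoment
  exact ⟨by rw [← Set.preimage_univ (f := Subtype.val), this.measure_preimage
    MeasurableSet.univ.nullMeasurableSet, measure_univ]⟩

theorem integral_val [Countable V] (h : AdmissibleKernel p a M)
    (hmoment : Summable fun n : ℕ => (n : ℝ) * μ.real {n}) (F : (V → ℕ) → ℝ) :
    ∫ η : stateSpace a, F η.1 ∂(stateMeasure a μ) =
      ∫ η, F η ∂(Measure.infinitePi fun _ : V => μ) :=
  (measurePreserving_val h hmoment).integral_comp
    (MeasurableEmbedding.subtype_coe (measurableSet_stateSpace fun x => (h.pos x).le)) F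

theorem integrable_val [Countable V] (h : AdmissibleKernel p a M)
    (hmoment : Summable fun n : ℕ => (n : ℝ) * μ.real {n}) {F : (V → ℕ) → ℝ}
    (hF : Integrable F (Measure.infinitePi fun _ : V => μ)) :
    Integrable (fun η : stateSpace a => F η.1) (stateMeasure a μ) :=
  (measurePreserving_val h hmoment).integrable_comp_of_integrable hF

theorem integrable_mass [Countable V] (h : AdmissibleKernel p a M)
    (hmoment : Summable fun n : ℕ => (n : ℝ) * μ.real {n}) :
    Integrable (fun η : stateSpace a => ∑' x, (η.1 x : ℝ) * a x) (stateMeasure a μ) := by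
  have h1 := integrable_toReal_of_lintegral_ne_top
    (Measurable.tsum fun x => measurable_occupation x (a x)).aemeasurable
    (lintegral_occupation_ne_top (μ := μ) h hmoment)
  refine (integrable_val h hmoment h1).congr (ae_of_all _ fun η => ?_)
  simp only
  rw [ENNReal.tsum_toReal_eq fun x => ENNReal.ofReal_ne_top]
  exact tsum_congr fun x => ENNReal.toReal_ofReal (mul_nonneg (Nat.cast_nonneg _) (h.pos x).le)

theorem measurable_coord (x : V) : Measurable fun η : stateSpace a => η.1 x :=
  (measurable_pi_apply x).comp measurable_subtype_coe

theorem measurable_bondBound (xy : V × V) :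
    Measurable fun η : stateSpace a => bondBound p a η xy := by
  have h1 : Measurable fun q : ℕ × ℕ => p xy.1 xy.2 * ((q.1 : ℝ) + q.2) * (a xy.1 + a xy.2) :=
    Measurable.of_discrete
  exact h1.comp ((measurable_coord xy.1).prodMk (measurable_coord xy.2))

theorem integrable_tsum_bondBound [Countable V] (h : AdmissibleKernel p a M)
    (hmoment : Summable fun n : ℕ => (n : ℝ) * μ.real {n}) :
    Integrable (fun η : stateSpace a => ∑' xy, bondBound p a η xy) (stateMeasure a μ) := by
  refine ((integrable_mass h hmoment).const_mul (2 * M + 2)).mono'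
    (measurable_tsum_of_summable measurable_bondBound
      (summable_state_pair h)).aestronglyMeasurable (ae_of_all _ fun η => ?_)
  rw [Real.norm_of_nonneg (tsum_nonneg (bondBound_nonneg h η))]
  exact (h.summable_pair (u := fun x => (η.1 x : ℝ)) (fun _ => Nat.cast_nonneg _) η.2).2

theorem integrable_bondBound [Countable V] (h : AdmissibleKernel p a M)
    (hmoment : Summable fun n : ℕ => (n : ℝ) * μ.real {n}) (xy : V × V) :
    Integrable (fun η : stateSpace a => bondBound p a η xy) (stateMeasure a μ) :=
  integrable_val (F := fun η => p xy.1 xy.2 * ((η xy.1 : ℝ) + η xy.2) * (a xy.1 + a xy.2))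
    h hmoment ((((integrable_occupation hmoment xy.1).add
      (integrable_occupation hmoment xy.2)).const_mul _).mul_const _)

theorem integral_bondBound [Countable V] (h : AdmissibleKernel p a M)
    (hmoment : Summable fun n : ℕ => (n : ℝ) * μ.real {n}) (xy : V × V) :
    ∫ η : stateSpace a, bondBound p a η xy ∂(stateMeasure a μ) =
      (∫ n : ℕ, (n : ℝ) ∂μ) * (p xy.1 xy.2 * (1 + 1) * (a xy.1 + a xy.2)) := by
  rw [show (∫ η : stateSpace a, bondBound p a η xy ∂(stateMeasure a μ)) = _ from
    integral_val h hmoment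
      (fun η => p xy.1 xy.2 * ((η xy.1 : ℝ) + η xy.2) * (a xy.1 + a xy.2)),
    integral_mul_const, integral_const_mul, integral_add (integrable_occupation hmoment xy.1)
      (integrable_occupation hmoment xy.2), integral_occupation, integral_occupation]
  ring

theorem summable_integral_bondBound [Countable V] (h : AdmissibleKernel p a M)
    (hmoment : Summable fun n : ℕ => (n : ℝ) * μ.real {n}) :
    Summable fun xy : V × V => ∫ η : stateSpace a, bondBound p a η xy ∂(stateMeasure a μ) := by
  simp_rw [integral_bondBound h hmoment]
  exact ((h.summable_pair (u := fun _ => 1) (fun _ => zero_le_one)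
    (by simpa using h.summable)).1).mul_left _

variable [DecidableEq V]

/-- The configuration that agrees with `η` on `Λ` and is empty elsewhere. -/
def cutoff (a : V → ℝ) (Λ : Finset V) (η : V → ℕ) : stateSpace a :=
  ⟨fun x => if x ∈ Λ then η x else 0,
    summable_of_ne_finset_zero (s := Λ) fun x hx => by simp [hx]⟩

theorem configDist_cutoff_le (ha : ∀ x, 0 ≤ a x) (Λ : Finset V) (η ζ : stateSpace a) :
    configDist a (cutoff a Λ η.1).1 (cutoff a Λ ζ.1).1 ≤ configDist a η.1 ζ.1 := by
  refine (summable_abs_sub ha _ _).tsum_le_tsum (fun x => ?_) (summable_abs_sub ha η ζ)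
  refine mul_le_mul_of_nonneg_right ?_ (ha x)
  simp only [cutoff]
  split_ifs
  · exact le_rfl
  · simp

theorem tendsto_configDist_cutoff (ha : ∀ x, 0 ≤ a x) (η : stateSpace a) :
    Tendsto (fun Λ => configDist a (cutoff a Λ η.1).1 η.1) atTop (𝓝 0) := by
  have := tendsto_tsum_of_dominated_convergence (𝓕 := atTop)
    (f := fun (Λ : Finset V) x => |((cutoff a Λ η.1).1 x : ℝ) - η.1 x| * a x)
    (g := fun _ => 0) (bound := fun x => (η.1 x : ℝ) * a x) η.2 (fun x => ?_)
    (Eventually.of_forall fun Λ x => ?_)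
  · rw [tsum_zero] at this
    exact this
  · refine tendsto_const_nhds.congr' ?_
    filter_upwards [eventually_ge_atTop {x}] with Λ hΛ
    have hx : x ∈ Λ := hΛ (by simp)
    simp [cutoff, hx]
  · rw [Real.norm_of_nonneg (mul_nonneg (abs_nonneg _) (ha x))]
    refine mul_le_mul_of_nonneg_right ?_ (ha x)
    simp only [cutoff]
    split_ifs <;> simp

theorem LipschitzBound.cutoff (ha : ∀ x, 0 ≤ a x) {K : ℝ} (hK : 0 ≤ K) {f : stateSpace a → ℝ}
    (hf : LipschitzBound a K f) (Λ : Finset V) :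
    LipschitzBound a K fun η => f (cutoff a Λ η.1) := fun η ζ =>
  (hf _ _).trans (mul_le_mul_of_nonneg_left (configDist_cutoff_le ha Λ η ζ) hK)

theorem tendsto_cutoff (ha : ∀ x, 0 ≤ a x) {K : ℝ} {f : stateSpace a → ℝ}
    (hf : LipschitzBound a K f) (η : stateSpace a) :
    Tendsto (fun Λ => f (cutoff a Λ η.1)) atTop (𝓝 (f η)) := by
  rw [tendsto_iff_dist_tendsto_zero]
  refine squeeze_zero (fun _ => dist_nonneg) (fun Λ => hf (cutoff a Λ η.1) η) ?_
  simpa using (tendsto_configDist_cutoff ha η).const_mul K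

/-- No regularity of `f` is needed: the composition factors through the countable discrete space `Λ
→ ℕ`. -/
theorem measurable_comp_cutoff (f : stateSpace a → ℝ) (Λ : Finset V) :
    Measurable fun η : V → ℕ => f (cutoff a Λ η) := by
  have h1 : (fun η : V → ℕ => f (cutoff a Λ η)) =
      (fun w : Λ → ℕ => f (cutoff a Λ fun x => if hx : x ∈ Λ then w ⟨x, hx⟩ else 0)) ∘
        fun η x => η x.1 := by
    funext η
    simp only [Function.comp]
    congr 1
    apply Subtype.ext
    funext x
    simp only [cutoff]
    split_ifs <;> rfl
  rw [h1]
  exact Measurable.of_discrete.comp (measurable_pi_lambda _ fun x => measurable_pi_apply x.1)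

/-- A Lipschitz function is the pointwise limit of its cutoffs, since a configuration of finite
weighted mass is approximated by its finite restrictions. -/
theorem IsLip.measurable [Countable V] (ha : ∀ x, 0 ≤ a x) {f : stateSpace a → ℝ}
    (hf : IsLip a f) : Measurable f := by
  obtain ⟨K, hK⟩ := hf
  refine measurable_of_tendsto_metrizable' (atTop : Filter (Finset V))
    (f := fun Λ (η : stateSpace a) => f (cutoff a Λ η.1))
    (fun Λ => (measurable_comp_cutoff f Λ).comp measurable_subtype_coe) ?_
  rw [tendsto_pi_nhds]
  exact fun η => tendsto_cutoff ha hK η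

theorem IsLip.integrable [Countable V] (h : AdmissibleKernel p a M)
    (hmoment : Summable fun n : ℕ => (n : ℝ) * μ.real {n}) {f : stateSpace a → ℝ}
    (hf : IsLip a f) : Integrable f (stateMeasure a μ) := by
  have ha := fun x => (h.pos x).le
  have hm := hf.measurable ha
  obtain ⟨K, hK⟩ := hf
  have := isProbabilityMeasure_stateMeasure h hmoment
  refine ((integrable_const |f (cutoff a ∅ 0)|).add
    ((integrable_mass h hmoment).const_mul K)).mono' hm.aestronglyMeasurable
    (ae_of_all _ fun η => ?_)
  have h1 := hK η (cutoff a ∅ 0)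
  have h2 : configDist a η.1 (cutoff a ∅ 0).1 = ∑' x, (η.1 x : ℝ) * a x := by
    unfold configDist
    refine tsum_congr fun x => ?_
    simp [cutoff]
  rw [h2] at h1
  rw [Real.norm_eq_abs, Pi.add_apply]
  have h3 := abs_add_le (f η - f (cutoff a ∅ 0)) (f (cutoff a ∅ 0))
  rw [sub_add_cancel] at h3
  linarith

theorem measurable_bondGenerator {f : stateSpace a → ℝ} (hf : Measurable f) (x y : V) :
    Measurable fun η => bondGenerator p g x y f η := by
  refine measurable_sum_Icc (F := fun k (η : stateSpace a) =>
    p x y * g k (η.1 x) (η.1 y) * (f (jumpState x y k η) - f η)) (fun k => ?_)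
    (measurable_coord x)
  have h1 : Measurable fun q : ℕ × ℕ => p x y * g k q.1 q.2 := Measurable.of_discrete
  have h2 : Measurable fun η : stateSpace a => jumpState x y k η :=
    ((measurable_jump x y k).comp measurable_subtype_coe).subtype_mk
  exact (h1.comp ((measurable_coord x).prodMk (measurable_coord y))).mul ((hf.comp h2).sub hf)

theorem measurable_generator [Countable V] (h : AdmissibleKernel p a M) (hg : RateBounds g C)
    {f : stateSpace a → ℝ} (hf : IsLip a f) : Measurable (generator p g f) :=
  measurable_tsum_of_summable
    (fun xy => measurable_bondGenerator (hf.measurable fun x => (h.pos x).le) xy.1 xy.2)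
    (summable_bondGenerator h hg hf)

theorem abs_generator_le (h : AdmissibleKernel p a M) (hg : RateBounds g C)
    {f : stateSpace a → ℝ} {K : ℝ} (hK : 0 ≤ K) (hf : LipschitzBound a K f) (η : stateSpace a) :
    |generator p g f η| ≤ K * C * ∑' xy, bondBound p a η xy := by
  rw [← tsum_mul_left]
  exact tsum_of_norm_bounded (f := fun xy : V × V => bondGenerator p g xy.1 xy.2 f η) ((summable_state_pair h η).mul_left (K * C)).hasSum
    fun xy => abs_bondGenerator_le h hg hK hf xy.1 xy.2 η

/-- Fubini: the mean of `bondBound` is summable over bonds because the occupation numbers have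
finite mean and `a` is summable. -/
theorem hasSum_integral_generator [Countable V] (h : AdmissibleKernel p a M) (hg : RateBounds g C)
    (hmoment : Summable fun n : ℕ => (n : ℝ) * μ.real {n}) {f : stateSpace a → ℝ}
    (hf : IsLip a f) :
    HasSum (fun xy : V × V => ∫ η, bondGenerator p g xy.1 xy.2 f η ∂(stateMeasure a μ))
      (∫ η, generator p g f η ∂(stateMeasure a μ)) := by
  have hm := hf.measurable fun x => (h.pos x).le
  obtain ⟨K, hK, hf⟩ := hf.exists_nonneg fun x => (h.pos x).le
  have h1 : ∀ xy : V × V, Integrable (fun η => bondGenerator p g xy.1 xy.2 f η)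
      (stateMeasure a μ) := fun xy =>
    ((integrable_bondBound h hmoment xy).const_mul (K * C)).mono'
      (measurable_bondGenerator hm xy.1 xy.2).aestronglyMeasurable
      (ae_of_all _ fun η => abs_bondGenerator_le h hg hK hf xy.1 xy.2 η)
  refine hasSum_integral_of_summable_integral_norm h1 ?_
  refine Summable.of_nonneg_of_le (fun xy => integral_nonneg fun η => norm_nonneg _) (fun xy => ?_)
    ((summable_integral_bondBound h hmoment).mul_left (K * C))
  rw [← integral_const_mul]
  exact integral_mono (h1 xy).norm ((integrable_bondBound h hmoment xy).const_mul (K * C))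
    fun η => abs_bondGenerator_le h hg hK hf xy.1 xy.2 η

/-- Cylinder functions suffice to test whether the generator has mean zero. -/
theorem tendsto_integral_generator_cutoff [Countable V] (h : AdmissibleKernel p a M)
    (hg : RateBounds g C) (hmoment : Summable fun n : ℕ => (n : ℝ) * μ.real {n})
    {f : stateSpace a → ℝ} (hf : IsLip a f) :
    Tendsto (fun Λ => ∫ η, generator p g (fun ξ : stateSpace a => f (cutoff a Λ ξ.1)) η
      ∂(stateMeasure a μ)) atTop (𝓝 (∫ η, generator p g f η ∂(stateMeasure a μ))) := by
  have ha := fun x => (h.pos x).le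
  obtain ⟨K, hK, hf⟩ := hf.exists_nonneg ha
  refine tendsto_integral_filter_of_dominated_convergence
    (fun η => K * C * ∑' xy, bondBound p a η xy)
    (Eventually.of_forall fun Λ =>
      (measurable_generator h hg ⟨K, hf.cutoff ha hK Λ⟩).aestronglyMeasurable)
    (Eventually.of_forall fun Λ => ae_of_all _ fun η =>
      abs_generator_le h hg hK (hf.cutoff ha hK Λ) η)
    ((integrable_tsum_bondBound h hmoment).const_mul (K * C)) (ae_of_all _ fun η => ?_)
  refine tendsto_tsum_of_dominated_convergence (bound := fun xy => K * C * bondBound p a η xy)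
    ((summable_state_pair h η).mul_left (K * C)) (fun xy => ?_)
    (Eventually.of_forall fun Λ xy => abs_bondGenerator_le h hg hK (hf.cutoff ha hK Λ) _ _ η)
  exact tendsto_finsetSum _ fun k _ =>
    ((tendsto_cutoff ha hf _).sub (tendsto_cutoff ha hf η)).const_mul _

/-! ### Means along a Markov semigroup. -/

variable {S : ℝ → (stateSpace a → ℝ) → stateSpace a → ℝ}

/-- The mean value inequality with the Lipschitz bound on `S t f`; its right-hand side is the
integrable majorant of the difference quotients. -/
theorem IsMarkovSemigroup.abs_sub_le (hS : IsMarkovSemigroup a p g S)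
    (h : AdmissibleKernel p a M) (hg : RateBounds g C)
    {f : stateSpace a → ℝ} (hf : IsLip a f) {K T : ℝ} (hK : 0 ≤ K)
    (hKf : ∀ t, 0 ≤ t → t ≤ T → LipschitzBound a K (S t f)) {s t : ℝ} (hs : s ∈ Set.Icc 0 T)
    (ht : t ∈ Set.Icc 0 T) (η : stateSpace a) :
    |S t f η - S s f η| ≤ K * C * (∑' xy, bondBound p a η xy) * |t - s| :=
  (convex_Icc (0 : ℝ) T).norm_image_sub_le_of_norm_hasDerivWithin_le (𝕜 := ℝ)
    (f := fun s => S s f η) (C := K * C * ∑' xy, bondBound p a η xy)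
    (fun u hu => (hS.backward f hf η u hu.1).mono Set.Icc_subset_Ici_self)
    (fun u hu => abs_generator_le h hg hK (hKf u hu.1 hu.2) η) hs ht

theorem IsMarkovSemigroup.isLip (hS : IsMarkovSemigroup a p g S) {f : stateSpace a → ℝ}
    (hf : IsLip a f) {t : ℝ} (ht : 0 ≤ t) : IsLip a (S t f) := by
  obtain ⟨K, hK⟩ := hS.lip f hf t
  exact ⟨K, hK t ht le_rfl⟩

theorem IsMarkovSemigroup.hasDerivWithinAt_integral [Countable V] (hS : IsMarkovSemigroup a p g S)
    (h : AdmissibleKernel p a M) (hg : RateBounds g C)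
    (hmoment : Summable fun n : ℕ => (n : ℝ) * μ.real {n}) {f : stateSpace a → ℝ}
    (hf : IsLip a f) {t : ℝ} (ht : 0 ≤ t) :
    HasDerivWithinAt (fun s => ∫ η, S s f η ∂(stateMeasure a μ))
      (∫ η, generator p g (S t f) η ∂(stateMeasure a μ)) (Set.Ici 0) t := by
  have ha := fun x => (h.pos x).le
  -- One extra unit of time makes the constant uniform in a neighbourhood of `t`.
  obtain ⟨K, hKf⟩ := hS.lip f hf (t + 1)
  have hKf : ∀ s, 0 ≤ s → s ≤ t + 1 → LipschitzBound a |K| (S s f) := fun s h0 h1 =>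
    (hKf s h0 h1).mono ha (le_abs_self K)
  have hint : ∀ s, 0 ≤ s → Integrable (S s f) (stateMeasure a μ) := fun s hs =>
    (hS.isLip hf hs).integrable h hmoment
  rw [hasDerivWithinAt_iff_tendsto_slope]
  have hmem : ∀ᶠ s in 𝓝[Set.Ici 0 \ {t}] t, s ∈ Set.Icc 0 (t + 1) ∧ s ≠ t := by
    have h1 : ∀ᶠ s in 𝓝[Set.Ici 0 \ {t}] t, s < t + 1 :=
      (eventually_lt_nhds (lt_add_one t)).filter_mono nhdsWithin_le_nhds
    filter_upwards [h1, self_mem_nhdsWithin] with s hs hs'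
    exact ⟨⟨hs'.1, hs.le⟩, hs'.2⟩
  have h2 : Tendsto (fun s => ∫ η, slope (fun s => S s f η) t s ∂(stateMeasure a μ))
      (𝓝[Set.Ici 0 \ {t}] t) (𝓝 (∫ η, generator p g (S t f) η ∂(stateMeasure a μ))) := by
    refine tendsto_integral_filter_of_dominated_convergence
      (fun η => |K| * C * ∑' xy, bondBound p a η xy) ?_ ?_
      ((integrable_tsum_bondBound h hmoment).const_mul _) ?_
    · filter_upwards [hmem] with s hs
      simp only [slope_def_module]
      exact (((hint s hs.1.1).sub (hint t ht)).smul (s - t)⁻¹).aestronglyMeasurable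
    · filter_upwards [hmem] with s hs
      refine ae_of_all _ fun η => ?_
      have h3 := hS.abs_sub_le h hg hf (abs_nonneg K) hKf (s := t) (t := s)
        ⟨ht, by linarith⟩ hs.1 η
      rw [slope_def_module, norm_smul, norm_inv, Real.norm_eq_abs, Real.norm_eq_abs,
        inv_mul_le_iff₀ (abs_pos.2 (sub_ne_zero.2 hs.2)), mul_comm]
      exact h3
    · exact ae_of_all _ fun η =>
        hasDerivWithinAt_iff_tendsto_slope.1 (hS.backward f hf η t ht)
  refine h2.congr' ?_
  filter_upwards [hmem] with s hs
  simp only [slope_def_module]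
  rw [integral_smul, integral_sub (hint s hs.1.1) (hint t ht)]

/-- Apply positivity to `B + f` and `B - f`, using that constants are preserved. -/
theorem IsMarkovSemigroup.abs_apply_le (hS : IsMarkovSemigroup a p g S) {f : stateSpace a → ℝ}
    (hf : IsLip a f) {B : ℝ} (hB : ∀ η, |f η| ≤ B) {t : ℝ} (ht : 0 ≤ t) (η : stateSpace a) :
    |S t f η| ≤ B := by
  have h1 : IsLip a (fun _ : stateSpace a => (1 : ℝ)) := ⟨0, fun η ζ => by simp⟩
  have key : ∀ c : ℝ, (∀ ξ, 0 ≤ B * 1 + c * f ξ) → 0 ≤ B + c * S t f η := by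
    intro c hc
    have h2 := hS.linear _ f h1 hf B c t ht
    have h3 : IsLip a fun η => B * (1 : ℝ) + c * f η := by
      obtain ⟨K, hK⟩ := hf
      refine ⟨|c| * K, fun η ζ => ?_⟩
      rw [add_sub_add_left_eq_sub, ← mul_sub, abs_mul, mul_assoc]
      exact mul_le_mul_of_nonneg_left (hK η ζ) (abs_nonneg c)
    have h4 := hS.nonneg _ h3 hc t ht η
    rw [h2, hS.one t ht] at h4
    simpa using h4
  have k1 := key 1 fun ξ => by linarith [(abs_le.1 (hB ξ)).1]
  have k2 := key (-1) fun ξ => by linarith [(abs_le.1 (hB ξ)).2]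
  exact abs_le.2 ⟨by linarith, by linarith⟩

/-- A product measure is invariant if and only if the generator has mean zero. -/
theorem IsMarkovSemigroup.isInvariantMeasure_iff [Countable V] (hS : IsMarkovSemigroup a p g S)
    (h : AdmissibleKernel p a M) (hg : RateBounds g C)
    (hmoment : Summable fun n : ℕ => (n : ℝ) * μ.real {n}) :
    IsInvariantMeasure a S (Measure.infinitePi fun _ : V => μ) ↔
      ∀ f : stateSpace a → ℝ, IsLip a f → (∃ B : ℝ, ∀ η, |f η| ≤ B) →
        ∫ η, generator p g f η ∂(stateMeasure a μ) = 0 := by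
  constructor
  · intro hinv f hf hB
    have h1 := hS.hasDerivWithinAt_integral h hg hmoment hf le_rfl
    rw [hS.zero f hf] at h1
    have h2 : HasDerivWithinAt (fun s => ∫ η, S s f η ∂(stateMeasure a μ)) 0 (Set.Ici 0) 0 :=
      (hasDerivWithinAt_const (0 : ℝ) (Set.Ici 0) (∫ η, f η ∂(stateMeasure a μ))).congr
        (fun s hs => hinv.2 f hf hB s hs) (hinv.2 f hf hB 0 le_rfl)
    exact (uniqueDiffOn_Ici (0 : ℝ) 0 Set.self_mem_Ici).eq_deriv _ h1 h2
  · intro hL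
    refine ⟨ae_mem_stateSpace h hmoment, fun f hf hB t ht => ?_⟩
    obtain ⟨B, hB⟩ := hB
    -- Since `S u f` is bounded and Lipschitz, the hypothesis applies to it too and the mean has
    -- zero derivative.
    have h1 := (convex_Icc (0 : ℝ) t).norm_image_sub_le_of_norm_hasDerivWithin_le (𝕜 := ℝ)
      (f := fun s => ∫ η, S s f η ∂(stateMeasure a μ)) (C := 0)
      (fun u hu => (hS.hasDerivWithinAt_integral h hg hmoment hf hu.1).mono Set.Icc_subset_Ici_self)
      (fun u hu => by
        rw [hL _ (hS.isLip hf hu.1) ⟨B, hS.abs_apply_le hf hB hu.1⟩, norm_zero])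
      ⟨le_rfl, ht⟩ ⟨ht, le_rfl⟩
    rw [zero_mul, norm_le_zero_iff, sub_eq_zero, hS.zero f hf] at h1
    exact h1

end StateSpaceMeasure

/-! ### Centred splitting of the flux and the two directions of the equivalence. -/

section TestFunctions

variable {μ : Measure ℕ} [IsProbabilityMeasure μ] {r : ℕ → ℕ → ℝ} {C : ℝ}

/-- Splitting of a function of two independent variables into centred functions of one variable and
a remainder with vanishing marginals. -/
structure IsCenteredSplitting (μ : Measure ℕ) (Φ : ℕ → ℕ → ℝ) (φ₁ φ₂ : ℕ → ℝ)
    (Ψ : ℕ → ℕ → ℝ) : Prop where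
  eq : ∀ α β, Φ α β = φ₁ α + φ₂ β + Ψ α β
  integrable_left : Integrable φ₁ μ
  integrable_right : Integrable φ₂ μ
  integral_left : ∫ α, φ₁ α ∂μ = 0
  integral_right : ∫ β, φ₂ β ∂μ = 0
  integrable : Integrable (fun q : ℕ × ℕ => Ψ q.1 q.2) (μ.prod μ)
  marginal_left : ∀ β, ∫ α, Ψ α β ∂μ = 0
  marginal_right : ∀ α, ∫ β, Ψ α β ∂μ = 0

omit [IsProbabilityMeasure μ] in
-- Every point is an atom, so almost everywhere means everywhere.
theorem forall_of_ae (hpos : ∀ n, 0 < μ.real {n}) {P : ℕ → Prop} (h : ∀ᵐ n ∂μ, P n) (n : ℕ) :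
    P n := by
  by_contra hn
  have h1 : μ {n} = 0 := measure_mono_null (by simpa using hn) (ae_iff.1 h)
  have := hpos n
  rw [measureReal_def, h1, ENNReal.toReal_zero] at this
  exact lt_irrefl _ this

/-- The splitting given by the conditional expectations. -/
theorem exists_isCenteredSplitting (hpos : ∀ n, 0 < μ.real {n}) {Φ : ℕ → ℕ → ℝ}
    (hΦ : Integrable (fun q : ℕ × ℕ => Φ q.1 q.2) (μ.prod μ))
    (h0 : ∫ q : ℕ × ℕ, Φ q.1 q.2 ∂(μ.prod μ) = 0) :
    ∃ φ₁ φ₂ Ψ, IsCenteredSplitting μ Φ φ₁ φ₂ Ψ := by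
  have s1 : ∀ α, Integrable (fun β => Φ α β) μ := forall_of_ae hpos hΦ.prod_right_ae
  have s2 : ∀ β, Integrable (fun α => Φ α β) μ := forall_of_ae hpos hΦ.prod_left_ae
  have i1 : Integrable (fun α => ∫ β, Φ α β ∂μ) μ := hΦ.integral_prod_left
  have i2 : Integrable (fun β => ∫ α, Φ α β ∂μ) μ := hΦ.integral_prod_right
  have z1 : ∫ α, ∫ β, Φ α β ∂μ ∂μ = 0 := by rw [← h0, integral_prod _ hΦ]
  have z2 : ∫ β, ∫ α, Φ α β ∂μ ∂μ = 0 := by rw [← h0, integral_prod_symm _ hΦ]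
  refine ⟨fun α => ∫ β, Φ α β ∂μ, fun β => ∫ α, Φ α β ∂μ,
    fun α β => Φ α β - ((∫ β, Φ α β ∂μ) + ∫ α, Φ α β ∂μ), fun α β => by ring, i1, i2, z1, z2,
    hΦ.sub ((i1.comp_fst μ).add (i2.comp_snd μ)), fun β => ?_, fun α => ?_⟩
  · refine (integral_sub (s2 β) (i1.add (integrable_const _))).trans ?_
    rw [integral_add' i1 (integrable_const _), z1]
    simp
  · refine (integral_sub (s1 α) ((integrable_const _).add i2)).trans ?_
    rw [integral_add' (integrable_const _) i2, z2]
    simp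

theorem integral_flux (hpos : ∀ n, 0 < μ.real {n})
    (hmoment : Summable fun n : ℕ => (n : ℝ) * μ.real {n})
    (hr : ∀ k β, 1 ≤ k → 0 ≤ r k β)
    (hgrowth : ∀ α β : ℕ, ∑ k ∈ Finset.Icc 1 α, (k : ℝ) * r k β ≤ C * ((α : ℝ) + β)) :
    ∫ q : ℕ × ℕ, flux (fun n => μ.real {n}) r q.1 q.2 ∂(μ.prod μ) = 0 := by
  have h1 := integral_pair_shift (f := fun _ => 1) (B := 1) hpos hmoment hr hgrowth
    (fun q => by simp)
  simp only [mul_one, one_mul] at h1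
  refine (integral_sub (integrable_gainRate hpos hmoment hr hgrowth)
    (integrable_lossRate hmoment hr hgrowth)).trans ?_
  rw [← h1]
  exact sub_self _

variable {V : Type*} [DecidableEq V]

/-- Integrate the coordinate `x` first: `F` does not see it and `G` is centred in it. -/
theorem integral_mul_eq_zero_of_update {F G : (V → ℕ) → ℝ} {B : ℝ} {x : V}
    (hFm : Measurable F) (hB : ∀ η, |F η| ≤ B) (hF : ∀ η α, F (Function.update η x α) = F η)
    (hG : Integrable G (Measure.infinitePi fun _ : V => μ))
    (h0 : ∀ η, ∫ α, G (Function.update η x α) ∂μ = 0) :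
    ∫ η, F η * G η ∂(Measure.infinitePi fun _ : V => μ) = 0 := by
  rw [integral_update (hG.bdd_mul (c := B) hFm.aestronglyMeasurable (ae_of_all _ hB)) x]
  simp_rw [hF, integral_const_mul, h0, mul_zero, integral_zero]

/-- The kernel `p` without its diagonal. -/
def offDiag (p : V → V → ℝ) (x y : V) : ℝ := if x = y then 0 else p x y

theorem hasSum_offDiag_row {p : V → V → ℝ} (hp : ∀ x, HasSum (p x) 1) (x : V) :
    HasSum (offDiag p x) (1 - p x x) := by
  have h1 := (hp x).update x 0
  convert! h1 using 1
  · funext y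
    by_cases hy : y = x
    · subst hy; simp [offDiag]
    · simp [offDiag, Ne.symm hy, hy]
  · ring

theorem hasSum_mul_kernel {q : V → V → ℝ} {ρ c : V → ℝ} {Λ : Finset V}
    (hq : ∀ x, HasSum (q x) (ρ x)) (hc : ∀ x ∉ Λ, c x = 0) :
    HasSum (fun xy : V × V => q xy.1 xy.2 * c xy.1) (∑ x ∈ Λ, ρ x * c x) := by
  have h1 : ∀ z, HasSum (fun xy : V × V => if xy.1 = z then q z xy.2 * c z else 0) (ρ z * c z) := by
    intro z
    refine ((Prod.mk_right_injective z).hasSum_iff ?_).1 ?_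
    · rintro ⟨x, y⟩ hxy
      refine if_neg fun hx : x = z => hxy ⟨y, ?_⟩
      rw [hx]
    · simpa [Function.comp_def] using (hq z).mul_right (c z)
  convert! hasSum_sum (s := Λ) fun z _ => h1 z using 1
  funext xy
  rw [Finset.sum_ite_eq]
  split_ifs with h
  · rfl
  · rw [hc _ h, mul_zero]

variable {p : V → V → ℝ} {a : V → ℝ} {M : ℝ}

/-- Diagonal bonds drop out because a jump from `x` to `x` changes nothing; hence `offDiag`. -/
theorem hasSum_integral_generator_cylinder [Countable V] (h : AdmissibleKernel p a M)
    (hg : RateBounds (targetRate r) C) (hpos : ∀ n, 0 < μ.real {n})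
    (hmoment : Summable fun n : ℕ => (n : ℝ) * μ.real {n}) (hr : ∀ k β, 1 ≤ k → 0 ≤ r k β)
    (hgrowth : ∀ α β : ℕ, ∑ k ∈ Finset.Icc 1 α, (k : ℝ) * r k β ≤ C * ((α : ℝ) + β))
    {f : stateSpace a → ℝ} (hf : IsLip a f) {B : ℝ} (hB : ∀ η, |f η| ≤ B) (Λ : Finset V) :
    HasSum (fun xy : V × V => offDiag p xy.1 xy.2 *
        ∫ η, f (cutoff a Λ η) * flux (fun n => μ.real {n}) r (η xy.1) (η xy.2)
          ∂(Measure.infinitePi fun _ : V => μ))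
      (∫ η, generator p (targetRate r) (fun ξ : stateSpace a => f (cutoff a Λ ξ.1)) η
        ∂(stateMeasure a μ)) := by
  have ha := fun x => (h.pos x).le
  obtain ⟨K, hK, hf⟩ := hf.exists_nonneg ha
  have h1 := hasSum_integral_generator (μ := μ) h hg hmoment ⟨K, hf.cutoff ha hK Λ⟩
  convert! h1 using 1
  funext xy
  by_cases hxy : xy.1 = xy.2
  · rw [offDiag, if_pos hxy, zero_mul]
    refine (integral_eq_zero_of_ae (ae_of_all _ fun η => ?_)).symm
    refine Finset.sum_eq_zero fun k _ => ?_
    simp only [jumpState, hxy, jump_self, sub_self, mul_zero]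
  · have h2 : ∀ η : stateSpace a, bondGenerator p (targetRate r) xy.1 xy.2
        (fun ξ : stateSpace a => f (cutoff a Λ ξ.1)) η =
        p xy.1 xy.2 * ∑ k ∈ Finset.Icc 1 (η.1 xy.1), r k (η.1 xy.2) *
          (f (cutoff a Λ (jump xy.1 xy.2 k η.1)) - f (cutoff a Λ η.1)) := by
      intro η
      rw [bondGenerator, Finset.mul_sum]
      refine Finset.sum_congr rfl fun k hk => ?_
      rw [targetRate, if_pos (Finset.mem_Icc.1 hk), mul_assoc]
      rfl
    simp_rw [h2]
    rw [offDiag, if_neg hxy, integral_const_mul]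
    congr 1
    rw [integral_val h hmoment fun η => ∑ k ∈ Finset.Icc 1 (η xy.1), r k (η xy.2) *
          (f (cutoff a Λ (jump xy.1 xy.2 k η)) - f (cutoff a Λ η))]
    exact (integral_jump_sub hpos hmoment hr hgrowth hxy (measurable_comp_cutoff f Λ)
      fun η => hB _).symm

theorem cutoff_update {Λ : Finset V} {x : V} (hx : x ∉ Λ) (η : V → ℕ) (α : ℕ) :
    cutoff a Λ (Function.update η x α) = cutoff a Λ η := by
  apply Subtype.ext
  funext z
  simp only [cutoff]
  split_ifs with hz
  · rw [Function.update_of_ne (ne_of_mem_of_not_mem hz hx)]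
  · rfl

/-- The mean of the generator applied to a cylinder function. -/
theorem integral_generator_cylinder [Countable V] (h : AdmissibleKernel p a M)
    (hg : RateBounds (targetRate r) C) (hpos : ∀ n, 0 < μ.real {n})
    (hmoment : Summable fun n : ℕ => (n : ℝ) * μ.real {n}) (hr : ∀ k β, 1 ≤ k → 0 ≤ r k β)
    (hgrowth : ∀ α β : ℕ, ∑ k ∈ Finset.Icc 1 α, (k : ℝ) * r k β ≤ C * ((α : ℝ) + β))
    {φ₁ φ₂ : ℕ → ℝ} {Ψ : ℕ → ℕ → ℝ}
    (hs : IsCenteredSplitting μ (flux (fun n => μ.real {n}) r) φ₁ φ₂ Ψ)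
    {f : stateSpace a → ℝ} (hf : IsLip a f) {B : ℝ} (hB : ∀ η, |f η| ≤ B) (Λ : Finset V) :
    ∫ η, generator p (targetRate r) (fun ξ : stateSpace a => f (cutoff a Λ ξ.1)) η
        ∂(stateMeasure a μ) =
      ∑ x ∈ Λ, (1 - p x x) * ∫ η, f (cutoff a Λ η) * (φ₁ (η x) + φ₂ (η x))
          ∂(Measure.infinitePi fun _ : V => μ) +
        ∑ xy ∈ Λ ×ˢ Λ, offDiag p xy.1 xy.2 * ∫ η, f (cutoff a Λ η) * Ψ (η xy.1) (η xy.2)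
          ∂(Measure.infinitePi fun _ : V => μ) := by
  set ν := Measure.infinitePi fun _ : V => μ with hν
  set F : (V → ℕ) → ℝ := fun η => f (cutoff a Λ η) with hF
  have hFm : Measurable F := measurable_comp_cutoff f Λ
  have hFB : ∀ η, |F η| ≤ B := fun η => hB _
  have hFu : ∀ x ∉ Λ, ∀ η α, F (Function.update η x α) = F η := fun x hx η α => by
    simp only [hF, cutoff_update hx]
  have eval_int : ∀ {φ : ℕ → ℝ}, Integrable φ μ → ∀ x, Integrable (fun η => φ (η x)) ν :=
    fun hφ x => (measurePreserving_eval_infinitePi (fun _ : V => μ) x).integrable_comp_of_integrable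
      hφ
  have pair_int : ∀ x y, x ≠ y → Integrable (fun η => Ψ (η x) (η y)) ν := fun x y hxy =>
    (measurePreserving_pair μ hxy).integrable_comp_of_integrable hs.integrable
  have mul_int : ∀ {G : (V → ℕ) → ℝ}, Integrable G ν → Integrable (fun η => F η * G η) ν :=
    fun hG => hG.bdd_mul (c := B) hFm.aestronglyMeasurable (ae_of_all _ hFB)
  -- Outside `Λ` a centred function of one site is independent of `F`.
  have single : ∀ {φ : ℕ → ℝ}, Integrable φ μ → ∫ α, φ α ∂μ = 0 → ∀ x ∉ Λ,
      ∫ η, F η * φ (η x) ∂ν = 0 := fun hφ h0 x hx =>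
    integral_mul_eq_zero_of_update hFm hFB (hFu x hx) (eval_int hφ x) fun η => by
      simpa using h0
  have pair : ∀ xy : V × V, xy ∉ Λ ×ˢ Λ →
      offDiag p xy.1 xy.2 * ∫ η, F η * Ψ (η xy.1) (η xy.2) ∂ν = 0 := by
    rintro ⟨x, y⟩ hxy
    by_cases he : x = y
    · simp [offDiag, he]
    refine mul_eq_zero_of_right _ ?_
    simp only
    by_cases hx : x ∈ Λ
    · have hy : y ∉ Λ := fun hy => hxy (Finset.mk_mem_product hx hy)
      refine integral_mul_eq_zero_of_update hFm hFB (hFu y hy) (pair_int x y he) fun η => ?_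
      simp_rw [Function.update_self, Function.update_of_ne he]
      exact hs.marginal_right _
    · refine integral_mul_eq_zero_of_update hFm hFB (hFu x hx) (pair_int x y he) fun η => ?_
      simp_rw [Function.update_self, Function.update_of_ne (Ne.symm he)]
      exact hs.marginal_left _
  -- Summing over all targets gives the source term the factor `1 - p x x`; the column sums give the
  -- target term the same factor, so `φ₁` and `φ₂` combine.
  have s1 := hasSum_mul_kernel (Λ := Λ) (hasSum_offDiag_row h.row)
    (single hs.integrable_left hs.integral_left)
  have s2 := (Equiv.prodComm V V).hasSum_iff.2 (hasSum_mul_kernel (Λ := Λ)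
    (hasSum_offDiag_row h.col) (single hs.integrable_right hs.integral_right))
  have s3 := hasSum_sum_of_ne_finset_zero (L := SummationFilter.unconditional _) pair
  have s4 := hasSum_integral_generator_cylinder (μ := μ) h hg hpos hmoment hr hgrowth hf hB Λ
  have s5 : ∀ x, ∫ η, F η * (φ₁ (η x) + φ₂ (η x)) ∂ν =
      ∫ η, F η * φ₁ (η x) ∂ν + ∫ η, F η * φ₂ (η x) ∂ν := fun x => by
    simp_rw [mul_add]
    exact integral_add (mul_int (eval_int hs.integrable_left x))
      (mul_int (eval_int hs.integrable_right x))
  refine s4.unique ?_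
  convert! (s1.add s2).add s3 using 1
  · funext xy
    obtain ⟨x, y⟩ := xy
    by_cases he : x = y
    · simp [offDiag, he]
    have s6 : ∫ η, F η * flux (fun n => μ.real {n}) r (η x) (η y) ∂ν =
        ∫ η, F η * φ₁ (η x) ∂ν + ∫ η, F η * φ₂ (η y) ∂ν + ∫ η, F η * Ψ (η x) (η y) ∂ν := by
      have t1 := mul_int (eval_int hs.integrable_left x)
      have t2 := mul_int (eval_int hs.integrable_right y)
      have t3 := integral_add (t1.add t2) (mul_int (pair_int x y he))
      rw [integral_add' t1 t2] at t3
      rw [← t3]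
      simp_rw [hs.eq, Pi.add_apply, mul_add]
    have s7 : offDiag (fun x y => p y x) y x = offDiag p x y := by simp [offDiag, he, Ne.symm he]
    simp only [Function.comp, Equiv.prodComm_apply, Prod.fst_swap, Prod.snd_swap]
    rw [s7, ← mul_add, ← mul_add, ← s6]
  · rw [← Finset.sum_add_distrib]
    congr 1
    refine Finset.sum_congr rfl fun x _ => ?_
    rw [← mul_add, ← s5]

/-- The mean of the generator vanishes if the flux is a discrete gradient. -/
theorem integral_generator_eq_zero [Countable V] (h : AdmissibleKernel p a M)
    (hg : RateBounds (targetRate r) C) (hpos : ∀ n, 0 < μ.real {n})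
    (hmoment : Summable fun n : ℕ => (n : ℝ) * μ.real {n}) (hr : ∀ k β, 1 ≤ k → 0 ≤ r k β)
    (hgrowth : ∀ α β : ℕ, ∑ k ∈ Finset.Icc 1 α, (k : ℝ) * r k β ≤ C * ((α : ℝ) + β))
    (hst : StepCondition (fun n => μ.real {n}) r)
    {f : stateSpace a → ℝ} (hf : IsLip a f) {B : ℝ} (hB : ∀ η, |f η| ≤ B) :
    ∫ η, generator p (targetRate r) f η ∂(stateMeasure a μ) = 0 := by
  set φ : ℕ → ℝ := fun α => ∑ k ∈ Finset.Icc 1 α, r k 0 with hφ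
  have i1 : Integrable φ μ := by
    refine ((integrable_cast hmoment).const_mul C).mono'
      (Measurable.of_discrete).aestronglyMeasurable (ae_of_all _ fun α => ?_)
    have h1 : 0 ≤ φ α := lossRate_nonneg hr (α, 0)
    have h2 : φ α ≤ C * ((α : ℝ) + (0 : ℕ)) := lossRate_le hr hgrowth (α, 0)
    rw [Real.norm_of_nonneg h1]
    simpa using h2
  set c := ∫ α, φ α ∂μ with hc
  -- Here the flux is `φ β - φ α`: the remainder is zero, and the one-site parts, centred by `c`,
  -- cancel at each site.
  have hs : IsCenteredSplitting μ (flux (fun n => μ.real {n}) r) (fun α => c - φ α)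
      (fun β => φ β - c) fun _ _ => 0 :=
    { eq := fun α β => by rw [flux_of_stepCondition hpos hst]; simp only [hφ]; ring
      integrable_left := (integrable_const c).sub i1
      integrable_right := i1.sub (integrable_const c)
      integral_left := by rw [integral_sub (integrable_const c) i1]; simp [hc]
      integral_right := by rw [integral_sub i1 (integrable_const c)]; simp [hc]
      integrable := integrable_const 0
      marginal_left := fun _ => by simp
      marginal_right := fun _ => by simp }
  refine tendsto_nhds_unique (tendsto_integral_generator_cutoff h hg hmoment hf) ?_
  refine tendsto_const_nhds.congr fun Λ => ?_
  rw [integral_generator_cylinder h hg hpos hmoment hr hgrowth hs hf hB Λ]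
  simp

omit [DecidableEq V] in
-- Configurations that differ at `x` are at distance at least `a x`, so the indicator jumps only at
-- a definite cost.
theorem isLip_ite (ha : ∀ x, 0 < a x) (u v : V) (α β : ℕ) :
    IsLip a fun ξ : stateSpace a => if ξ.1 u = α ∧ ξ.1 v = β then (1 : ℝ) else 0 := by
  refine ⟨1 / a u + 1 / a v, fun η ζ => ?_⟩
  have h0 := fun x => (ha x).le
  have hd := configDist_nonneg h0 η.1 ζ.1
  have h1 : ∀ x, η.1 x ≠ ζ.1 x → 1 ≤ 1 / a x * configDist a η.1 ζ.1 := by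
    intro x hx
    have h2 := (summable_abs_sub h0 η ζ).le_tsum x fun y _ => mul_nonneg (abs_nonneg _) (h0 y)
    have h3 : (1 : ℝ) ≤ |(η.1 x : ℝ) - ζ.1 x| := by
      have : (1 : ℤ) ≤ |(η.1 x : ℤ) - ζ.1 x| :=
        Int.one_le_abs (sub_ne_zero.2 (by exact_mod_cast hx))
      exact_mod_cast this
    rw [one_div, le_inv_mul_iff₀ (ha x), mul_one]
    exact (le_mul_of_one_le_left (h0 x) h3).trans h2
  have h4 : ∀ x, 0 ≤ 1 / a x * configDist a η.1 ζ.1 := fun x =>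
    mul_nonneg (one_div_nonneg.2 (h0 x)) hd
  rw [add_mul]
  by_cases hu : η.1 u = ζ.1 u
  · by_cases hv : η.1 v = ζ.1 v
    · simp only [hu, hv, sub_self, abs_zero]
      exact add_nonneg (h4 u) (h4 v)
    · refine le_trans ?_ ((h1 v hv).trans (le_add_of_nonneg_left (h4 u)))
      simp only
      split_ifs <;> simp
  · refine le_trans ?_ ((h1 u hu).trans (le_add_of_nonneg_right (h4 v)))
    simp only
    split_ifs <;> simp

theorem integral_ite_mul {u v : V} (huv : u ≠ v) (α β : ℕ) (G : ℕ × ℕ → ℝ) :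
    ∫ η, (if η u = α ∧ η v = β then (1 : ℝ) else 0) * G (η u, η v)
        ∂(Measure.infinitePi fun _ : V => μ) = (μ.prod μ).real {(α, β)} * G (α, β) := by
  have h1 := measurePreserving_pair μ huv
  have h2 : ∫ q, Set.indicator {(α, β)} G q ∂(μ.prod μ) = (μ.prod μ).real {(α, β)} * G (α, β) := by
    rw [integral_indicator (measurableSet_singleton _), integral_singleton, smul_eq_mul]
  rw [← h2, ← h1.map_eq, integral_map h1.measurable.aemeasurable
    (Measurable.of_discrete).aestronglyMeasurable]
  refine integral_congr_ae (ae_of_all _ fun η => ?_)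
  simp [Set.indicator_apply]

/-- If the mean of the generator vanishes, then the flux is a discrete gradient. -/
theorem stepCondition_of_integral_generator [Countable V] (h : AdmissibleKernel p a M)
    (hasym : ∃ x y, p x y ≠ p y x)
    (hg : RateBounds (targetRate r) C) (hpos : ∀ n, 0 < μ.real {n})
    (hmoment : Summable fun n : ℕ => (n : ℝ) * μ.real {n}) (hr : ∀ k β, 1 ≤ k → 0 ≤ r k β)
    (hgrowth : ∀ α β : ℕ, ∑ k ∈ Finset.Icc 1 α, (k : ℝ) * r k β ≤ C * ((α : ℝ) + β))
    (h0 : ∀ f : stateSpace a → ℝ, IsLip a f → (∃ B : ℝ, ∀ η, |f η| ≤ B) →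
      ∫ η, generator p (targetRate r) f η ∂(stateMeasure a μ) = 0) :
    StepCondition (fun n => μ.real {n}) r := by
  obtain ⟨u, v, huv⟩ := hasym
  have hne : u ≠ v := fun he => huv (by rw [he])
  obtain ⟨φ₁, φ₂, Ψ, hs⟩ := exists_isCenteredSplitting hpos
    (integrable_flux hpos hmoment hr hgrowth) (integral_flux hpos hmoment hr hgrowth)
  -- Test with the indicator of `η u = α`, `η v = β`, and divide by the positive mass of this event.
  have key : ∀ α β, (1 - p u u) * (φ₁ α + φ₂ α) + (1 - p v v) * (φ₁ β + φ₂ β) +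
      (p u v * Ψ α β + p v u * Ψ β α) = 0 := by
    intro α β
    set f : stateSpace a → ℝ := fun ξ => if ξ.1 u = α ∧ ξ.1 v = β then (1 : ℝ) else 0 with hf
    have hfl : IsLip a f := isLip_ite h.pos u v α β
    have hfB : ∀ η, |f η| ≤ 1 := fun η => by
      simp only [hf]
      split_ifs <;> simp
    have hfc : ∀ η, f (cutoff a {u, v} η) = if η u = α ∧ η v = β then (1 : ℝ) else 0 := fun η => by
      simp [hf, cutoff]
    have h1 := integral_generator_cylinder h hg hpos hmoment hr hgrowth hs hfl hfB {u, v}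
    have h2 : (fun ξ : stateSpace a => f (cutoff a {u, v} ξ.1)) = f := funext fun ξ => hfc ξ.1
    rw [h2, h0 f hfl ⟨1, hfB⟩] at h1
    simp_rw [hfc] at h1
    rw [Finset.sum_product] at h1
    simp only [Finset.sum_pair hne] at h1
    rw [integral_ite_mul hne α β fun q => φ₁ q.1 + φ₂ q.1,
      integral_ite_mul hne α β fun q => φ₁ q.2 + φ₂ q.2,
      integral_ite_mul hne α β fun q => Ψ q.1 q.2,
      integral_ite_mul hne α β fun q => Ψ q.2 q.1] at h1
    simp only [offDiag, if_true, if_neg hne, if_neg hne.symm, zero_mul, zero_add, add_zero] at h1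
    have h3 : (μ.prod μ).real {(α, β)} ≠ 0 := by
      rw [prod_real_singleton]
      exact (mul_pos (hpos _) (hpos _)).ne'
    refine (mul_eq_zero.1 (?_ : (μ.prod μ).real {(α, β)} * _ = 0)).resolve_left h3
    linarith
  have s1 : ∀ α, Integrable (fun β => Ψ α β) μ := forall_of_ae hpos hs.integrable.prod_right_ae
  have s2 : ∀ β, Integrable (fun α => Ψ α β) μ := forall_of_ae hpos hs.integrable.prod_left_ae
  -- Integrate `key` in `β`: all other terms are centred.
  have hsum : ∀ α, (1 - p u u) * (φ₁ α + φ₂ α) = 0 := by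
    intro α
    have i1 := (hs.integrable_left.add hs.integrable_right).const_mul (1 - p v v)
    have i2 := ((s1 α).const_mul (p u v)).add ((s2 α).const_mul (p v u))
    have h1 : ∫ β, ((1 - p v v) * (φ₁ β + φ₂ β) + (p u v * Ψ α β + p v u * Ψ β α)) ∂μ = 0 := by
      refine (integral_add i1 i2).trans ?_
      rw [integral_const_mul, integral_add' hs.integrable_left hs.integrable_right,
        integral_add' ((s1 α).const_mul _) ((s2 α).const_mul _), integral_const_mul,
        integral_const_mul, hs.integral_left, hs.integral_right, hs.marginal_left,
        hs.marginal_right]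
      simp
    have h2 : ∀ β, (1 - p v v) * (φ₁ β + φ₂ β) + (p u v * Ψ α β + p v u * Ψ β α) =
        -((1 - p u u) * (φ₁ α + φ₂ α)) := fun β => by linarith [key α β]
    simp_rw [h2] at h1
    simpa using h1
  -- If `p u u = 1`, the row and column sums at `u` force `p u v = 0 = p v u`, against asymmetry.
  have hρ : 1 - p u u ≠ 0 := by
    have h1 := (h.row u).summable.sum_le_tsum {u, v} fun y _ => h.nonneg u y
    have h2 := (h.col u).summable.sum_le_tsum {u, v} fun y _ => h.nonneg y u
    rw [Finset.sum_pair hne, (h.row u).tsum_eq] at h1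
    rw [Finset.sum_pair hne, (h.col u).tsum_eq] at h2
    intro h3
    have h4 := h.nonneg u v
    have h5 := h.nonneg v u
    exact huv (by linarith)
  have hφ : ∀ α, φ₁ α + φ₂ α = 0 := fun α => (mul_eq_zero.1 (hsum α)).resolve_left hρ
  -- `key` at `(α, β)` and at `(β, α)` is a linear system for `Ψ α β`, `Ψ β α` with determinant `p u
  -- v ^ 2 - p v u ^ 2`.
  have hΨ : ∀ α β, Ψ α β = 0 := by
    intro α β
    have h1 := key α β
    have h2 := key β α
    rw [hφ, hφ] at h1 h2
    have h3 : (p u v - p v u) * (p u v + p v u) * Ψ α β = 0 := by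
      linear_combination p u v * h1 - p v u * h2
    have h4 : p u v + p v u ≠ 0 := by
      have h4 := h.nonneg u v
      have h5 := h.nonneg v u
      exact fun h6 => huv (by linarith)
    exact (mul_eq_zero.1 h3).resolve_left (mul_ne_zero (sub_ne_zero.2 huv) h4)
  refine stepCondition_of_flux hpos (φ := φ₁) fun α β => ?_
  rw [hs.eq, hΨ]
  linarith [hφ β]

/-- Characterization of the invariant product measures. -/
theorem IsMarkovSemigroup.isInvariantMeasure_iff_stepCondition [Countable V]
    {S : ℝ → (stateSpace a → ℝ) → stateSpace a → ℝ}
    (hS : IsMarkovSemigroup a p (targetRate r) S) (h : AdmissibleKernel p a M)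
    (hasym : ∃ x y, p x y ≠ p y x)
    (hg : RateBounds (targetRate r) C) (hpos : ∀ n, 0 < μ.real {n})
    (hmoment : Summable fun n : ℕ => (n : ℝ) * μ.real {n}) (hr : ∀ k β, 1 ≤ k → 0 ≤ r k β) :
    IsInvariantMeasure a S (Measure.infinitePi fun _ : V => μ) ↔
      StepCondition (fun n => μ.real {n}) r := by
  have hgrowth : ∀ α β : ℕ, ∑ k ∈ Finset.Icc 1 α, (k : ℝ) * r k β ≤ C * ((α : ℝ) + β) := by
    intro α β
    refine (Finset.sum_le_sum fun k hk => le_of_eq ?_).trans (hg.growth α β)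
    rw [targetRate, if_pos (Finset.mem_Icc.1 hk)]
  rw [hS.isInvariantMeasure_iff h hg hmoment]
  exact ⟨stepCondition_of_integral_generator h hasym hg hpos hmoment hr hgrowth,
    fun hst f hf ⟨B, hB⟩ => integral_generator_eq_zero h hg hpos hmoment hr hgrowth hst hf hB⟩

theorem rateBounds_targetRate (hr : ∀ k β, 1 ≤ k → 0 ≤ r k β) (hC : 0 < C)
    (hgrowth : ∀ α β : ℕ, 0 < α →
      ∑ k ∈ Finset.Icc 1 α, (k : ℝ) * targetRate r k α β ≤ C * ((α : ℝ) + β)) :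
    RateBounds (targetRate r) C where
  nonneg k α β := by
    unfold targetRate
    split_ifs with hk
    · exact hr k β hk.1
    · exact le_rfl
  supp k α β hk := if_neg fun h => by omega
  pos := hC
  growth α β := by
    rcases Nat.eq_zero_or_pos α with rfl | hα
    · simpa using mul_nonneg hC.le (Nat.cast_nonneg β)
    · exact hgrowth α β hα

/-- Translation invariance makes the column of `y` a reindexing of the row of `0` by `x ↦ y - x`, so
`p` is doubly stochastic. -/
theorem IsTransitionProbability.exists_admissibleKernel {G : Type*} [AddCommGroup G]
    {p : G → G → ℝ} {a : G → ℝ} (hp : IsTransitionProbability p)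
    (htrans : ∀ x y z, p (x + z) (y + z) = p x y) (ha : IsWeight p a) :
    ∃ M, AdmissibleKernel p a M := by
  obtain ⟨M, hM⟩ := ha.bound
  have h0 : ∀ x, 0 ≤ ∑' y, p x y * a y := fun x =>
    tsum_nonneg fun y => mul_nonneg (hp.nonneg x y) (ha.pos y).le
  have h1 : ∀ x, 0 ≤ ∑' y, a y * p y x := fun x =>
    tsum_nonneg fun y => mul_nonneg (ha.pos y).le (hp.nonneg y x)
  have h2 : ∀ x, M * a x ≤ max M 1 * a x := fun x =>
    mul_le_mul_of_nonneg_right (le_max_left M 1) (ha.pos x).le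
  -- The maximum with `1` makes the constant positive, as the resolvent parameter `(2 M)⁻¹`
  -- requires.
  refine ⟨max M 1, hp.nonneg, hp.hasSum_one, fun y => ?_, ha.pos, ha.summable,
    lt_max_of_lt_right one_pos, fun x => by linarith [hM x, h1 x, h2 x],
    fun x => by linarith [hM x, h0 x, h2 x]⟩
  have h3 := (Equiv.subLeft y).hasSum_iff.2 (hp.hasSum_one 0)
  convert! h3 using 1
  funext x
  have := htrans 0 (y - x) x
  rwa [zero_add, sub_add_cancel] at this

end TestFunctions

end MassMigration

/-! ### The characterization and the construction together. -/

open MassMigration in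
theorem theorem3p13 {d : ℕ}
    (p : (Fin d → ℤ) → (Fin d → ℤ) → ℝ) (hp : IsTransitionProbability p)
    (hirr : IsIrreducible p)
    (htrans : ∀ x y z, p (x + z) (y + z) = p x y)
    (hasym : ∃ x y, p x y ≠ p y x)
    (a : (Fin d → ℤ) → ℝ) (ha : IsWeight p a)
    (r : ℕ → ℕ → ℝ) (hr : ∀ k β, 1 ≤ k → 0 ≤ r k β)
    (hgrowth : LinearGrowth (targetRate r))
    (μ : Measure ℕ) [IsProbabilityMeasure μ]
    (hpos : ∀ n, 0 < μ.real {n})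
    (hmoment : Summable fun n : ℕ => (n : ℝ) * μ.real {n}) :
    (∀ S : ℝ → (stateSpace a → ℝ) → stateSpace a → ℝ,
      IsMarkovSemigroup a p (targetRate r) S →
        (IsInvariantMeasure a S (Measure.infinitePi fun _ : Fin d → ℤ => μ) ↔
          ∀ α β : ℕ, 1 ≤ α → 1 ≤ β →
            r α β = r α 0 + 1 / μ.real {β} *
              ∑ k ∈ Finset.Icc 1 β, H (fun n => μ.real {n}) α β k * r k 0)) ∧
    (LipschitzRates (targetRate r) →
      IsMarkovSemigroup a p (targetRate r) (limitSemigroup p (targetRate r)) ∧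
      ∀ f, IsLip a f → ∀ t, 0 ≤ t → ∀ η,
        Tendsto (fun Λ : Finset (Fin d → ℤ) => finiteSemigroup p (targetRate r) Λ t f η)
          atTop (𝓝 (limitSemigroup p (targetRate r) t f η))) := by
  obtain ⟨M, h⟩ := hp.exists_admissibleKernel htrans ha
  obtain ⟨C, hC, hgrowth⟩ := hgrowth
  have hg := rateBounds_targetRate hr hC hgrowth
  refine ⟨fun S hS => ?_, fun ⟨D, hD, hL⟩ => ?_⟩
  · rw [hS.isInvariantMeasure_iff_stepCondition h hasym hg hpos hmoment hr, stepCondition_iff hpos]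
  · exact ⟨isMarkovSemigroup_limitSemigroup h hg hL hD.le,
      fun f hf t ht η => tendsto_limitSemigroup h hg hL hD.le hf ht η⟩
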